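/- **Setting.** Let $(\nu_t)_{t\in\mathbb Z}$ be i.i.d. errors with a known law and let $(\tilde\nu_t)_{t\in\mathbb Z}$ be simulated i.i.d. errors with the same law. For $\theta$ in $\Theta\subset\mathbb R^{d_\theta}$ put $$y_{t}(\theta)=r(\varphi(\nu_t,\nu_{t-1},\dots;\theta);\theta),\qquad z_{u,t}(\theta)=\zeta(u;\nu_t,\nu_{t-1},\dots;\theta)\in\mathbb R^{d_z},$$ with $r,\varphi$ real valued, all functions measurable (a function of $\nu_t$ only is a special case), and let $\tilde y_{t}(\theta),\tilde z_{u,t}(\theta)$ be defined in the same way from $\tilde\nu$. Let $\theta_0:[0,1]\to\Theta$ be the true function, and write $y_{u,t}=y_t(\theta_0(u))$, $z_{u,t}=z_{u,t}(\theta_0(u))$. The observations $(Y_{t,T},Z_{t,T})\in\mathbb R\times\mathbb R^{d_z}$, $1\le t\le T$, $T\ge1$, form a triangular array. Let $\mathcal U=[\delta,1-\delta]$ with a fixed $\delta\in[0,1/2)$ (the case $\delta=0$ contains every trimming $[\delta_T,1-\delta_T]$ with $\delta_T\to0$), let $\Gamma\subset\mathbb R^{d_\rho}$, and let $$M_T[\rho;u]=\frac1{Th}\sum_{t=1}^T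 g[Y_{t,T};f(Z_{t,T},\rho)]\,K\!\Big(\frac{u-t/T}{h}\Big),\quad \tilde M_T[\rho;u,\theta]=\frac1T\sum_{t=1}^T g[\tilde y_{t}(\theta);f(\tilde z_{u,t}(\theta),\rho)].$$ Let $\hat\rho(u)$ and $\hat\rho(u;\theta)$ be minimizers over $\rho\in\Gamma$ of $M_T[\rho;u]$ and $\tilde M_T[\rho;u,\theta]$. Assume that $\mathbb M_0[\rho;u]=\lim_T E M_T[\rho;u]$ exists for $\rho$ in an open convex set $O\supset\Gamma$ on which $f(z,\cdot)$ is defined, that $\tilde{\mathbb M}_0[\rho;u,\theta]=\lim_T E\tilde M_T[\rho;u,\theta]$ exists with finite expectations for $\rho\in\Gamma$, and that $\rho_0(u)$ and $\rho_0(u;\theta)$ are the unique minimizers over $\Gamma$ of $\mathbb M_0[\cdot;u]$ and $\tilde{\mathbb M}_0[\cdot;u,\theta]$, for $u\in\mathcal U$, $\theta\in\Theta$. For some $\varepsilon_0>0$ put $\mathcal E(u)=\{\rho\in\Gamma:\|\rho-\rho_0(u)\|\le\varepsilon_0\}$. **Assumption 1.** $\theta_0$ is continuous on $[0,1]$ and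 twice differentiable on $(0,1)$ with bounded second derivative. On an open neighbourhood of $\Theta$, $r(e;\cdot)$ for every $e$ and $\varphi(x;\cdot)$ for almost every history $x$ of the errors are $C^2$ in $\theta$, with second derivatives bounded on $\Theta$ uniformly in $e$, $x$; $r$ is jointly continuous; $\zeta(u;x;\theta)$ is continuous in $(u,\theta)\in[0,1]\times\Theta$ for almost every $x$. **Assumption 2.** (i) $(Y_{t,T},Z_{t,T})$ is locally stationary with stationary approximation $(y_{u,t},z_{u,t})$: almost surely $\|(Y_{t,T},Z_{t,T})-(y_{t/T,t},z_{t/T,t})\|\le C_T/T$ for all $1\le t\le T$, where $\sup_TE|C_T|^\eta<\infty$ for some $\eta>0$ (for the first component this holds with zero error if $Y_{t,T}=r(\epsilon_{t,T};\theta_0(t/T))$, $\epsilon_{t,T}=\varphi(\nu_t,\nu_{t-1},\dots;\theta_0(t/T))$). Its $\phi$-mixing coefficients $\phi(k)=\sup|P(B|A)-P(B)|$, the supremum being over all $T$, $t$, all events $A$ with $P(A)>0$ generated by $(Y_{i,T},Z_{i,T})_{i\le t}$ and all events $B$ generated by $(Y_{i,T},Z_{i,T})_{i\ge t+k}$, tend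 to $0$, and there are integers $1\le m_T\le T$ with $\sup_TT\phi(m_T)/m_T<\infty$. (ii) For every $\theta\in\Theta$, $y_{t}(\theta)$ is square integrable with constant mean and shift-invariant covariances. **Assumption 3.** There is $b$ with $|f(z,\rho_1)-f(z,\rho_2)|\le b(z)\|\rho_1-\rho_2\|$ on $\Gamma$. (i) $(y,z,\rho)\mapsto g[y;f(z,\rho)]$ is $C^2$ on $\mathbb R\times\mathbb R^{d_z}\times O$ with bounded first and second derivatives, and $\sup_{\rho\in\mathcal E(u)}E|g[Y_{t,T};f(Z_{t,T},\rho)]|<\infty$ for all $u\in\mathcal U$, $t$, $T$. (ii) $f(\cdot,\rho)$ is measurable; for $u\in\mathcal U$, $f(z,\cdot)$ is twice differentiable at every $\rho\in\mathcal E(u)$, $\sup_{\rho\in\mathcal E(u)}E|f(Z_{t,T},\rho)|<\infty$, and there is $\bar f$ with $f(z,\rho)\le\bar f(z)$ for all $\rho\in\mathcal E(u)$ and $E|\bar f(Z_{t,T})|<\infty$. (iii) The score $q(y,z,\rho)=\partial_\rho\, g[y;f(z,\rho)]$ is strictly monotone near the pseudo-true values: every $c\in\{\rho_0(u),\rho_0(u;\theta):u\in\mathcal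 U,\theta\in\Theta\}$ has a neighbourhood $N_c=\{\rho\in\Gamma:\|\rho-c\|\le\varepsilon_c\}$, $\varepsilon_c>0$, that is convex (as it is for small $\varepsilon_c$ if $\Gamma$ is convex or $c$ is an interior point of $\Gamma$) and such that $\langle q(y,z,\rho_1)-q(y,z,\rho_2),\rho_1-\rho_2\rangle>0$ for all $y$, $z$ and all $\rho_1\ne\rho_2$ in $N_c$. (iv) For $u\in\mathcal U$, $\mathbb M_0[\cdot;u]$ is differentiable at the points of $\Gamma$, $\rho_0(u)$ is the unique zero in $\Gamma$ of its gradient, and for every $\varepsilon>0$ there is $\eta>0$ with $\mathbb M_0[\rho;u]-\mathbb M_0[\rho_0(u);u]\ge\eta$ for all $\rho\in\Gamma$ with $\|\rho-\rho_0(u)\|>\varepsilon$. (v) For every $\varepsilon>0$ there are $a_1,a_2>0$ with $|Eg[y_{u_1,t};f(z_{u_1,t},\rho_1)]-Eg[y_{u_2,t};f(z_{u_2,t},\rho_2)]|\le\varepsilon$ whenever $u_1,u_2\in\mathcal U$, $|u_1-u_2|\le a_1$, $\rho_1\in\mathcal E(u_1)$, $\rho_2\in\Gamma$, $\|\rho_1-\rho_2\|\le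 a_2$. (vi) For every $u\in\mathcal U$, $\theta\mapsto\rho_0(u;\theta)$ is continuous and injective on $\Theta$. (vii) $\Gamma$ and $\Theta$ are compact and $d_\rho\ge d_\theta$. **Assumption 4.** (i) $K\ge0$ is symmetric, bounded, Lipschitz, and $k$ times continuously differentiable for some $k\ge2$; $\int K=1$, $\int K^2<\infty$; either $K$ has compact support, or $|K'|\le C$ and $|K'(x)|\le C|x|^{-v}$ for $|x|>L$, for some $v>1$ and $L>0$; $\int x^iK(x)dx=0$ for $1\le i<k$, $\int x^kK(x)dx\ne0$, $\int|x|^k|K(x)|dx<\infty$, $|x|K(x)\to0$ as $|x|\to\infty$. (ii) $h=h_T>0$, $h\to0$, $Th\to\infty$ and $Th/(m_T\log T)\to\infty$. **Theorem 1.** Under Assumptions 1–4 minimizers $\hat\rho(u)$ and $\hat\rho(u;\theta)$ exist for all $T$, $u\in\mathcal U$, $\theta\in\Theta$, and with probability one they are, for all sufficiently large $T$, unique for all $u\in\mathcal U$ and $\theta\in\Theta$ simultaneously. Moreover, for every choice of the minimizers, as $T\to\infty$, $$\sup_{u\in\mathcal U}\|\hat\rho(u)-\rho_0(u)\|=o_p(1),\qquad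 \sup_{u\in\mathcal U}\sup_{\theta\in\Theta}\|\hat\rho(u;\theta)-\rho_0(u;\theta)\|=o_p(1).$$ -/

import Mathlib

open MeasureTheory ProbabilityTheory Filter Topology Set
open scoped ENNReal

noncomputable section

namespace LII

/-- Euclidean space of dimension `n`. -/
abbrev Euc (n : ℕ) := EuclideanSpace ℝ (Fin n)

/-- The history `(x t, x (t-1), x (t-2), …)` of a two-sided sequence at time `t`. -/
def hist {S : Type*} (x : ℤ → S) (t : ℤ) : ℕ → S := fun j => x (t - j)

/-- The raw objects of the model (their properties are the assumptions below).
* `P` is the probability; `Q` the known law of one structural error; `ν`, `νsim` are the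
  structural errors behind the observed data and the simulated errors;
* `r`, `φ` are the structural functions, `ζ` the function which generates the stationary
  regressors; `φ` and `ζ` may depend on the current and on all past errors (as a moving average
  or an autoregressive volatility does);
* `θ₀` is the unknown function of rescaled time, with values in `Θ`;
* `Y T t`, `Z T t`, `1 ≤ t ≤ T`, are the observed triangular arrays;
* `g`, `f` are the auxiliary criterion and regression functions, `Γ` is the auxiliary parameter
  space, and `O` is a neighbourhood of `Γ` on which `f z` is defined;
* `K`, `h` are the kernel and the bandwidth;
* `δ` is the trimming constant of the interval `[δ, 1 - δ]` of rescaled time points; `δ = 0` is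
  allowed, so that a statement about all of `[0, 1]`, hence about any `[δ_T, 1 - δ_T]` with
  `δ_T → 0`, is included. -/
structure Setup (Ω S : Type*) [MeasurableSpace Ω] [MeasurableSpace S] (dθ dρ dz : ℕ) where
  P : Measure Ω
  Q : Measure S
  ν : ℤ → Ω → S
  νsim : ℤ → Ω → S
  r : ℝ → Euc dθ → ℝ
  φ : (ℕ → S) → Euc dθ → ℝ
  ζ : ℝ → (ℕ → S) → Euc dθ → Euc dz
  Θ : Set (Euc dθ)
  θ₀ : ℝ → Euc dθ
  Y : ℕ → ℕ → Ω → ℝ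
  Z : ℕ → ℕ → Ω → Euc dz
  g : ℝ → ℝ → ℝ
  f : Euc dz → Euc dρ → ℝ
  Γ : Set (Euc dρ)
  O : Set (Euc dρ)
  K : ℝ → ℝ
  h : ℕ → ℝ
  δ : ℝ

variable {Ω S : Type*} [MeasurableSpace Ω] [MeasurableSpace S] {dθ dρ dz : ℕ}

/-! ### Stationarity, local stationarity, mixing -/

/-- Strict stationarity of a process indexed by the integers. -/
def IsStationary {E : Type*} [MeasurableSpace E] (P : Measure Ω) (x : ℤ → Ω → E) : Prop :=
  ∀ m : ℤ, P.map (fun ω t => x (t + m) ω) = P.map (fun ω t => x t ω)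

/-- The triangular array `X T t`, `1 ≤ t ≤ T`, is locally stationary with the stationary
approximations `x u`, `u ∈ [0,1]`:
almost surely `max_{1 ≤ t ≤ T} ‖X T t - x (t/T) t‖ ≤ C_T / T` where `sup_T E |C_T|^η < ∞`
for some `η > 0`. -/
def IsLocallyStationary {E : Type*} [NormedAddCommGroup E] [MeasurableSpace E]
    (P : Measure Ω) (X : ℕ → ℕ → Ω → E) (x : ℝ → ℤ → Ω → E) : Prop :=
  (∀ u ∈ Icc (0 : ℝ) 1, IsStationary P (x u)) ∧
  ∃ (C : ℕ → Ω → ℝ) (η : ℝ) (B : ℝ), 0 < η ∧ (∀ T, Measurable (C T)) ∧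
    (∀ T, 1 ≤ T → ∫⁻ ω, ENNReal.ofReal (|C T ω| ^ η) ∂P ≤ ENNReal.ofReal B) ∧
    (∀ T, 1 ≤ T → ∀ᵐ ω ∂P, ∀ t ∈ Finset.Icc 1 T,
      ‖X T t ω - x ((t : ℝ) / T) (t : ℤ) ω‖ ≤ C T ω / T)

/-- The σ-field generated by the row variables `X T i`, `1 ≤ i ≤ T`, with `a ≤ i ≤ b`. -/
abbrev rowField {E : Type*} [mE : MeasurableSpace E] (X : ℕ → ℕ → Ω → E) (T a b : ℕ) :
    MeasurableSpace Ω :=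
  ⨆ i ∈ {i : ℕ | 1 ≤ i ∧ i ≤ T ∧ a ≤ i ∧ i ≤ b}, MeasurableSpace.comap (X T i) mE

/-- The `φ`-mixing coefficient of a triangular array:
the supremum of `|P(B | A) - P(B)|` over all rows `T`, all `t`, all events `A` of positive
probability determined by the row up to time `t` and all events `B` determined by the row from
time `t + k` on. -/
def phiCoef {E : Type*} [MeasurableSpace E] (P : Measure Ω) (X : ℕ → ℕ → Ω → E) (k : ℕ) : ℝ :=
  sSup {x : ℝ | ∃ (T t : ℕ) (A B : Set Ω), 1 ≤ T ∧ t ≤ T ∧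
    MeasurableSet[rowField X T 1 t] A ∧ MeasurableSet[rowField X T (t + k) T] B ∧
    0 < P.real A ∧ x = |P.real (A ∩ B) / P.real A - P.real B|}

/-! ### Processes and criteria -/

namespace Setup

variable (M : Setup Ω S dθ dρ dz)

/-- The set of rescaled time points `[δ, 1 - δ]`. -/
def U : Set ℝ := Icc M.δ (1 - M.δ)

/-- The stationary structural process driven by the errors `e`, at the parameter `θ`. -/
def y (e : ℤ → Ω → S) (θ : Euc dθ) (t : ℤ) (ω : Ω) : ℝ :=
  M.r (M.φ (hist (fun s => e s ω) t) θ) θ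

/-- The stationary regressors driven by the errors `e`, at rescaled time `u`, parameter `θ`. -/
def z (e : ℤ → Ω → S) (u : ℝ) (θ : Euc dθ) (t : ℤ) (ω : Ω) : Euc dz :=
  M.ζ u (hist (fun s => e s ω) t) θ

/-- The auxiliary criterion of one observation. -/
def G (y : ℝ) (z : Euc dz) (ρ : Euc dρ) : ℝ := M.g y (M.f z ρ)

/-- The score: the gradient in `ρ` of the criterion of one observation. -/
def q (y : ℝ) (z : Euc dz) (ρ : Euc dρ) : Euc dρ := gradient (fun ρ' => M.G y z ρ') ρ

/-- The local criterion `M_T[ρ; u]` of the observed data. -/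
def crit (T : ℕ) (ω : Ω) (u : ℝ) (ρ : Euc dρ) : ℝ :=
  1 / (T * M.h T) * ∑ t ∈ Finset.Icc 1 T,
    M.G (M.Y T t ω) (M.Z T t ω) ρ * M.K ((u - (t : ℝ) / T) / M.h T)

/-- The criterion of the simulated data. -/
def simCrit (T : ℕ) (ω : Ω) (u : ℝ) (θ : Euc dθ) (ρ : Euc dρ) : ℝ :=
  1 / (T : ℝ) * ∑ t ∈ Finset.Icc 1 T, M.G (M.y M.νsim θ t ω) (M.z M.νsim u θ t ω) ρ

/-- `ρ` minimizes `F` over the auxiliary parameter space. -/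
def IsArgmin (F : Euc dρ → ℝ) (ρ : Euc dρ) : Prop := ρ ∈ M.Γ ∧ ∀ ρ' ∈ M.Γ, F ρ ≤ F ρ'

/-- The neighbourhood `{ρ ∈ Γ : ‖ρ - c‖ ≤ ε}` of `c`. -/
def nbhd (c : Euc dρ) (ε : ℝ) : Set (Euc dρ) := {ρ ∈ M.Γ | ‖ρ - c‖ ≤ ε}

/-- `M₀[ρ; u] = lim_T E M_T[ρ; u]`. -/
def IsLimitCrit (M₀ : Euc dρ → ℝ → ℝ) : Prop :=
  ∀ u ∈ M.U, ∀ ρ ∈ M.O, Tendsto (fun T => ∫ ω, M.crit T ω u ρ ∂M.P) atTop (𝓝 (M₀ ρ u))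

/-- `M̃₀[ρ; u] = lim_T T⁻¹ ∑ E g[ỹ_{u,t}(θ); f(z̃_{u,t}(θ), ρ)]`, the expectations being finite. -/
def IsSimLimitCrit (M₀s : Euc dρ → ℝ → Euc dθ → ℝ) : Prop :=
  ∀ u ∈ M.U, ∀ θ ∈ M.Θ, ∀ ρ ∈ M.Γ,
    (∀ t : ℤ, Integrable (fun ω => M.G (M.y M.νsim θ t ω) (M.z M.νsim u θ t ω) ρ) M.P) ∧
    Tendsto (fun T : ℕ => 1 / (T : ℝ) * ∑ t ∈ Finset.Icc 1 T,
      ∫ ω, M.G (M.y M.νsim θ (t : ℤ) ω) (M.z M.νsim u θ (t : ℤ) ω) ρ ∂M.P)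
      atTop (𝓝 (M₀s ρ u θ))

/-- The score is strictly monotone in `ρ`, in a (convex) neighbourhood of `c` in `Γ`. The
neighbourhood is convex as soon as `Γ` is convex or `c` is an interior point of `Γ`. -/
def ScoreStrictMonoNear (c : Euc dρ) : Prop :=
  ∃ ε > 0, Convex ℝ (M.nbhd c ε) ∧ ∀ (y : ℝ) (z : Euc dz),
    ∀ ρ₁ ∈ M.nbhd c ε, ∀ ρ₂ ∈ M.nbhd c ε, ρ₁ ≠ ρ₂ →
      0 < inner ℝ (M.q y z ρ₁ - M.q y z ρ₂) (ρ₁ - ρ₂)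

/-! ### Assumptions -/

/-- Measurability, and the ranges of the parameters. -/
structure Basic : Prop where
  prob : IsProbabilityMeasure M.P
  meas_Y : ∀ T t, Measurable (M.Y T t)
  meas_Z : ∀ T t, Measurable (M.Z T t)
  meas_φ : ∀ θ ∈ M.Θ, Measurable (fun x => M.φ x θ)
  meas_ζ : ∀ u ∈ Icc (0 : ℝ) 1, ∀ θ ∈ M.Θ, Measurable (fun x => M.ζ u x θ)
  θ₀_mem : ∀ u ∈ Icc (0 : ℝ) 1, M.θ₀ u ∈ M.Θ
  δ_nonneg : 0 ≤ M.δ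
  δ_lt : M.δ < 1 / 2
  open_O : IsOpen M.O
  convex_O : Convex ℝ M.O
  Γ_sub_O : M.Γ ⊆ M.O

/-- Strong white noise with marginal law `Q`. -/
structure IsNoise (e : ℤ → Ω → S) : Prop where
  meas : ∀ t, Measurable (e t)
  indep : iIndepFun e M.P
  law : ∀ t, M.P.map (e t) = M.Q

/-- The law of the history of the errors. -/
def histLaw : Measure (ℕ → S) := M.P.map (fun ω => hist (fun s => M.ν s ω) 0)

/-- The structural model. -/
structure StructuralAssumption : Prop where
  /-- `θ₀` has uniformly bounded second derivatives, and is continuous up to the endpoints -/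
  θ₀_diff : ∀ u ∈ Ioo (0 : ℝ) 1, DifferentiableAt ℝ M.θ₀ u ∧ DifferentiableAt ℝ (deriv M.θ₀) u
  θ₀_bdd : ∃ C, ∀ u ∈ Ioo (0 : ℝ) 1, ‖deriv (deriv M.θ₀) u‖ ≤ C
  θ₀_cont : ContinuousOn M.θ₀ (Icc 0 1)
  /-- `r` and `φ` are twice continuously differentiable in `θ` on a neighbourhood `V` of `Θ`,
  with uniformly bounded second derivatives; `r` is jointly continuous, and the regressors depend
  continuously on `(u, θ)` -/
  smooth : ∃ (V : Set (Euc dθ)) (C : ℝ), IsOpen V ∧ M.Θ ⊆ V ∧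
    ContinuousOn (fun p : ℝ × Euc dθ => M.r p.1 p.2) (univ ×ˢ V) ∧
    (∀ e, ContDiffOn ℝ 2 (M.r e) V ∧ ∀ θ ∈ M.Θ, ‖iteratedFDeriv ℝ 2 (M.r e) θ‖ ≤ C) ∧
    (∀ᵐ x ∂M.histLaw, ContDiffOn ℝ 2 (M.φ x) V ∧ ∀ θ ∈ M.Θ, ‖iteratedFDeriv ℝ 2 (M.φ x) θ‖ ≤ C)
  ζ_cont : ∀ᵐ x ∂M.histLaw,
    ContinuousOn (fun p : ℝ × Euc dθ => M.ζ p.1 x p.2) (Icc 0 1 ×ˢ M.Θ)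
  /-- the errors are white noise with a known law, from which the simulated errors are
  drawn -/
  noise : M.IsNoise M.ν
  noise_sim : M.IsNoise M.νsim

/-- The observed pair `(Y, Z)`. -/
def YZ (T t : ℕ) (ω : Ω) : ℝ × Euc dz := (M.Y T t ω, M.Z T t ω)

/-- The stationary approximation `(y_{u,t}, z_{u,t})` of the data, at the true parameter `θ₀ u`. -/
def yz (u : ℝ) (t : ℤ) (ω : Ω) : ℝ × Euc dz :=
  (M.y M.ν (M.θ₀ u) t ω, M.z M.ν u (M.θ₀ u) t ω)

/-- Local stationarity, `φ`-mixing (with the sequence `m`), and weak stationarity. The observations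
need not be exactly `Y T t = r (φ (ν t, ν (t-1), …) (θ₀ (t/T))) (θ₀ (t/T))`; with this equality
the first component of `locStat` holds with error zero. -/
structure DependenceAssumption (m : ℕ → ℕ) : Prop where
  locStat : IsLocallyStationary M.P M.YZ M.yz
  mixing : Tendsto (phiCoef M.P M.YZ) atTop (𝓝 0)
  m_range : ∀ T, 1 ≤ T → 1 ≤ m T ∧ m T ≤ T
  mixing_rate : ∃ C : ℝ, ∀ T : ℕ, 1 ≤ T → T * phiCoef M.P M.YZ (m T) / m T ≤ C
  /-- weak stationarity of the structural process at every parameter value -/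
  moment : ∀ θ ∈ M.Θ, ∀ t, MemLp (M.y M.ν θ t) 2 M.P
  mean_const : ∀ θ ∈ M.Θ, ∃ C, ∀ t, ∫ ω, M.y M.ν θ t ω ∂M.P = C
  cov_shift : ∀ θ ∈ M.Θ, ∀ t s k : ℤ,
    covariance (M.y M.ν θ t) (M.y M.ν θ s) M.P =
      covariance (M.y M.ν θ (t + k)) (M.y M.ν θ (s + k)) M.P

/-- The auxiliary model. `ε₀` is the radius of the local neighbourhoods of the pseudo-true
values `ρ₀ u`; `ρ₀s u θ` is the pseudo-true value of the simulated data. -/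
structure AuxiliaryAssumption (M₀ : Euc dρ → ℝ → ℝ) (ρ₀ : ℝ → Euc dρ) (ρ₀s : ℝ → Euc dθ → Euc dρ)
    (ε₀ : ℝ) : Prop where
  ε₀_pos : 0 < ε₀
  /-- `f` belongs to the class of regression functions which are locally Lipschitz in `ρ` -/
  f_lip : ∃ b : Euc dz → ℝ, ∀ z, ∀ ρ₁ ∈ M.Γ, ∀ ρ₂ ∈ M.Γ,
    |M.f z ρ₁ - M.f z ρ₂| ≤ b z * ‖ρ₁ - ρ₂‖
  /-- `g[y; f(z, ρ)]` is twice continuously differentiable in `(y, z, ρ)`, with bounded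
  derivatives (so that the score is bounded and is differentiable in `ρ`) -/
  G_smooth : ContDiffOn ℝ 2 (fun p : ℝ × Euc dz × Euc dρ => M.G p.1 p.2.1 p.2.2)
    (univ ×ˢ univ ×ˢ M.O)
  G_bdd : ∃ C, ∀ p ∈ (univ ×ˢ univ ×ˢ M.O : Set (ℝ × Euc dz × Euc dρ)),
    ‖fderiv ℝ (fun p : ℝ × Euc dz × Euc dρ => M.G p.1 p.2.1 p.2.2) p‖ ≤ C ∧
    ‖iteratedFDeriv ℝ 2 (fun p : ℝ × Euc dz × Euc dρ => M.G p.1 p.2.1 p.2.2) p‖ ≤ C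
  G_int : ∀ u ∈ M.U, ∀ T, ∀ t ∈ Finset.Icc 1 T, ∃ C, ∀ ρ ∈ M.nbhd (ρ₀ u) ε₀,
    Integrable (fun ω => M.G (M.Y T t ω) (M.Z T t ω) ρ) M.P ∧
      ∫ ω, |M.G (M.Y T t ω) (M.Z T t ω) ρ| ∂M.P ≤ C
  /-- regularity and envelope of `f` near the pseudo-true values -/
  f_meas : ∀ ρ ∈ M.Γ, Measurable (fun z => M.f z ρ)
  f_diff : ∀ u ∈ M.U, ∀ ρ ∈ M.nbhd (ρ₀ u) ε₀, ∀ z,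
    DifferentiableAt ℝ (M.f z) ρ ∧ DifferentiableAt ℝ (fderiv ℝ (M.f z)) ρ
  f_int : ∀ u ∈ M.U, ∀ T, ∀ t ∈ Finset.Icc 1 T, ∃ C, ∀ ρ ∈ M.nbhd (ρ₀ u) ε₀,
    Integrable (fun ω => M.f (M.Z T t ω) ρ) M.P ∧ ∫ ω, |M.f (M.Z T t ω) ρ| ∂M.P ≤ C
  f_env : ∀ u ∈ M.U, ∃ fbar : Euc dz → ℝ, (∀ ρ ∈ M.nbhd (ρ₀ u) ε₀, ∀ z, M.f z ρ ≤ fbar z) ∧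
    ∀ T, ∀ t ∈ Finset.Icc 1 T, Integrable (fun ω => fbar (M.Z T t ω)) M.P
  /-- strict monotonicity of the score near the pseudo-true values -/
  score_mono : ∀ u ∈ M.U, M.ScoreStrictMonoNear (ρ₀ u)
  score_mono_sim : ∀ u ∈ M.U, ∀ θ ∈ M.Θ, M.ScoreStrictMonoNear (ρ₀s u θ)
  /-- identification of the pseudo-true value -/
  unique_zero : ∀ u ∈ M.U, ∀ ρ ∈ M.Γ, DifferentiableAt ℝ (fun ρ' => M₀ ρ' u) ρ ∧
    (gradient (fun ρ' => M₀ ρ' u) ρ = 0 ↔ ρ = ρ₀ u)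
  separated : ∀ u ∈ M.U, ∀ ε > 0, ∃ η > 0, ∀ ρ ∈ M.Γ, ε < ‖ρ - ρ₀ u‖ → η ≤ M₀ ρ u - M₀ (ρ₀ u) u
  /-- equicontinuity of the expected criterion -/
  equicont : ∀ ε > 0, ∃ a₁ > 0, ∃ a₂ > 0, ∀ u₁ ∈ M.U, ∀ ρ₁ ∈ M.nbhd (ρ₀ u₁) ε₀,
    ∀ u₂ ∈ M.U, |u₂ - u₁| ≤ a₁ → ∀ ρ₂ ∈ M.Γ, ‖ρ₂ - ρ₁‖ ≤ a₂ → ∀ t : ℤ,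
      |(∫ ω, M.G (M.yz u₁ t ω).1 (M.yz u₁ t ω).2 ρ₁ ∂M.P)
        - ∫ ω, M.G (M.yz u₂ t ω).1 (M.yz u₂ t ω).2 ρ₂ ∂M.P| ≤ ε
  /-- the binding function -/
  binding_cont : ∀ u ∈ M.U, ContinuousOn (ρ₀s u) M.Θ
  binding_inj : ∀ u ∈ M.U, InjOn (ρ₀s u) M.Θ
  /-- parameter spaces -/
  compact_Γ : IsCompact M.Γ
  compact_Θ : IsCompact M.Θ
  dim_le : dθ ≤ dρ

/-- The kernel, of order `k ≥ 2`, and the bandwidth. -/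
structure KernelAssumption (m : ℕ → ℕ) (k : ℕ) : Prop where
  nonneg : ∀ x, 0 ≤ M.K x
  symm : ∀ x, M.K (-x) = M.K x
  bounded : ∃ C, ∀ x, M.K x ≤ C
  two_le : 2 ≤ k
  smooth : ContDiff ℝ k M.K
  integrable : Integrable M.K
  integral_one : ∫ x, M.K x = 1
  sq_integrable : Integrable (fun x => M.K x ^ 2)
  tail : (∃ L : ℝ, ∀ x, L < |x| → M.K x = 0) ∨
    ∃ C L v : ℝ, 0 < L ∧ 1 < v ∧ (∀ x, |deriv M.K x| ≤ C) ∧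
      ∀ x, L < |x| → |deriv M.K x| ≤ C * |x| ^ (-v)
  moments_zero : ∀ i, 1 ≤ i → i < k → ∫ x, x ^ i * M.K x = 0
  moment_ne : ∫ x, x ^ k * M.K x ≠ 0
  moment_int : Integrable (fun x => |x| ^ k * |M.K x|)
  decay : Tendsto (fun x => |x| * M.K x) (cocompact ℝ) (𝓝 0)
  lipschitz : ∃ C, ∀ x x', |M.K x - M.K x'| ≤ C * |x - x'|
  h_pos : ∀ T, 1 ≤ T → 0 < M.h T
  h_zero : Tendsto M.h atTop (𝓝 0)
  Th_top : Tendsto (fun T : ℕ => T * M.h T) atTop atTop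
  Th_rate : Tendsto (fun T : ℕ => T * M.h T / (m T * Real.log T)) atTop atTop

end Setup

/-- `X_T = o_p(1)` for nonnegative, possibly infinite `X_T` (with the outer probability, if `X_T`
is not measurable). -/
def IsLittleOp (P : Measure Ω) (X : ℕ → Ω → ℝ≥0∞) : Prop :=
  ∀ ε : ℝ≥0∞, 0 < ε → Tendsto (fun T => P {ω | ε ≤ X T ω}) atTop (𝓝 0)

end LII

end

/-! A minimizer depends only on differences of the criterion, so the argument works throughout with
increments from a fixed reference point `b` of `Γ`. Since the criterion has bounded first
derivatives and `Γ` is compact, these increments are bounded and Lipschitz even where the criterion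
itself is unbounded. The expected increment at the stationary pair, `meanIncr`, is jointly
continuous on a compact set and serves as the limit object.

The core is deterministic. If a random criterion orders the points of `Γ` as `meanIncr` does, up to
any error η > 0 and uniformly in the index, then compactness and uniqueness of the limiting
minimizer (`exists_separation`) force every minimizer close to it (`AsympSure.argmin_dist_lt`). Two
minimizers at one index then lie in a common neighbourhood where the score is strictly monotone,
hence coincide (`AsympSure.argmin_unique`).

For the simulated data the ordering (`simCrit_order`) comes from a uniform strong law for functions
of the whole history of white noise. Functions of finitely many coordinates reduce to the classical
strong law along arithmetic progressions; the maximal ergodic inequality extends this by L¹ density;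
oscillations on small balls make it uniform (`asympSure_uniform_average`).

For the observed data (`crit_order`) the increment splits into a centred part and a mean. The
centred part is controlled by an exponential inequality for alternating blocks of a φ-mixing row,
with tails of order T⁻⁵ against a grid of about T³ points (`asympSure_centered`). In the mean, local
stationarity and the localization by the kernel leave `meanIncr` times the total kernel weight
(`kernel_average_meanIncr`). That weight need not tend to one near the ends of [0, 1], but it stays
between positive constants, which is enough for the ordering. Identification of `ρ₀ u` is
transferred from the limit criterion to `meanIncr` in `eq_of_meanIncr_le`.

All random statements are phrased through `AsympSure`, which yields both almost sure eventual
validity and vanishing outer probability of failure, without measurability of the events concerned.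
-/

namespace LII

/-! ### Asymptotically sure events -/

/-- `p T ω` holds for all large `T` outside measurable exceptional sets which almost every `ω`
eventually leaves. -/
def AsympSure {Ω : Type*} [MeasurableSpace Ω] (P : Measure Ω) (p : ℕ → Ω → Prop) : Prop :=
  ∃ A : ℕ → Set Ω, (∀ T, MeasurableSet (A T)) ∧ (∀ᵐ ω ∂P, ∀ᶠ T in atTop, ω ∉ A T) ∧
    ∀ᶠ T in atTop, ∀ ω, ω ∉ A T → p T ω

namespace AsympSure

variable {Ω : Type*} [MeasurableSpace Ω] {P : Measure Ω} {p q : ℕ → Ω → Prop}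

lemma mono (hp : AsympSure P p) (h : ∀ᶠ T in atTop, ∀ ω, p T ω → q T ω) : AsympSure P q := by
  obtain ⟨A, hA, hA', hp⟩ := hp
  refine ⟨A, hA, hA', ?_⟩
  filter_upwards [hp, h] with T h1 h2 ω hω using h2 ω (h1 ω hω)

lemma forall_finset {ι : Type*} (s : Finset ι) {p : ι → ℕ → Ω → Prop}
    (hp : ∀ i ∈ s, AsympSure P (p i)) : AsympSure P (fun T ω => ∀ i ∈ s, p i T ω) := by
  choose! A hA hA' hp using hp
  refine ⟨fun T => ⋃ i ∈ s, A i T, fun T => s.measurableSet_biUnion fun i hi => hA i hi T, ?_, ?_⟩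
  · have := (ae_ball_iff s.countable_toSet).2 hA'
    filter_upwards [this] with ω hω
    have := (s.eventually_all (l := atTop)).2 hω
    filter_upwards [this] with T hT
    simpa using hT
  · have := (s.eventually_all (l := atTop)).2 hp
    filter_upwards [this] with T hT ω hω i hi
    exact hT i hi ω fun h => hω (by simp only [mem_iUnion]; exact ⟨i, hi, h⟩)

lemma and (hp : AsympSure P p) (hq : AsympSure P q) : AsympSure P (fun T ω => p T ω ∧ q T ω) := by
  refine (forall_finset Finset.univ (p := fun b : Bool => if b then p else q) ?_).mono
    (Eventually.of_forall fun T ω h => ?_)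
  · rintro (_ | _) _ <;> simpa
  · exact ⟨by simpa using h true, by simpa using h false⟩

lemma of_ae {p : Ω → Prop} (hp : ∀ᵐ ω ∂P, p ω) : AsympSure P (fun _ => p) := by
  obtain ⟨N, hN, hNm, hN0⟩ := exists_measurable_superset_of_null (ae_iff.1 hp)
  refine ⟨fun _ => N, fun _ => hNm, ?_, Eventually.of_forall fun T ω hω => ?_⟩
  · filter_upwards [measure_eq_zero_iff_ae_notMem.1 hN0] with ω hω using Eventually.of_forall fun _ => hω
  · by_contra h
    exact hω (hN h)

lemma ae_eventually (hp : AsympSure P p) : ∀ᵐ ω ∂P, ∀ᶠ T in atTop, p T ω := by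
  obtain ⟨A, hA, hA', hp⟩ := hp
  filter_upwards [hA'] with ω hω
  filter_upwards [hω, hp] with T h1 h2 using h2 ω h1

/-- The indicators of the exceptional sets tend to zero almost everywhere, hence so do their
probabilities. The failure event is only contained in such a set and need not be measurable. -/
lemma tendsto_measure_not [IsFiniteMeasure P] (hp : AsympSure P p) :
    Tendsto (fun T => P {ω | ¬ p T ω}) atTop (𝓝 0) := by
  obtain ⟨A, hA, hA', hp⟩ := hp
  have h0 : Tendsto (fun T => P (A T)) atTop (𝓝 (P ∅)) := by
    refine tendsto_measure_of_ae_tendsto_indicator_of_isFiniteMeasure (L := atTop)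
      MeasurableSet.empty hA ?_
    filter_upwards [hA'] with ω hω
    filter_upwards [hω] with T hT
    simp [hT]
  rw [measure_empty] at h0
  refine tendsto_of_tendsto_of_tendsto_of_le_of_le' tendsto_const_nhds h0
    (Eventually.of_forall fun _ => zero_le) ?_
  filter_upwards [hp] with T hT
  refine measure_mono fun ω hω => ?_
  by_contra h
  exact hω (hT ω h)

/-- Borel–Cantelli, applied after a shift of the index because the bound holds only from some `T₀`
on. -/
lemma of_summable {A : ℕ → Set Ω} (hA : ∀ T, MeasurableSet (A T)) {b : ℕ → ℝ} (hb : Summable b)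
    (hAb : ∀ᶠ T in atTop, P (A T) ≤ ENNReal.ofReal (b T))
    (h : ∀ᶠ T in atTop, ∀ ω, ω ∉ A T → p T ω) : AsympSure P p := by
  obtain ⟨T₀, hT₀⟩ := eventually_atTop.1 hAb
  refine ⟨A, hA, ?_, h⟩
  have hs : ∑' T, P (A (T + T₀)) ≠ ∞ := by
    refine ne_top_of_le_ne_top ?_ (ENNReal.tsum_le_tsum fun T => hT₀ (T + T₀) (by omega))
    exact ((summable_nat_add_iff T₀).2 hb).tsum_ofReal_ne_top
  filter_upwards [ae_eventually_notMem hs] with ω hω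
  obtain ⟨n, hn⟩ := eventually_atTop.1 hω
  filter_upwards [eventually_ge_atTop (n + T₀)] with T hT
  simpa [Nat.sub_add_cancel (show T₀ ≤ T by omega)] using hn (T - T₀) (by omega)

end AsympSure

/-! ### Argmins over a compact parameter space -/

section Argmin

variable {E F : Type*} [PseudoMetricSpace E] [MetricSpace F]

/-- A unique minimizer of a jointly continuous family on a compact set is separated from the other
points, uniformly in the parameter of the family. -/
lemma exists_separation {X : Set E} {Γ : Set F} (hX : IsCompact X) (hΓ : IsCompact Γ)
    {e : E → F → ℝ} (he : ContinuousOn (fun p : E × F => e p.1 p.2) (X ×ˢ Γ)) {ρ₀ : E → F}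
    (hρ₀ : ∀ x ∈ X, ρ₀ x ∈ Γ) (hmin : ∀ x ∈ X, ∀ ρ ∈ Γ, e x ρ ≤ e x (ρ₀ x) → ρ = ρ₀ x)
    {ε : ℝ} (hε : 0 < ε) :
    ∃ η > 0, ∀ x ∈ X, ∀ ρ ∈ Γ, e x ρ ≤ e x (ρ₀ x) + η → dist ρ (ρ₀ x) < ε := by
  by_contra! hcon
  have hpos : ∀ n : ℕ, (0 : ℝ) < 1 / (n + 1) := fun n => Nat.one_div_pos_of_nat
  choose x hx ρ hρ hle hfar using fun n : ℕ => hcon _ (hpos n)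
  -- Continuity of `ρ₀` is not known here. Its values are therefore extracted as a third convergent
  -- component, whose limit `c` is identified with `ρ₀ a` afterwards.
  obtain ⟨⟨a, b, c⟩, ⟨ha, hb, hc⟩, s, hs, hlim⟩ :=
    (hX.prod (hΓ.prod hΓ)).tendsto_subseq (x := fun n => (x n, ρ n, ρ₀ (x n)))
      (fun n => ⟨hx n, hρ n, hρ₀ _ (hx n)⟩)
  have hxa : Tendsto (fun n => x (s n)) atTop (𝓝 a) := (continuous_fst.tendsto _).comp hlim
  have hρb : Tendsto (fun n => ρ (s n)) atTop (𝓝 b) :=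
    ((continuous_fst.comp continuous_snd).tendsto _).comp hlim
  have hρc : Tendsto (fun n => ρ₀ (x (s n))) atTop (𝓝 c) :=
    ((continuous_snd.comp continuous_snd).tendsto _).comp hlim
  have key : ∀ {r : ℕ → F} {d : F}, Tendsto r atTop (𝓝 d) → (∀ n, r n ∈ Γ) → d ∈ Γ →
      Tendsto (fun n => e (x (s n)) (r n)) atTop (𝓝 (e a d)) := by
    intro r d hr hrΓ hd
    have h1 := he (a, d) ⟨ha, hd⟩
    refine Tendsto.comp (f := fun n => (x (s n), r n)) h1 ?_
    exact tendsto_nhdsWithin_iff.2 ⟨hxa.prodMk_nhds hr,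
      Eventually.of_forall fun n => ⟨hx _, hrΓ n⟩⟩
  have heb := key hρb (fun n => hρ _) hb
  have hec := key hρc (fun n => hρ₀ _ (hx _)) hc
  have h0 : Tendsto (fun n => (1 : ℝ) / ((s n : ℝ) + 1)) atTop (𝓝 0) :=
    tendsto_one_div_add_atTop_nhds_zero_nat.comp hs.tendsto_atTop
  have hbc : e a b ≤ e a c := by
    refine le_of_tendsto_of_tendsto heb (by simpa only [add_zero] using hec.add h0) ?_
    exact Eventually.of_forall fun n => hle (s n)
  have hca : c = ρ₀ a := by
    refine hmin a ha c hc ?_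
    refine le_of_tendsto_of_tendsto hec (key (tendsto_const_nhds (x := ρ₀ a))
      (fun _ => hρ₀ a ha) (hρ₀ a ha)) (Eventually.of_forall fun n => ?_)
    by_contra! hlt
    have := hmin _ (hx (s n)) _ (hρ₀ a ha) hlt.le
    rw [this] at hlt
    exact lt_irrefl _ hlt
  have hba : b = ρ₀ a := hmin a ha b hb (hca ▸ hbc)
  have hd : Tendsto (fun n => dist (ρ (s n)) (ρ₀ (x (s n)))) atTop (𝓝 (dist b c)) := hρb.dist hρc
  have := ge_of_tendsto' hd fun n => hfar (s n)
  rw [hba, hca, dist_self] at this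
  linarith

/-- For `x'` near `x`, uniform continuity makes `ρ₀ x'` an almost minimizer of `e x`, so separation
places it near `ρ₀ x`. -/
lemma continuousOn_argmin {X : Set E} {Γ : Set F} (hX : IsCompact X) (hΓ : IsCompact Γ)
    {e : E → F → ℝ} (he : ContinuousOn (fun p : E × F => e p.1 p.2) (X ×ˢ Γ)) {ρ₀ : E → F}
    (hρ₀ : ∀ x ∈ X, ρ₀ x ∈ Γ) (hmin : ∀ x ∈ X, ∀ ρ ∈ Γ, e x ρ ≤ e x (ρ₀ x) → ρ = ρ₀ x) :
    ContinuousOn ρ₀ X := by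
  have hle : ∀ x ∈ X, ∀ ρ ∈ Γ, e x (ρ₀ x) ≤ e x ρ := by
    intro x hx ρ hρ
    by_contra! h
    rw [← hmin x hx ρ hρ h.le] at h
    exact lt_irrefl _ h
  rw [Metric.continuousOn_iff]
  intro x hx ε hε
  obtain ⟨η, hη, h⟩ := exists_separation hX hΓ he hρ₀ hmin hε
  have hu := (hX.prod hΓ).uniformContinuousOn_of_continuous he
  obtain ⟨δ, hδ, hu⟩ := Metric.uniformContinuousOn_iff.1 hu (η / 2) (by positivity)
  refine ⟨δ, hδ, fun x' hx' hd => h x hx _ (hρ₀ x' hx') ?_⟩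
  have h1 := hu (x', ρ₀ x') ⟨hx', hρ₀ x' hx'⟩ (x, ρ₀ x') ⟨hx, hρ₀ x' hx'⟩ (by simp [Prod.dist_eq, hd])
  have h2 := hu (x', ρ₀ x) ⟨hx', hρ₀ x hx⟩ (x, ρ₀ x) ⟨hx, hρ₀ x hx⟩ (by simp [Prod.dist_eq, hd])
  have h3 := hle x' hx' _ (hρ₀ x hx)
  rw [Real.dist_eq, abs_lt] at h1 h2
  simp only at h1 h2
  linarith [h1.1, h2.2]

end Argmin

/-- A function with a strictly monotone gradient on a convex set has at most one minimizer there. -/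
lemma minimizer_unique_of_gradient_strictMono {d : ℕ} {N : Set (Euc d)} (hN : Convex ℝ N)
    {F : Euc d → ℝ} {F' : Euc d → Euc d} (hF : ∀ ρ ∈ N, HasGradientAt F (F' ρ) ρ)
    (hmono : ∀ ρ₁ ∈ N, ∀ ρ₂ ∈ N, ρ₁ ≠ ρ₂ → 0 < inner ℝ (F' ρ₁ - F' ρ₂) (ρ₁ - ρ₂))
    {ρ₁ ρ₂ : Euc d} (h₁ : ρ₁ ∈ N) (h₂ : ρ₂ ∈ N) (hm₁ : ∀ ρ ∈ N, F ρ₁ ≤ F ρ)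
    (hm₂ : ∀ ρ ∈ N, F ρ₂ ≤ F ρ) : ρ₁ = ρ₂ := by
  by_contra hne
  -- The first-order variational inequality; minimizers may lie on the boundary, so the gradient
  -- need not vanish. Adding it at the two minimizers contradicts strict monotonicity.
  have key : ∀ a ∈ N, ∀ b ∈ N, (∀ ρ ∈ N, F a ≤ F ρ) → 0 ≤ inner ℝ (F' a) (b - a) := by
    intro a ha b hb hm
    have hmin : IsLocalMinOn F N a := (isMinOn_iff.2 hm).localize
    have := hmin.hasFDerivWithinAt_nonneg (hF a ha).hasFDerivAt.hasFDerivWithinAt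
      (sub_mem_posTangentConeAt_of_segment_subset (hN.segment_subset ha hb))
    simpa using this
  have h3 := key ρ₁ h₁ ρ₂ h₂ hm₁
  have h4 := key ρ₂ h₂ ρ₁ h₁ hm₂
  have h5 := hmono ρ₁ h₁ ρ₂ h₂ hne
  rw [inner_sub_left] at h5
  rw [← neg_sub ρ₁ ρ₂, inner_neg_right] at h3
  linarith

/-- Consistency of minimizers: if outside the exceptional sets the random criteria order the points
of `Γ` as the limit criterion does, up to any positive error, then their minimizers converge to the
unique minimizer of the limit criterion, uniformly. -/
lemma AsympSure.argmin_dist_lt {Ω E F : Type*} [MeasurableSpace Ω] {P : Measure Ω}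
    [PseudoMetricSpace E] [MetricSpace F] {X : Set E} {Γ : Set F} (hX : IsCompact X)
    (hΓ : IsCompact Γ) {e : E → F → ℝ}
    (he : ContinuousOn (fun p : E × F => e p.1 p.2) (X ×ˢ Γ)) {ρ₀ : E → F}
    (hρ₀ : ∀ x ∈ X, ρ₀ x ∈ Γ) (hmin : ∀ x ∈ X, ∀ ρ ∈ Γ, e x ρ ≤ e x (ρ₀ x) → ρ = ρ₀ x)
    {C : ℕ → Ω → E → F → ℝ}
    (hC : ∀ η > 0, AsympSure P fun T ω => ∀ x ∈ X, ∀ ρ ∈ Γ, ∀ ρ' ∈ Γ,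
      C T ω x ρ ≤ C T ω x ρ' → e x ρ ≤ e x ρ' + η) {ε : ℝ} (hε : 0 < ε) :
    AsympSure P fun T ω => ∀ x ∈ X, ∀ ρ ∈ Γ, (∀ ρ' ∈ Γ, C T ω x ρ ≤ C T ω x ρ') →
      dist ρ (ρ₀ x) < ε := by
  obtain ⟨η, hη, h⟩ := exists_separation hX hΓ he hρ₀ hmin hε
  exact (hC η hη).mono (Eventually.of_forall fun T ω hT x hx ρ hρ hm =>
    h x hx ρ hρ (hT x hx ρ hρ _ (hρ₀ x hx) (hm _ (hρ₀ x hx))))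

/-- Uniqueness of minimizers: in the situation of `AsympSure.argmin_dist_lt`, local uniqueness near
the minimizers of the limit criterion implies uniqueness. -/
lemma AsympSure.argmin_unique {Ω E F : Type*} [MeasurableSpace Ω] {P : Measure Ω}
    [PseudoMetricSpace E] [MetricSpace F] {X : Set E} {Γ : Set F} (hX : IsCompact X)
    (hΓ : IsCompact Γ) {e : E → F → ℝ}
    (he : ContinuousOn (fun p : E × F => e p.1 p.2) (X ×ˢ Γ)) {ρ₀ : E → F}
    (hρ₀ : ∀ x ∈ X, ρ₀ x ∈ Γ) (hmin : ∀ x ∈ X, ∀ ρ ∈ Γ, e x ρ ≤ e x (ρ₀ x) → ρ = ρ₀ x)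
    {C : ℕ → Ω → E → F → ℝ}
    (hC : ∀ η > 0, AsympSure P fun T ω => ∀ x ∈ X, ∀ ρ ∈ Γ, ∀ ρ' ∈ Γ,
      C T ω x ρ ≤ C T ω x ρ' → e x ρ ≤ e x ρ' + η)
    {good : Set F → Prop} (hgood : ∀ x ∈ X, ∃ ε > 0, good {ρ ∈ Γ | dist ρ (ρ₀ x) ≤ ε})
    (hloc : ∀ᶠ T in atTop, ∀ ω, ∀ x ∈ X, ∀ N ⊆ Γ, good N → ∀ ρ₁ ∈ N, ∀ ρ₂ ∈ N,
      (∀ ρ ∈ N, C T ω x ρ₁ ≤ C T ω x ρ) → (∀ ρ ∈ N, C T ω x ρ₂ ≤ C T ω x ρ) → ρ₁ = ρ₂) :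
    AsympSure P fun T ω => ∀ x ∈ X, ∀ ρ₁ ∈ Γ, ∀ ρ₂ ∈ Γ, (∀ ρ ∈ Γ, C T ω x ρ₁ ≤ C T ω x ρ) →
      (∀ ρ ∈ Γ, C T ω x ρ₂ ≤ C T ω x ρ) → ρ₁ = ρ₂ := by
  choose! r hr hg using hgood
  have hcpt : IsCompact (ρ₀ '' X) :=
    hX.image_of_continuousOn (continuousOn_argmin hX hΓ he hρ₀ hmin)
  -- The radius of the good neighbourhood varies with the point. A Lebesgue number of the cover of
  -- the compact image of `ρ₀` gives one precision that works for all `x`.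
  obtain ⟨ε, hε, hsub⟩ := lebesgue_number_lemma_of_metric (c := fun x : X => Metric.ball (ρ₀ x) (r x))
    hcpt (fun _ => Metric.isOpen_ball) (by
      rintro _ ⟨x, hx, rfl⟩
      exact mem_iUnion.2 ⟨⟨x, hx⟩, Metric.mem_ball_self (hr x hx)⟩)
  refine (AsympSure.argmin_dist_lt hX hΓ he hρ₀ hmin hC hε).mono ?_
  filter_upwards [hloc] with T hT ω hω x hx ρ₁ h₁ ρ₂ h₂ hm₁ hm₂
  obtain ⟨⟨x', hx'⟩, hball⟩ := hsub (ρ₀ x) (mem_image_of_mem _ hx)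
  have hmem : ∀ ρ ∈ Γ, (∀ ρ' ∈ Γ, C T ω x ρ ≤ C T ω x ρ') →
      ρ ∈ {ρ ∈ Γ | dist ρ (ρ₀ x') ≤ r x'} := fun ρ hρ hm =>
    ⟨hρ, (Metric.mem_ball.1 (hball (Metric.mem_ball.2 (hω x hx ρ hρ hm)))).le⟩
  exact hT ω x hx _ (fun ρ hρ => hρ.1) (hg x' hx') ρ₁ (hmem ρ₁ h₁ hm₁) ρ₂ (hmem ρ₂ h₂ hm₂)
    (fun ρ hρ => hm₁ ρ hρ.1) (fun ρ hρ => hm₂ ρ hρ.1)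

end LII

namespace LII

/-! ### The maximal ergodic inequality -/

section MaximalErgodic

variable {X : Type*} {τ : X → X} {f : X → ℝ}

/-- The maximum of `0` and the first `N` Birkhoff sums. -/
def maxBirkhoff (τ : X → X) (f : X → ℝ) : ℕ → X → ℝ
  | 0 => 0
  | N + 1 => fun x => max 0 (f x + maxBirkhoff τ f N (τ x))

lemma maxBirkhoff_nonneg (N : ℕ) (x : X) : 0 ≤ maxBirkhoff τ f N x := by
  cases N with
  | zero => exact le_rfl
  | succ N => exact le_max_left _ _

lemma maxBirkhoff_le_succ (N : ℕ) (x : X) : maxBirkhoff τ f N x ≤ maxBirkhoff τ f (N + 1) x := by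
  induction N generalizing x with
  | zero => exact maxBirkhoff_nonneg _ _
  | succ N ih => exact max_le_max le_rfl (by simpa using ih (τ x))

lemma maxBirkhoff_mono (x : X) : Monotone fun N => maxBirkhoff τ f N x :=
  monotone_nat_of_le_succ fun N => maxBirkhoff_le_succ N x

lemma birkhoffSum_le_maxBirkhoff (N : ℕ) (x : X) :
    birkhoffSum τ f N x ≤ maxBirkhoff τ f N x := by
  induction N generalizing x with
  | zero => simp [maxBirkhoff]
  | succ N ih =>
    rw [birkhoffSum_succ']
    exact le_max_of_le_right (by simpa using ih (τ x))

variable [MeasurableSpace X] {μ : Measure X}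

lemma measurable_maxBirkhoff (hτ : Measurable τ) (hf : Measurable f) (N : ℕ) :
    Measurable (maxBirkhoff τ f N) := by
  induction N with
  | zero => exact measurable_const
  | succ N ih => exact measurable_const.max (hf.add (ih.comp hτ))

lemma integrable_maxBirkhoff (hτ : MeasurePreserving τ μ μ) (hf : Integrable f μ) (N : ℕ) :
    Integrable (maxBirkhoff τ f N) μ := by
  induction N with
  | zero => exact integrable_zero _ _ _
  | succ N ih =>
    have := (hf.add (hτ.integrable_comp_of_integrable ih)).pos_part
    refine this.congr (Eventually.of_forall fun x => ?_)
    simp [maxBirkhoff, max_comm]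

/-- The maximal ergodic theorem. -/
lemma setIntegral_maxBirkhoff_pos_nonneg (hτ : MeasurePreserving τ μ μ) (hf : Integrable f μ)
    (hfm : Measurable f) (N : ℕ) : 0 ≤ ∫ x in {x | 0 < maxBirkhoff τ f N x}, f x ∂μ := by
  have hm := measurable_maxBirkhoff hτ.measurable hfm N
  have hi := integrable_maxBirkhoff hτ hf N
  have hi' : Integrable (fun x => maxBirkhoff τ f N (τ x)) μ := hτ.integrable_comp_of_integrable hi
  have hs : MeasurableSet {x | 0 < maxBirkhoff τ f N x} := measurableSet_lt measurable_const hm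
  have heq : ∫ x, maxBirkhoff τ f N (τ x) ∂μ = ∫ x, maxBirkhoff τ f N x ∂μ := by
    conv_rhs => rw [← hτ.map_eq]
    rw [integral_map hτ.aemeasurable hm.aestronglyMeasurable]
  rw [← integral_indicator hs]
  have h0 : 0 = ∫ x, (maxBirkhoff τ f N x - maxBirkhoff τ f N (τ x)) ∂μ := by
    rw [integral_sub hi hi', heq, sub_self]
  -- Garsia's argument: where the maximum is positive, the recursion and monotonicity in `N` give
  -- max − max ∘ τ ≤ f; elsewhere the left side is at most zero. Invariance makes its integral
  -- vanish.
  refine h0.trans_le (integral_mono (hi.sub hi') (hf.indicator hs) fun x => ?_)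
  by_cases hx : 0 < maxBirkhoff τ f N x
  · rw [indicator_of_mem (by exact hx)]
    cases N with
    | zero => exact absurd hx (lt_irrefl _)
    | succ N =>
      have h1 : maxBirkhoff τ f (N + 1) x = f x + maxBirkhoff τ f N (τ x) := by
        have h2 : maxBirkhoff τ f (N + 1) x = max 0 (f x + maxBirkhoff τ f N (τ x)) := rfl
        rw [h2] at hx ⊢
        exact max_eq_right_of_lt (by simpa using hx)
      have := maxBirkhoff_le_succ (τ := τ) (f := f) N (τ x)
      simp only
      linarith
  · rw [indicator_of_notMem (by exact hx)]
    have := maxBirkhoff_nonneg (τ := τ) (f := f) N (τ x)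
    simp only
    linarith

/-- The weak type inequality for the maximal function of the Birkhoff averages. -/
lemma measure_exists_birkhoffSum_gt_le [IsProbabilityMeasure μ] (hτ : MeasurePreserving τ μ μ)
    (hf : Integrable f μ) (hfm : Measurable f) (hf0 : ∀ x, 0 ≤ f x) {c : ℝ} (hc : 0 < c) :
    μ {x | ∃ n : ℕ, c * n < birkhoffSum τ f n x} ≤ ENNReal.ofReal ((∫ x, f x ∂μ) / c) := by
  -- A Birkhoff sum of `f` exceeds `c * n` exactly when that of `f - c` is positive.
  set g : X → ℝ := fun x => f x - c with hg
  have hgi : Integrable g μ := hf.sub (integrable_const c)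
  have hgm : Measurable g := hfm.sub_const c
  set A : ℕ → Set X := fun N => {x | 0 < maxBirkhoff τ g N x} with hA
  have hsum : ∀ n x, birkhoffSum τ g n x = birkhoffSum τ f n x - c * n := by
    intro n x
    simp [birkhoffSum, hg, Finset.sum_sub_distrib, mul_comm]
  have hsub : {x | ∃ n : ℕ, c * n < birkhoffSum τ f n x} ⊆ ⋃ N, A N := by
    rintro x ⟨n, hn⟩
    refine mem_iUnion.2 ⟨n, lt_of_lt_of_le ?_ (birkhoffSum_le_maxBirkhoff n x)⟩
    rw [hsum]; linarith
  have hmono : Monotone A := fun M N h x hx => lt_of_lt_of_le hx (maxBirkhoff_mono x h)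
  refine (measure_mono hsub).trans ?_
  rw [hmono.measure_iUnion]
  refine iSup_le fun N => ?_
  have hs : MeasurableSet (A N) :=
    measurableSet_lt measurable_const (measurable_maxBirkhoff hτ.measurable hgm N)
  have h1 := setIntegral_maxBirkhoff_pos_nonneg hτ hgi hgm N
  have h2 : ∫ x in A N, g x ∂μ = (∫ x in A N, f x ∂μ) - c * μ.real (A N) := by
    rw [hg, integral_sub hf.integrableOn (integrable_const c).integrableOn]
    simp [mul_comm]
  have h3 : ∫ x in A N, f x ∂μ ≤ ∫ x, f x ∂μ :=
    setIntegral_le_integral hf (Eventually.of_forall hf0)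
  rw [← ofReal_measureReal]
  refine ENNReal.ofReal_le_ofReal ?_
  rw [le_div_iff₀ hc]
  have h4 : (0 : ℝ) ≤ ∫ x in A N, g x ∂μ := h1
  linarith

/-- The set of integrable functions which satisfy the strong law of large numbers along the orbits
of `τ` is closed in `L¹`. -/
lemma tendsto_birkhoffSum_of_approx [IsProbabilityMeasure μ] (hτ : MeasurePreserving τ μ μ)
    (hf : Integrable f μ) (hfm : Measurable f)
    (happrox : ∀ ε > 0, ∃ g : X → ℝ, Measurable g ∧ Integrable g μ ∧ ∫ x, |f x - g x| ∂μ ≤ ε ∧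
      ∀ᵐ x ∂μ, Tendsto (fun n : ℕ => birkhoffSum τ g n x / n) atTop (𝓝 (∫ x, g x ∂μ))) :
    ∀ᵐ x ∂μ, Tendsto (fun n : ℕ => birkhoffSum τ f n x / n) atTop (𝓝 (∫ x, f x ∂μ)) := by
  have key : ∀ η > 0, ∀ᵐ x ∂μ, ∀ᶠ n : ℕ in atTop,
      |birkhoffSum τ f n x / n - ∫ x, f x ∂μ| ≤ 3 * η := by
    intro η hη
    rw [ae_iff]
    refine le_antisymm (ENNReal.le_of_forall_pos_le_add fun ε hε _ => ?_) zero_le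
    rw [zero_add]
    have hε' : (0 : ℝ) < ε := hε
    -- The bound η controls the difference of the two integrals; the bound ηε makes the maximal
    -- inequality at level η give probability at most ε. The third η is the convergence error of
    -- `g`.
    obtain ⟨g, hgm, hg, hfg, hlim⟩ := happrox (min η (η * ε)) (lt_min hη (mul_pos hη hε'))
    have hfgi : Integrable (fun x => |f x - g x|) μ := (hf.sub hg).abs
    have hmax := measure_exists_birkhoffSum_gt_le hτ hfgi (hfm.sub hgm).abs
      (fun x => abs_nonneg _) hη
    have hle : ENNReal.ofReal ((∫ x, |f x - g x| ∂μ) / η) ≤ ε := by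
      rw [← ENNReal.ofReal_coe_nnreal]
      refine ENNReal.ofReal_le_ofReal ?_
      rw [div_le_iff₀ hη, mul_comm]
      exact hfg.trans (min_le_right _ _)
    refine le_trans ?_ (hmax.trans hle)
    refine measure_mono_ae ?_
    filter_upwards [hlim] with x hx hbad
    by_contra hgood
    refine hbad ?_
    have hgood : ∀ n : ℕ, birkhoffSum τ (fun x => |f x - g x|) n x ≤ η * n := by
      intro n
      by_contra! h
      exact hgood ⟨n, h⟩
    filter_upwards [(Metric.tendsto_nhds.1 hx) η hη, eventually_gt_atTop 0] with n hn hn0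
    have hn0' : (0 : ℝ) < n := by exact_mod_cast hn0
    rw [Real.dist_eq] at hn
    have h1 : |birkhoffSum τ f n x / n - birkhoffSum τ g n x / n| ≤ η := by
      rw [← sub_div, abs_div, Nat.abs_cast, div_le_iff₀ hn0']
      refine le_trans ?_ (hgood n)
      rw [birkhoffSum, birkhoffSum, ← Finset.sum_sub_distrib]
      exact Finset.abs_sum_le_sum_abs _ _
    have h2 : |(∫ x, f x ∂μ) - ∫ x, g x ∂μ| ≤ η := by
      rw [← integral_sub hf hg]
      exact (abs_integral_le_integral_abs).trans (hfg.trans (min_le_left _ _))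
    rw [abs_le] at h1 h2 ⊢
    rw [abs_lt] at hn
    constructor <;> linarith [h1.1, h1.2, h2.1, h2.2, hn.1, hn.2]
  have key' : ∀ᵐ x ∂μ, ∀ k : ℕ, ∀ᶠ n : ℕ in atTop,
      |birkhoffSum τ f n x / n - ∫ x, f x ∂μ| ≤ 3 * (1 / ((k : ℝ) + 1)) :=
    ae_all_iff.2 fun k => key _ Nat.one_div_pos_of_nat
  filter_upwards [key'] with x hx
  rw [Metric.tendsto_nhds]
  intro ε hε
  obtain ⟨k, hk⟩ := exists_nat_one_div_lt (show 0 < ε / 3 by positivity)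
  filter_upwards [hx k] with n hn
  rw [Real.dist_eq]
  linarith

end MaximalErgodic

end LII

namespace LII

/-! ### The strong law of large numbers for functions of the history of white noise -/

section Bernoulli

variable {S : Type*} [MeasurableSpace S]

/-- The shift of two-sided sequences. -/
def shift (x : ℤ → S) : ℤ → S := fun t => x (t + 1)

/-- The σ-field of the coordinates in `I`. -/
@[reducible]
def coordField (S : Type*) [mS : MeasurableSpace S] (I : Set ℤ) : MeasurableSpace (ℤ → S) :=
  ⨆ i ∈ I, MeasurableSpace.comap (fun x => x i) mS

lemma coordField_le (I : Set ℤ) : coordField S I ≤ MeasurableSpace.pi :=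
  iSup₂_le fun i _ => (measurable_pi_apply i).comap_le

lemma coordField_mono {I J : Set ℤ} (h : I ⊆ J) : coordField S I ≤ coordField S J :=
  biSup_mono h

lemma shift_iterate {S : Type*} (n : ℕ) (x : ℤ → S) : shift^[n] x = fun t => x (t + n) := by
  induction n generalizing x with
  | zero => simp
  | succ n ih =>
    rw [Function.iterate_succ_apply, ih]
    funext t
    simp [shift, add_assoc]

lemma measurable_shift_iterate_coordField (n : ℕ) (I J : Set ℤ) (h : ∀ i ∈ I, i + n ∈ J) :
    @Measurable _ _ (coordField S J) (coordField S I) (shift^[n]) := by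
  refine measurable_iff_comap_le.2 ?_
  rw [coordField, MeasurableSpace.comap_iSup]
  refine iSup_le fun i => ?_
  rw [MeasurableSpace.comap_iSup]
  refine iSup_le fun hi => ?_
  rw [MeasurableSpace.comap_comp]
  have : (fun x : ℤ → S => x i) ∘ shift^[n] = fun x => x (i + n) := by
    funext x; simp [shift_iterate]
  rw [this]
  exact le_iSup₂_of_le (i + (n : ℤ)) (h i hi) le_rfl

variable (Q : Measure S) [IsProbabilityMeasure Q]

/-- The law of two-sided white noise. -/
noncomputable def noiseLaw : Measure (ℤ → S) := Measure.infinitePi fun _ => Q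

instance : IsProbabilityMeasure (noiseLaw Q) := by unfold noiseLaw; infer_instance

lemma measurePreserving_shift : MeasurePreserving shift (noiseLaw Q) (noiseLaw Q) :=
  ⟨measurable_pi_lambda _ fun t => measurable_pi_apply (t + 1),
    Measure.map_infinitePi_infinitePi_of_inj (P := fun _ : ℤ => Q) (add_left_injective (1 : ℤ))⟩

lemma indep_coordField {I J : Set ℤ} (h : Disjoint I J) :
    Indep (coordField S I) (coordField S J) (noiseLaw Q) :=
  indep_iSup_of_disjoint (fun i => (measurable_pi_apply i).comap_le)
    ((iIndepFun_infinitePi (P := fun _ : ℤ => Q) (X := fun _ x => x) fun _ => measurable_id).iIndep)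
    h

/-- Shifts by multiples of 2m + 1 involve disjoint sets of coordinates, so along each residue class
the terms are pairwise independent and identically distributed. The strong law holds on each of the
finitely many classes, and the incomplete last block is negligible. -/
lemma tendsto_birkhoffSum_of_coordField {m : ℕ} {g : (ℤ → S) → ℝ} {B : ℝ}
    (hg : Measurable[coordField S {i | |i| ≤ m}] g) (hB : ∀ x, |g x| ≤ B) :
    ∀ᵐ x ∂noiseLaw Q, Tendsto (fun n : ℕ => birkhoffSum shift g n x / n) atTop
      (𝓝 (∫ x, g x ∂noiseLaw Q)) := by
  set c := ∫ x, g x ∂noiseLaw Q with hc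
  have hgm : Measurable g := hg.mono (coordField_le _) le_rfl
  have hgi : Integrable g (noiseLaw Q) :=
    Integrable.of_bound hgm.aestronglyMeasurable B (Eventually.of_forall hB)
  set l : ℕ := 2 * m + 1 with hl
  have hpres := fun n => (measurePreserving_shift Q).iterate n
  have hres : ∀ r : ℕ, ∀ᵐ x ∂noiseLaw Q,
      Tendsto (fun n : ℕ => (∑ q ∈ Finset.range n, g (shift^[l * q + r] x)) / n) atTop (𝓝 c) := by
    intro r
    have hid : ∀ k, IdentDistrib (fun x => g (shift^[k] x)) g (noiseLaw Q) (noiseLaw Q) := fun k =>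
      ⟨(hgm.comp (hpres k).measurable).aemeasurable, hgm.aemeasurable, by
        change (noiseLaw Q).map (g ∘ shift^[k]) = _
        rw [← Measure.map_map hgm (hpres k).measurable, (hpres k).map_eq]⟩
    have h := strong_law_ae_real (μ := noiseLaw Q) (fun q x => g (shift^[l * q + r] x))
      ((hid _).integrable_iff.2 hgi) ?_ (fun i => (hid _).trans (hid _).symm)
    · have h2 : ∫ x, g (shift^[l * 0 + r] x) ∂noiseLaw Q = c := (hid _).integral_eq
      rwa [h2] at h
    · intro p q hpq
      have hmeas : ∀ k : ℕ, Measurable[coordField S {i | |i - k| ≤ m}] fun x => g (shift^[k] x) :=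
        fun k => hg.comp (measurable_shift_iterate_coordField k _ _ fun i hi => by simpa using hi)
      refine (IndepFun_iff_Indep _ _ _).2 (indep_of_indep_of_le_left (indep_of_indep_of_le_right
        (indep_coordField Q ?_) (hmeas (l * q + r)).comap_le) (hmeas (l * p + r)).comap_le)
      rw [Set.disjoint_left]
      intro i h1 h2
      simp only [mem_ofPred_eq, abs_le] at h1 h2
      push_cast at h1 h2
      rcases lt_or_gt_of_ne hpq with h | h
      · have : (l : ℤ) * p + l ≤ l * q := by
          have : ((p : ℤ) + 1) ≤ q := by exact_mod_cast h
          nlinarith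
        push_cast [hl] at this h1 h2
        linarith [h1.2, h2.1]
      · have : (l : ℤ) * q + l ≤ l * p := by
          have : ((q : ℤ) + 1) ≤ p := by exact_mod_cast h
          nlinarith
        push_cast [hl] at this h1 h2
        linarith [h1.1, h2.2]
  have hlpos : 0 < l := by omega
  have hB0 : 0 ≤ B := by
    obtain ⟨x⟩ := Measure.nonempty_of_neZero (noiseLaw Q)
    exact (abs_nonneg _).trans (hB x)
  filter_upwards [ae_all_iff.2 hres] with x hx
  -- The complete blocks are regrouped by residue class modulo `l`.
  have hblock : ∀ N, birkhoffSum shift g (l * N) x =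
      ∑ r ∈ Finset.range l, ∑ q ∈ Finset.range N, g (shift^[l * q + r] x) := by
    intro N
    rw [Finset.sum_comm]
    induction N with
    | zero => simp
    | succ N ih =>
      rw [mul_add_one, birkhoffSum_add, Finset.sum_range_succ, ih, birkhoffSum]
      simp only [← Function.iterate_add_apply, add_comm]
  have hlim : Tendsto (fun N : ℕ => birkhoffSum shift g (l * N) x / N - l * c) atTop (𝓝 0) := by
    have := tendsto_finsetSum (Finset.range l) fun r _ => hx r
    rw [Finset.sum_const, Finset.card_range, nsmul_eq_mul] at this
    have h2 := this.sub_const (l * c)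
    rw [sub_self] at h2
    refine h2.congr fun N => ?_
    rw [hblock, Finset.sum_div]
  have hlim2 := (hlim.comp (Nat.tendsto_div_const_atTop hlpos.ne')).abs
  rw [abs_zero] at hlim2
  have hlim3 := hlim2.add (tendsto_const_div_atTop_nhds_zero_nat (l * (B + |c|)))
  rw [add_zero] at hlim3
  rw [tendsto_iff_dist_tendsto_zero]
  refine squeeze_zero' (Eventually.of_forall fun _ => dist_nonneg) ?_ hlim3
  filter_upwards [eventually_ge_atTop l] with n hn
  have hN : 0 < n / l := Nat.div_pos hn hlpos
  have hN' : (0 : ℝ) < (n / l : ℕ) := by exact_mod_cast hN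
  have hn' : (0 : ℝ) < n := by exact_mod_cast lt_of_lt_of_le hlpos hn
  have hNn : ((n / l : ℕ) : ℝ) ≤ n := by exact_mod_cast Nat.div_le_self n l
  have hmod : n = l * (n / l) + n % l := (Nat.div_add_mod n l).symm
  have hmodl : ((n % l : ℕ) : ℝ) ≤ l := by exact_mod_cast (Nat.mod_lt n hlpos).le
  have hsum : birkhoffSum shift g n x - n * c = (birkhoffSum shift g (l * (n / l)) x - (n / l : ℕ) * (l * c)) +
      (birkhoffSum shift g (n % l) (shift^[l * (n / l)] x) - (n % l : ℕ) * c) := by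
    conv_lhs => rw [hmod, birkhoffSum_add]
    push_cast
    ring
  have hrem : |birkhoffSum shift g (n % l) (shift^[l * (n / l)] x) - (n % l : ℕ) * c| ≤
      l * (B + |c|) := by
    have h1 : |birkhoffSum shift g (n % l) (shift^[l * (n / l)] x)| ≤ (n % l : ℕ) * B := by
      refine (Finset.abs_sum_le_sum_abs _ _).trans ?_
      refine (Finset.sum_le_sum fun i _ => hB _).trans ?_
      simp
    have h2 : |((n % l : ℕ) : ℝ) * c| = (n % l : ℕ) * |c| := by rw [abs_mul, Nat.abs_cast]
    refine (abs_sub _ _).trans ?_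
    rw [h2]
    calc _ ≤ ((n % l : ℕ) : ℝ) * (B + |c|) := by linarith
      _ ≤ _ := by gcongr
  simp only [Function.comp_apply, Real.dist_eq]
  have e1 : birkhoffSum shift g n x / n - c = (birkhoffSum shift g n x - n * c) / n := by
    field_simp
  have e2 : birkhoffSum shift g (l * (n / l)) x / (n / l : ℕ) - l * c =
      (birkhoffSum shift g (l * (n / l)) x - (n / l : ℕ) * (l * c)) / (n / l : ℕ) := by
    field_simp
  rw [e1, e2, hsum, abs_div, abs_div, Nat.abs_cast, Nat.abs_cast]
  refine (div_le_div_of_nonneg_right (abs_add_le _ _) hn'.le).trans ?_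
  rw [add_div]
  gcongr

/-- Bounded functions of two-sided white noise satisfy the strong law of large numbers. -/
lemma tendsto_birkhoffSum_noiseLaw {f : (ℤ → S) → ℝ} {B : ℝ} (hf : Measurable f)
    (hB : ∀ x, |f x| ≤ B) :
    ∀ᵐ x ∂noiseLaw Q, Tendsto (fun n : ℕ => birkhoffSum shift f n x / n) atTop
      (𝓝 (∫ x, f x ∂noiseLaw Q)) := by
  have hfi : Integrable f (noiseLaw Q) :=
    Integrable.of_bound hf.aestronglyMeasurable B (Eventually.of_forall hB)
  have hB0 : 0 ≤ B := by
    obtain ⟨x⟩ := Measure.nonempty_of_neZero (noiseLaw Q)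
    exact (abs_nonneg _).trans (hB x)
  let ℱ : Filtration ℕ (MeasurableSpace.pi : MeasurableSpace (ℤ → S)) :=
    ⟨fun m => coordField S {i | |i| ≤ (m : ℤ)}, fun a b hab => coordField_mono fun i hi => by
      simp only [mem_ofPred_eq] at hi ⊢; omega, fun m => coordField_le _⟩
  have hsup : ⨆ n, (ℱ n : MeasurableSpace (ℤ → S)) = MeasurableSpace.pi := by
    refine le_antisymm (iSup_le fun n => ℱ.le n) (iSup_le fun i => ?_)
    exact le_iSup_of_le i.natAbs (le_iSup₂_of_le (f := fun i (_ : i ∈ _) =>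
      MeasurableSpace.comap (fun x : ℤ → S => x i) _) i (by simp) le_rfl)
  have hlevy := tendsto_eLpNorm_condExp (μ := noiseLaw Q) (ℱ := ℱ) f
  rw [hsup, condExp_of_stronglyMeasurable le_rfl hf.stronglyMeasurable hfi] at hlevy
  refine tendsto_birkhoffSum_of_approx (measurePreserving_shift Q) hfi hf fun ε hε => ?_
  -- Lévy's upward theorem: conditioning on the coordinates in [-m, m] approximates `f` in L¹.
  obtain ⟨m, hm⟩ := (hlevy.eventually_lt_const (ENNReal.ofReal_pos.2 hε)).exists
  set h : (ℤ → S) → ℝ := (noiseLaw Q)[f | ℱ m] with hh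
  have hhm : Measurable[ℱ m] h := stronglyMeasurable_condExp.measurable
  -- Clipping makes the approximant bounded everywhere. It fixes `f` and is a contraction, so it
  -- does not increase the L¹ distance.
  set g : (ℤ → S) → ℝ := fun x => max (-B) (min B (h x)) with hg
  have hgm : Measurable[ℱ m] g := measurable_const.max (measurable_const.min hhm)
  have hgB : ∀ x, |g x| ≤ B := fun x => abs_le.2 ⟨le_max_left _ _, max_le (by linarith) (min_le_left _ _)⟩
  have hgm' : Measurable g := hgm.mono (ℱ.le m) le_rfl
  refine ⟨g, hgm', Integrable.of_bound hgm'.aestronglyMeasurable B (Eventually.of_forall hgB), ?_,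
    tendsto_birkhoffSum_of_coordField Q hgm hgB⟩
  have hle : ∫ x, |f x - g x| ∂noiseLaw Q ≤ ∫ x, |h x - f x| ∂noiseLaw Q := by
    refine integral_mono_of_nonneg (Eventually.of_forall fun _ => abs_nonneg _)
      (integrable_condExp.sub hfi).abs (Eventually.of_forall fun x => ?_)
    have h1 := abs_le.1 (hB x)
    simp only [hg]
    rw [abs_sub_comm (h x)]
    have hfx : f x = max (-B) (min B (f x)) := by
      rw [min_eq_right h1.2, max_eq_right h1.1]
    calc |f x - max (-B) (min B (h x))| = |max (-B) (min B (f x)) - max (-B) (min B (h x))| := by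
          rw [← hfx]
      _ ≤ |min B (f x) - min B (h x)| := (abs_max_sub_max_le_max _ _ _ _).trans (by simp)
      _ ≤ |f x - h x| := (abs_min_sub_min_le_max _ _ _ _).trans (by simp)
  refine hle.trans ?_
  have : eLpNorm (h - f) 1 (noiseLaw Q) = ENNReal.ofReal (∫ x, |h x - f x| ∂noiseLaw Q) := by
    rw [eLpNorm_one_eq_lintegral_enorm, ← ofReal_integral_norm_eq_lintegral_enorm (integrable_condExp.sub hfi)]
    rfl
  rw [this] at hm
  exact ((ENNReal.ofReal_lt_ofReal_iff hε).1 hm).le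

end Bernoulli

end LII

namespace LII

lemma AsympSure.of_tendsto {Ω : Type*} [MeasurableSpace Ω] {P : Measure Ω} {f : ℕ → Ω → ℝ} {c : ℝ}
    (hf : ∀ T, Measurable (f T)) (h : ∀ᵐ ω ∂P, Tendsto (fun T => f T ω) atTop (𝓝 c)) {η : ℝ}
    (hη : 0 < η) : AsympSure P fun T ω => |f T ω - c| < η := by
  refine ⟨fun T => {ω | η ≤ |f T ω - c|}, fun T => measurableSet_le measurable_const
    ((hf T).sub_const c).abs, ?_, Eventually.of_forall fun T ω hω => not_le.1 hω⟩
  filter_upwards [h] with ω hω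
  filter_upwards [Metric.tendsto_nhds.1 hω η hη] with T hT
  rw [Real.dist_eq] at hT
  exact not_le.2 hT

/-! ### Averages along the history of white noise. -/

section History

variable {Ω S : Type*} [MeasurableSpace Ω] [MeasurableSpace S] {P : Measure Ω} {Q : Measure S}
  {e : ℤ → Ω → S}

lemma measurable_hist_comp (hm : ∀ t, Measurable (e t)) (t : ℤ) :
    Measurable fun ω => hist (fun s => e s ω) t :=
  measurable_pi_lambda _ fun _ => hm _

/-- The history of white noise at any time has the product law. -/
lemma map_hist (hm : ∀ t, Measurable (e t)) (hi : iIndepFun e P) (hl : ∀ t, P.map (e t) = Q)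
    (t : ℤ) : P.map (fun ω => hist (fun s => e s ω) t) = Measure.infinitePi fun _ : ℕ => Q := by
  have hinj : Function.Injective fun j : ℕ => t - (j : ℤ) := fun a b h => by simpa using h
  have := (hi.precomp hinj).map_fun_eq_infinitePi_map fun j => hm _
  simp only [hl] at this
  exact this

/-- The strong law of large numbers for bounded functions of the history of white noise. -/
lemma tendsto_average_hist [IsProbabilityMeasure Q] (hm : ∀ t, Measurable (e t))
    (hi : iIndepFun e P) (hl : ∀ t, P.map (e t) = Q) {W : (ℕ → S) → ℝ} {B : ℝ} (hW : Measurable W)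
    (hB : ∀ x, |W x| ≤ B) :
    ∀ᵐ ω ∂P, Tendsto (fun T : ℕ => 1 / (T : ℝ) * ∑ t ∈ Finset.Icc 1 T, W (hist (fun s => e s ω) t))
      atTop (𝓝 (∫ x, W x ∂Measure.infinitePi fun _ : ℕ => Q)) := by
  have hmeas : Measurable fun ω => fun t => e t ω := measurable_pi_lambda _ hm
  have hlaw : P.map (fun ω t => e t ω) = noiseLaw Q := by
    rw [hi.map_fun_eq_infinitePi_map hm]; simp only [hl, noiseLaw]
  have hh : ∀ t : ℤ, Measurable fun x : ℤ → S => hist x t := fun t =>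
    measurable_pi_lambda _ fun _ => measurable_pi_apply _
  -- The history is read at time 1 because Birkhoff sums start with the zeroth shift while the
  -- average starts at t = 1.
  have h := tendsto_birkhoffSum_noiseLaw Q (hW.comp (hh 1)) (fun x => hB _)
  have hint : ∫ x, (W ∘ fun x => hist x 1) x ∂noiseLaw Q =
      ∫ x, W x ∂Measure.infinitePi fun _ : ℕ => Q := by
    have : (noiseLaw Q).map (fun x => hist x 1) = Measure.infinitePi fun _ : ℕ => Q :=
      Measure.map_infinitePi_infinitePi_of_inj (P := fun _ : ℤ => Q) (f := fun j : ℕ => 1 - (j : ℤ))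
        fun a b h => by simpa using h
    rw [← this, integral_map (hh 1).aemeasurable hW.aestronglyMeasurable]
    rfl
  rw [hint, ← hlaw] at h
  filter_upwards [ae_of_ae_map hmeas.aemeasurable h] with ω hω
  refine hω.congr fun T => ?_
  rw [div_eq_inv_mul, one_div, birkhoffSum, Finset.range_eq_Ico, ← Finset.Ico_add_one_right_eq_Icc,
    Finset.sum_Ico_eq_sum_range, Finset.sum_Ico_eq_sum_range]
  congr 1
  refine Finset.sum_congr (by simp) fun k _ => ?_
  simp only [Function.comp_apply, shift_iterate]
  congr 1
  funext j
  simp only [hist]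
  congr 1
  push_cast
  ring

end History

/-! ### From pointwise to uniform laws by means of oscillations. -/

section UniformLaw

variable {X H : Type*} [PseudoMetricSpace X] [CompactSpace X]

/-- The oscillation of `p ↦ W p h` on the ball of radius `1 / (n + 1)` around `p`, through a dense
sequence. -/
noncomputable def osc [Nonempty X] (W : X → H → ℝ) (n : ℕ) (p : X) (h : H) : ℝ :=
  ⨆ k : ℕ, (Metric.ball p (1 / ((n : ℝ) + 1))).indicator (fun q => |W q h - W p h|)
    (TopologicalSpace.denseSeq X k)

variable [Nonempty X] {W : X → H → ℝ} {B : ℝ}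

lemma osc_nonneg (n : ℕ) (p : X) (h : H) : 0 ≤ osc W n p h :=
  Real.iSup_nonneg fun _ => indicator_nonneg (fun _ _ => abs_nonneg _) _

lemma osc_term_le {X H : Type*} {W : X → H → ℝ} {B : ℝ} (hB : ∀ p h, |W p h| ≤ B) (s : Set X)
    (p q : X) (h : H) : s.indicator (fun q => |W q h - W p h|) q ≤ 2 * B := by
  have h2 := hB p h
  refine indicator_le' (f := fun q => |W q h - W p h|) (g := fun _ => 2 * B)
    (fun q _ => ?_) (fun _ _ => ?_) q
  · linarith [abs_sub (W q h) (W p h), hB q h]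
  · linarith [abs_nonneg (W p h)]

lemma osc_le (hB : ∀ p h, |W p h| ≤ B) (n : ℕ) (p : X) (h : H) : osc W n p h ≤ 2 * B :=
  ciSup_le fun _ => osc_term_le hB _ p _ h

lemma measurable_osc [MeasurableSpace H] (hW : ∀ p, Measurable (W p)) (n : ℕ) (p : X) :
    Measurable (osc W n p) := by
  refine Measurable.iSup fun k => ?_
  by_cases hk : TopologicalSpace.denseSeq X k ∈ Metric.ball p (1 / ((n : ℝ) + 1))
  · simp only [indicator_of_mem hk]
    exact ((hW _).sub (hW p)).abs
  · simp only [indicator_of_notMem hk]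
    exact measurable_const

/-- The countable supremum keeps the oscillation measurable, and loses nothing where `W` is
continuous in `p`: the dense points inside an open ball are dense in it, and the inequality is a
closed condition. -/
lemma abs_sub_le_osc (hB : ∀ p h, |W p h| ≤ B) {h : H} (hc : Continuous fun p => W p h) {n : ℕ}
    {p q : X} (hq : dist q p < 1 / ((n : ℝ) + 1)) : |W q h - W p h| ≤ osc W n p h := by
  have hcl : IsClosed {q | |W q h - W p h| ≤ osc W n p h} :=
    isClosed_le (hc.sub continuous_const).abs continuous_const
  have hsub := (TopologicalSpace.denseRange_denseSeq X).open_subset_closure_inter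
    (Metric.isOpen_ball (x := p) (ε := 1 / ((n : ℝ) + 1)))
  refine (closure_minimal ?_ hcl) (hsub (Metric.mem_ball.2 hq))
  rintro _ ⟨hk, ⟨k, rfl⟩⟩
  have := le_ciSup (f := fun k : ℕ => (Metric.ball p (1 / ((n : ℝ) + 1))).indicator
    (fun q => |W q h - W p h|) (TopologicalSpace.denseSeq X k))
    ⟨2 * B, by rintro _ ⟨k, rfl⟩; exact osc_term_le hB _ p _ h⟩ k
  simp only [indicator_of_mem hk] at this
  exact this

lemma tendsto_osc {h : H} (hc : Continuous fun p => W p h) (p : X) :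
    Tendsto (fun n => osc W n p h) atTop (𝓝 0) := by
  rw [Metric.tendsto_nhds]
  intro ε hε
  obtain ⟨δ, hδ, hcont⟩ := Metric.continuous_iff.1 hc p (ε / 2) (by positivity)
  have h0 := tendsto_one_div_add_atTop_nhds_zero_nat (𝕜 := ℝ)
  filter_upwards [h0.eventually_lt_const hδ] with n hn
  rw [Real.dist_eq, sub_zero, abs_of_nonneg (osc_nonneg n p h)]
  refine lt_of_le_of_lt (ciSup_le fun k => ?_) (half_lt_self hε)
  refine indicator_le' (f := fun q => |W q h - W p h|) (g := fun _ => ε / 2)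
    (fun q hq => ?_) (fun _ _ => ?_) _
  · exact (hcont _ ((Metric.mem_ball.1 hq).trans hn)).le
  · positivity

/-- The uniform strong law of large numbers over a compact index space, for functions of the history
of white noise. -/
lemma asympSure_uniform_average {Ω S : Type*} [MeasurableSpace Ω] [MeasurableSpace S]
    {P : Measure Ω} {Q : Measure S} [IsProbabilityMeasure Q] {e : ℤ → Ω → S}
    (hm : ∀ t, Measurable (e t)) (hi : iIndepFun e P) (hl : ∀ t, P.map (e t) = Q)
    {W : X → (ℕ → S) → ℝ} {B : ℝ} (hW : ∀ p, Measurable (W p)) (hB : ∀ p x, |W p x| ≤ B)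
    (hc : ∀ᵐ x ∂Measure.infinitePi fun _ : ℕ => Q, Continuous fun p => W p x) {η : ℝ} (hη : 0 < η) :
    AsympSure P fun T ω => ∀ p, |1 / (T : ℝ) * ∑ t ∈ Finset.Icc 1 T, W p (hist (fun s => e s ω) t) -
      ∫ x, W p x ∂Measure.infinitePi fun _ : ℕ => Q| < η := by
  set μ := Measure.infinitePi fun _ : ℕ => Q with hμ
  have hWi : ∀ p, Integrable (W p) μ := fun p =>
    Integrable.of_bound (hW p).aestronglyMeasurable B (Eventually.of_forall (hB p))
  have hoB : ∀ n p x, |osc W n p x| ≤ 2 * B := fun n p x => by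
    rw [abs_of_nonneg (osc_nonneg n p x)]; exact osc_le hB n p x
  have hoi : ∀ n p, Integrable (osc W n p) μ := fun n p =>
    Integrable.of_bound (measurable_osc hW n p).aestronglyMeasurable (2 * B)
      (Eventually.of_forall (hoB n p))
  -- With η/8 here and for the two laws below, the errors sum to η/2: one for `W p`, two for the
  -- average oscillation and one for the expected oscillation.
  have hosc : ∀ p, ∃ n, ∫ x, osc W n p x ∂μ < η / 8 := by
    intro p
    have : Tendsto (fun n => ∫ x, osc W n p x ∂μ) atTop (𝓝 (∫ _, (0 : ℝ) ∂μ)) := by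
      refine tendsto_integral_of_dominated_convergence (fun _ => 2 * B)
        (fun n => (measurable_osc hW n p).aestronglyMeasurable) (integrable_const _)
        (fun n => Eventually.of_forall (hoB n p)) ?_
      filter_upwards [hc] with x hx using tendsto_osc hx p
    rw [integral_zero] at this
    exact (this.eventually_lt_const (by positivity)).exists
  choose n hn using hosc
  obtain ⟨s, hs⟩ := CompactSpace.elim_nhds_subcover
    (fun p => Metric.ball p (1 / ((n p : ℝ) + 1))) fun p => Metric.ball_mem_nhds p Nat.one_div_pos_of_nat
  have havg : ∀ {V : (ℕ → S) → ℝ}, Measurable V → ∀ T : ℕ, Measurable fun ω => 1 / (T : ℝ) *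
      ∑ t ∈ Finset.Icc 1 T, V (hist (fun s => e s ω) t) := fun hV T =>
    measurable_const.mul (Finset.measurable_sum _ fun t _ => hV.comp (measurable_hist_comp hm t))
  have h1 : AsympSure P fun T ω => ∀ p ∈ s, |1 / (T : ℝ) * ∑ t ∈ Finset.Icc 1 T,
      W p (hist (fun s => e s ω) t) - ∫ x, W p x ∂μ| < η / 8 :=
    AsympSure.forall_finset s fun p _ => AsympSure.of_tendsto (havg (hW p))
      (tendsto_average_hist hm hi hl (hW p) (hB p)) (by positivity)
  have h2 : AsympSure P fun T ω => ∀ p ∈ s, |1 / (T : ℝ) * ∑ t ∈ Finset.Icc 1 T,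
      osc W (n p) p (hist (fun s => e s ω) t) - ∫ x, osc W (n p) p x ∂μ| < η / 8 :=
    AsympSure.forall_finset s fun p _ => AsympSure.of_tendsto (havg (measurable_osc hW _ p))
      (tendsto_average_hist hm hi hl (measurable_osc hW _ p) (hoB _ p)) (by positivity)
  have h3 : ∀ᵐ ω ∂P, ∀ t : ℤ, Continuous fun p => W p (hist (fun s => e s ω) t) := by
    refine ae_all_iff.2 fun t => ?_
    rw [hμ, ← map_hist hm hi hl t] at hc
    exact ae_of_ae_map (measurable_hist_comp hm t).aemeasurable hc
  refine ((h1.and h2).and (AsympSure.of_ae h3)).mono (Eventually.of_forall fun T ω => ?_)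
  rintro ⟨⟨h1, h2⟩, h3⟩ q
  obtain ⟨p, hp, hq⟩ : ∃ p ∈ s, q ∈ Metric.ball p (1 / ((n p : ℝ) + 1)) := by
    have : q ∈ ⋃ p ∈ s, Metric.ball p (1 / ((n p : ℝ) + 1)) := by rw [hs]; trivial
    simpa using this
  have e1 := abs_lt.1 (h1 p hp)
  have e2 := abs_lt.1 (h2 p hp)
  have e3 : |1 / (T : ℝ) * ∑ t ∈ Finset.Icc 1 T, W q (hist (fun s => e s ω) t) -
      1 / (T : ℝ) * ∑ t ∈ Finset.Icc 1 T, W p (hist (fun s => e s ω) t)| ≤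
      1 / (T : ℝ) * ∑ t ∈ Finset.Icc 1 T, osc W (n p) p (hist (fun s => e s ω) t) := by
    rw [← mul_sub, ← Finset.sum_sub_distrib, abs_mul, abs_of_nonneg (by positivity)]
    refine mul_le_mul_of_nonneg_left ((Finset.abs_sum_le_sum_abs _ _).trans
      (Finset.sum_le_sum fun t _ => ?_)) (by positivity)
    exact abs_sub_le_osc hB (h3 t) hq
  have e4 : |∫ x, W q x ∂μ - ∫ x, W p x ∂μ| ≤ ∫ x, osc W (n p) p x ∂μ := by
    rw [← integral_sub (hWi q) (hWi p)]
    refine abs_integral_le_integral_abs.trans (integral_mono_ae ((hWi q).sub (hWi p)).abs (hoi _ p) ?_)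
    filter_upwards [hc] with x hx using abs_sub_le_osc hB hx hq
  have e5 := hn p
  rw [abs_le] at e3 e4
  rw [abs_lt]
  constructor <;> linarith [e1.1, e1.2, e2.1, e2.2, e3.1, e3.2, e4.1, e4.2]

end UniformLaw

end LII

namespace LII

/-! ### An exponential inequality for `φ`-mixing arrays -/

section Mixing

/-- For fixed `B` the mixing bound is an inequality of measures on `𝒜`, so it integrates against
`X`. The layer-cake formula for `F` under the measure with density `X` then adds up the levels. Only
levels below `b` contribute, hence the total price φ b. -/
lemma lintegral_mul_le_of_mixing {Ω : Type*} {𝒜 ℬ mΩ : MeasurableSpace Ω} {P : Measure Ω} (h𝒜 : 𝒜 ≤ mΩ) (hℬ : ℬ ≤ mΩ)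
    {φ : ℝ≥0∞} (hmix : ∀ A B, MeasurableSet[𝒜] A → MeasurableSet[ℬ] B →
      P (A ∩ B) ≤ (P B + φ) * P A) {X : Ω → ℝ≥0∞} {F : Ω → ℝ} (hX : Measurable[𝒜] X)
    (hF : Measurable[ℬ] F) {b : ℝ} (hF0 : ∀ ω, 0 ≤ F ω) (hFb : ∀ ω, F ω ≤ b) :
    ∫⁻ ω, X ω * ENNReal.ofReal (F ω) ∂P ≤
      (∫⁻ ω, X ω ∂P) * (∫⁻ ω, ENNReal.ofReal (F ω) ∂P + φ * ENNReal.ofReal b) := by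
  have hX' : Measurable X := hX.mono h𝒜 le_rfl
  have hF' : Measurable F := hF.mono hℬ le_rfl
  have h1 : ∀ B, MeasurableSet[ℬ] B → ∫⁻ ω in B, X ω ∂P ≤ (∫⁻ ω, X ω ∂P) * (P B + φ) := by
    intro B hB
    have hle : (P.restrict B).trim h𝒜 ≤ (P B + φ) • P.trim h𝒜 := by
      refine Measure.le_iff.2 fun A hA => ?_
      rw [trim_measurableSet_eq h𝒜 hA, Measure.restrict_apply (h𝒜 A hA), Measure.smul_apply,
        trim_measurableSet_eq h𝒜 hA, smul_eq_mul]
      exact hmix A B hA hB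
    calc ∫⁻ ω in B, X ω ∂P = ∫⁻ ω, X ω ∂(P.restrict B).trim h𝒜 := (lintegral_trim h𝒜 hX).symm
      _ ≤ ∫⁻ ω, X ω ∂((P B + φ) • P.trim h𝒜) := lintegral_mono' hle le_rfl
      _ = (∫⁻ ω, X ω ∂P) * (P B + φ) := by
        rw [lintegral_smul_measure, lintegral_trim h𝒜 hX, smul_eq_mul, mul_comm]
  have h2 : ∫⁻ ω, X ω * ENNReal.ofReal (F ω) ∂P =
      ∫⁻ ω, ENNReal.ofReal (F ω) ∂P.withDensity X := by
    rw [lintegral_withDensity_eq_lintegral_mul _ hX' hF'.ennreal_ofReal]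
    rfl
  rw [h2, lintegral_eq_lintegral_meas_lt _ (Eventually.of_forall hF0) hF'.aemeasurable,
    lintegral_eq_lintegral_meas_lt _ (Eventually.of_forall hF0) hF'.aemeasurable]
  have h3 : ∀ t : ℝ, P.withDensity X {ω | t < F ω} ≤ (∫⁻ ω, X ω ∂P) *
      (P {ω | t < F ω} + φ * (Iio b).indicator 1 t) := by
    intro t
    by_cases ht : t < b
    · have hm : MeasurableSet[ℬ] {ω | t < F ω} := hF measurableSet_Ioi
      rw [withDensity_apply _ (hℬ _ hm), indicator_of_mem (by exact ht)]
      simpa using h1 _ hm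
    · have : {ω | t < F ω} = ∅ := by
        ext ω
        simp only [mem_ofPred_eq, mem_empty_iff_false, iff_false, not_lt]
        exact (hFb ω).trans (not_lt.1 ht)
      rw [this, measure_empty]
      exact zero_le
  refine (lintegral_mono h3).trans ?_
  have hmeas : Measurable fun t : ℝ => φ * (Iio b).indicator (1 : ℝ → ℝ≥0∞) t :=
    (measurable_one.indicator measurableSet_Iio).const_mul φ
  have hanti : Measurable fun t : ℝ => P {ω | t < F ω} :=
    Antitone.measurable fun s t hst => measure_mono fun ω hω => lt_of_le_of_lt hst hω
  rw [lintegral_const_mul (f := fun t => P {ω | t < F ω} + φ * (Iio b).indicator 1 t) _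
    (hanti.add hmeas), lintegral_add_right _ hmeas]
  gcongr
  rw [lintegral_const_mul _ (measurable_one.indicator measurableSet_Iio),
    lintegral_indicator_one measurableSet_Iio, Measure.restrict_apply measurableSet_Iio]
  gcongr
  rw [inter_comm, Ioi_inter_Iio, Real.volume_Ioo, sub_zero]

variable {Ω : Type*} [mΩ : MeasurableSpace Ω] {P : Measure Ω} [IsProbabilityMeasure P]

/-- On [-1, 1] one has eˣ ≤ 1 + x + x², and the linear term has mean zero. -/
lemma integral_exp_le {V : Ω → ℝ} {v : ℝ} (hV : Measurable V) (hbd : ∀ ω, |V ω| ≤ v) (hv : v ≤ 1)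
    (hmean : ∫ ω, V ω ∂P = 0) :
    ∫⁻ ω, ENNReal.ofReal (Real.exp (V ω)) ∂P ≤ ENNReal.ofReal (1 + v ^ 2) := by
  have hi : Integrable V P := Integrable.of_bound hV.aestronglyMeasurable v (Eventually.of_forall hbd)
  have hpt : ∀ ω, Real.exp (V ω) ≤ 1 + V ω + v ^ 2 := by
    intro ω
    have h1 := (abs_le.1 (Real.abs_exp_sub_one_sub_id_le ((hbd ω).trans hv))).2
    have h2 : V ω ^ 2 ≤ v ^ 2 := sq_le_sq.2 ((hbd ω).trans (le_abs_self v))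
    linarith
  have hi2 : Integrable (fun ω => 1 + V ω + v ^ 2) P := ((integrable_const _).add hi).add (integrable_const _)
  calc ∫⁻ ω, ENNReal.ofReal (Real.exp (V ω)) ∂P ≤ ∫⁻ ω, ENNReal.ofReal (1 + V ω + v ^ 2) ∂P :=
        lintegral_mono fun ω => ENNReal.ofReal_le_ofReal (hpt ω)
    _ = ENNReal.ofReal (∫ ω, (1 + V ω + v ^ 2) ∂P) :=
        (ofReal_integral_eq_lintegral_ofReal hi2 (Eventually.of_forall fun ω =>
          (Real.exp_pos _).le.trans (hpt ω))).symm
    _ = _ := by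
        rw [integral_add (f := fun ω => 1 + V ω) ((integrable_const _).add hi) (integrable_const _),
          integral_add (integrable_const _) hi, hmean]
        simp

/-- Induction, splitting off the last factor by mixing. Each factor is at most e < 3, so a step
costs 1 + v² + 3φ ≤ exp(v² + 3φ). -/
lemma lintegral_exp_sum_le {𝒜 ℬ : ℕ → MeasurableSpace Ω} (h𝒜 : ∀ n, 𝒜 n ≤ mΩ)
    (hℬ : ∀ n, ℬ n ≤ mΩ) {φ : ℝ} (hφ : 0 ≤ φ)
    (hmix : ∀ n A B, MeasurableSet[𝒜 n] A → MeasurableSet[ℬ n] B →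
      P (A ∩ B) ≤ (P B + ENNReal.ofReal φ) * P A) {V : ℕ → Ω → ℝ} {v : ℕ → ℝ}
    (hV𝒜 : ∀ n, ∀ j < n, Measurable[𝒜 n] (V j)) (hVℬ : ∀ n, Measurable[ℬ n] (V n))
    (hbd : ∀ j ω, |V j ω| ≤ v j) (hv : ∀ j, v j ≤ 1) (hmean : ∀ j, ∫ ω, V j ω ∂P = 0) (n : ℕ) :
    ∫⁻ ω, ENNReal.ofReal (Real.exp (∑ j ∈ Finset.range n, V j ω)) ∂P ≤
      ENNReal.ofReal (Real.exp (∑ j ∈ Finset.range n, v j ^ 2 + n * (3 * φ))) := by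
  induction n with
  | zero => simp
  | succ n ih =>
    have hsplit : ∀ ω, ENNReal.ofReal (Real.exp (∑ j ∈ Finset.range (n + 1), V j ω)) =
        ENNReal.ofReal (Real.exp (∑ j ∈ Finset.range n, V j ω)) *
          ENNReal.ofReal (Real.exp (V n ω)) := fun ω => by
      rw [Finset.sum_range_succ, Real.exp_add, ENNReal.ofReal_mul (Real.exp_pos _).le]
    simp only [hsplit]
    have hX : Measurable[𝒜 n] fun ω =>
        ENNReal.ofReal (Real.exp (∑ j ∈ Finset.range n, V j ω)) := by
      refine ENNReal.measurable_ofReal.comp (Real.measurable_exp.comp ?_)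
      exact Finset.measurable_sum (m := 𝒜 n) _ fun j hj => hV𝒜 n j (Finset.mem_range.1 hj)
    refine (lintegral_mul_le_of_mixing (h𝒜 n) (hℬ n) (hmix n) hX
      (Real.measurable_exp.comp (hVℬ n)) (b := 3) (fun ω => (Real.exp_pos _).le) (fun ω => ?_)).trans ?_
    · have h1 : V n ω ≤ 1 := (le_abs_self _).trans ((hbd n ω).trans (hv n))
      have h2 := Real.exp_one_lt_d9
      refine (Real.exp_le_exp.2 h1).trans (by linarith)
    refine (mul_le_mul' ih (add_le_add (integral_exp_le ((hVℬ n).mono (hℬ n) le_rfl) (hbd n) (hv n)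
      (hmean n)) le_rfl)).trans ?_
    rw [← ENNReal.ofReal_mul hφ, ← ENNReal.ofReal_add (by positivity) (by positivity),
      ← ENNReal.ofReal_mul (Real.exp_pos _).le]
    refine ENNReal.ofReal_le_ofReal ?_
    rw [Finset.sum_range_succ]
    have h1 := Real.add_one_le_exp (v n ^ 2 + φ * 3)
    calc _ ≤ Real.exp (∑ j ∈ Finset.range n, v j ^ 2 + n * (3 * φ)) * Real.exp (v n ^ 2 + φ * 3) := by
          gcongr; linarith
      _ = _ := by rw [← Real.exp_add]; congr 1; push_cast; ring

/-- Chernoff's bound; the free exponential parameter is already absorbed in the variables. -/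
lemma measure_le_sum_of_mixing {𝒜 ℬ : ℕ → MeasurableSpace Ω} (h𝒜 : ∀ n, 𝒜 n ≤ mΩ)
    (hℬ : ∀ n, ℬ n ≤ mΩ) {φ : ℝ} (hφ : 0 ≤ φ)
    (hmix : ∀ n A B, MeasurableSet[𝒜 n] A → MeasurableSet[ℬ n] B →
      P (A ∩ B) ≤ (P B + ENNReal.ofReal φ) * P A) {V : ℕ → Ω → ℝ} {v : ℕ → ℝ}
    (hV𝒜 : ∀ n, ∀ j < n, Measurable[𝒜 n] (V j)) (hVℬ : ∀ n, Measurable[ℬ n] (V n))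
    (hbd : ∀ j ω, |V j ω| ≤ v j) (hv : ∀ j, v j ≤ 1) (hmean : ∀ j, ∫ ω, V j ω ∂P = 0) (n : ℕ)
    (x : ℝ) :
    P {ω | x ≤ ∑ j ∈ Finset.range n, V j ω} ≤
      ENNReal.ofReal (Real.exp (∑ j ∈ Finset.range n, v j ^ 2 + n * (3 * φ) - x)) := by
  have hm : Measurable fun ω => ENNReal.ofReal (Real.exp (∑ j ∈ Finset.range n, V j ω)) :=
    (Real.measurable_exp.comp (Finset.measurable_sum _ fun j _ =>
      (hVℬ j).mono (hℬ j) le_rfl)).ennreal_ofReal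
  have hpos : ENNReal.ofReal (Real.exp x) ≠ 0 := by simp [Real.exp_pos]
  have h1 : P {ω | x ≤ ∑ j ∈ Finset.range n, V j ω} ≤
      (∫⁻ ω, ENNReal.ofReal (Real.exp (∑ j ∈ Finset.range n, V j ω)) ∂P) /
        ENNReal.ofReal (Real.exp x) := by
    refine le_trans (measure_mono fun ω hω => ?_)
      (meas_ge_le_lintegral_div hm.aemeasurable hpos ENNReal.ofReal_ne_top)
    exact ENNReal.ofReal_le_ofReal (Real.exp_le_exp.2 hω)
  refine h1.trans ((ENNReal.div_le_div_right (lintegral_exp_sum_le h𝒜 hℬ hφ hmix hV𝒜 hVℬ hbd hv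
    hmean n) _).trans ?_)
  rw [← ENNReal.ofReal_div_of_pos (Real.exp_pos _), Real.exp_sub]

/-! ### Blocking the rows of a φ-mixing array. -/

section Array

variable {E : Type*} [MeasurableSpace E] {X : ℕ → ℕ → Ω → E}

lemma rowField_le (hX : ∀ T t, Measurable (X T t)) (T a b : ℕ) : rowField X T a b ≤ mΩ :=
  iSup₂_le fun i _ => (hX T i).comap_le

lemma rowField_mono {Ω E : Type*} [MeasurableSpace E] {X : ℕ → ℕ → Ω → E} (T : ℕ) {a a' b b' : ℕ}
    (h : ∀ i, 1 ≤ i → i ≤ T → a ≤ i → i ≤ b → a' ≤ i ∧ i ≤ b') :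
    rowField X T a b ≤ rowField X T a' b' :=
  biSup_mono fun i ⟨h1, h2, h3, h4⟩ => ⟨h1, h2, h i h1 h2 h3 h4⟩

lemma bddAbove_phiCoef (k : ℕ) : BddAbove {x : ℝ | ∃ (T t : ℕ) (A B : Set Ω), 1 ≤ T ∧ t ≤ T ∧
    MeasurableSet[rowField X T 1 t] A ∧ MeasurableSet[rowField X T (t + k) T] B ∧
    0 < P.real A ∧ x = |P.real (A ∩ B) / P.real A - P.real B|} := by
  refine ⟨1, ?_⟩
  rintro _ ⟨T, t, A, B, -, -, -, -, hA, rfl⟩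
  have h1 : P.real (A ∩ B) / P.real A ≤ 1 :=
    (div_le_one hA).2 (measureReal_mono inter_subset_left)
  have h2 : 0 ≤ P.real (A ∩ B) / P.real A := by positivity
  have h3 : P.real B ≤ 1 := measureReal_le_one
  have h4 : 0 ≤ P.real B := measureReal_nonneg
  rw [abs_le]
  constructor <;> linarith

lemma phiCoef_nonneg {Ω E : Type*} [MeasurableSpace Ω] [MeasurableSpace E] {P : Measure Ω}
    {X : ℕ → ℕ → Ω → E} (k : ℕ) : 0 ≤ phiCoef P X k := by
  refine Real.sSup_nonneg ?_
  rintro _ ⟨T, t, A, B, -, -, -, -, -, rfl⟩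
  exact abs_nonneg _

lemma measure_inter_le_of_rowField {T t k : ℕ} (hT : 1 ≤ T) {A B : Set Ω}
    (hA : MeasurableSet[rowField X T 1 t] A) (hB : MeasurableSet[rowField X T (t + k) T] B) :
    P (A ∩ B) ≤ (P B + ENNReal.ofReal (phiCoef P X k)) * P A := by
  rcases eq_or_ne (P A) 0 with h0 | h0
  · rw [measure_mono_null inter_subset_left h0]; exact zero_le
  have hA0 : 0 < P.real A := by
    rw [measureReal_def]; exact ENNReal.toReal_pos h0 (measure_ne_top _ _)
  have hle : |P.real (A ∩ B) / P.real A - P.real B| ≤ phiCoef P X k := by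
    -- The coefficient only admits times up to `T`; truncating `t` does not shrink either field.
    refine le_csSup (bddAbove_phiCoef k) ⟨T, min t T, A, B, hT, min_le_right _ _, ?_, ?_, hA0, rfl⟩
    · exact rowField_mono T (fun i h1 h2 h3 h4 => ⟨h3, le_min h4 h2⟩) _ hA
    · exact rowField_mono T (fun i h1 h2 h3 h4 => ⟨by omega, h4⟩) _ hB
  have h1 := (abs_le.1 hle).2
  have h2 : P.real (A ∩ B) ≤ (P.real B + phiCoef P X k) * P.real A := by
    rw [← div_le_iff₀ hA0]; linarith
  rw [← ofReal_measureReal (μ := P) (s := A ∩ B), ← ofReal_measureReal (μ := P) (s := B),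
    ← ofReal_measureReal (μ := P) (s := A),
    ← ENNReal.ofReal_add measureReal_nonneg (phiCoef_nonneg k),
    ← ENNReal.ofReal_mul (add_nonneg measureReal_nonneg (phiCoef_nonneg k))]
  exact ENNReal.ofReal_le_ofReal h2

lemma sum_range_mul {M : Type*} [AddCommMonoid M] (f : ℕ → M) (N k : ℕ) :
    ∑ s ∈ Finset.range (k * N), f s =
      ∑ j ∈ Finset.range N, ∑ l ∈ Finset.range k, f (k * j + l) := by
  induction N with
  | zero => simp
  | succ N ih => rw [mul_add_one, Finset.sum_range_add, ih, Finset.sum_range_succ]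

/-- The exponential inequality for every other block of length `m`. -/
lemma measure_le_sum_blocks (hX : ∀ T t, Measurable (X T t)) {T m o : ℕ} (hT : 1 ≤ T) (ho : o ≤ m)
    {ξ : ℕ → Ω → ℝ} (hξ : ∀ s, Measurable[rowField X T (s + 1) (s + 1)] (ξ s)) {a : ℕ → ℝ}
    (hbd : ∀ s ω, |ξ s ω| ≤ a s) (hmean : ∀ s, ∫ ω, ξ s ω ∂P = 0) {v A lam : ℝ}
    (hv : ∀ i, ∑ l ∈ Finset.range m, a (i + l) ≤ v) {N : ℕ}
    (hA : ∑ s ∈ Finset.range (2 * m * N + o), a s ≤ A) (hlam : 0 ≤ lam) (hlv : lam * v ≤ 1) (x : ℝ) :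
    P {ω | x ≤ ∑ j ∈ Finset.range N, ∑ l ∈ Finset.range m, ξ (2 * m * j + (o + l)) ω} ≤
      ENNReal.ofReal (Real.exp (lam ^ 2 * v * A + N * (3 * phiCoef P X m) - lam * x)) := by
  have ha0 : ∀ s, 0 ≤ a s := fun s => by
    obtain ⟨ω⟩ := Measure.nonempty_of_neZero P
    exact (abs_nonneg _).trans (hbd s ω)
  have hv0 : 0 ≤ v := (Finset.sum_nonneg fun l _ => ha0 _).trans (hv 0)
  have hξm : ∀ s, Measurable (ξ s) := fun s => (hξ s).mono (rowField_le hX _ _ _) le_rfl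
  have hξi : ∀ s, Integrable (ξ s) P := fun s =>
    Integrable.of_bound (hξm s).aestronglyMeasurable (a s) (Eventually.of_forall (hbd s))
  set V : ℕ → Ω → ℝ := fun j ω => lam * ∑ l ∈ Finset.range m, ξ (2 * m * j + (o + l)) ω with hV
  set w : ℕ → ℝ := fun j => lam * ∑ l ∈ Finset.range m, a (2 * m * j + (o + l)) with hw
  have hVmeas : ∀ (𝒢 : MeasurableSpace Ω) j, (∀ l < m,
      rowField X T (2 * m * j + (o + l) + 1) (2 * m * j + (o + l) + 1) ≤ 𝒢) → Measurable[𝒢] (V j) :=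
    fun 𝒢 j h => Measurable.const_mul (Finset.measurable_sum _ fun l hl =>
      (hξ _).mono (h l (Finset.mem_range.1 hl)) le_rfl) _
  have hwle : ∀ j, w j ≤ lam * v := fun j => by
    refine mul_le_mul_of_nonneg_left ?_ hlam
    simpa only [add_assoc] using hv (2 * m * j + o)
  have hw0 : ∀ j, 0 ≤ w j := fun j => mul_nonneg hlam (Finset.sum_nonneg fun l _ => ha0 _)
  -- Summand `s` belongs to observation `s + 1`, so block `n` starts at 2mn + o + 1 and the
  -- preceding one ends at 2mn + o − m. For n = 0 the truncated subtraction gives 0 and the past is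
  -- the trivial field, which needs no mixing.
  have hmix : ∀ n A B, MeasurableSet[rowField X T 1 (2 * m * n + o - m)] A →
      MeasurableSet[rowField X T (2 * m * n + o + 1) T] B →
      P (A ∩ B) ≤ (P B + ENNReal.ofReal (phiCoef P X m)) * P A := by
    intro n A B hA hB
    rcases Nat.eq_zero_or_pos n with rfl | hn
    · have hbot : rowField X T 1 (2 * m * 0 + o - m) = ⊥ := by
        refine le_bot_iff.1 (iSup₂_le fun i hi => ?_)
        obtain ⟨h1, -, -, h4⟩ := hi
        omega
      rw [hbot, MeasurableSpace.measurableSet_bot_iff] at hA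
      rcases hA with rfl | rfl
      · simp
      · simp
    · refine measure_inter_le_of_rowField hT hA
        (rowField_mono T (fun i h1 h2 h3 h4 => ⟨?_, h4⟩) _ hB)
      have : m ≤ 2 * m * n := by nlinarith
      omega
  have key := measure_le_sum_of_mixing (fun n => rowField_le hX _ _ _) (fun n => rowField_le hX _ _ _)
    (phiCoef_nonneg m) hmix (V := V) (v := w) ?_ ?_ ?_ (fun j => (hwle j).trans hlv) ?_ N (lam * x)
  · refine le_trans (measure_mono fun ω hω => ?_) (key.trans (ENNReal.ofReal_le_ofReal
      (Real.exp_le_exp.2 ?_)))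
    · simp only [mem_ofPred_eq, hV] at hω ⊢
      rw [← Finset.mul_sum]
      exact mul_le_mul_of_nonneg_left hω hlam
    -- The sum of squares is bounded by the largest block bound times the total: this produces λ² v
    -- A.
    · have h1 : ∑ j ∈ Finset.range N, w j ^ 2 ≤ lam * v * ∑ j ∈ Finset.range N, w j := by
        rw [Finset.mul_sum]
        exact Finset.sum_le_sum fun j _ => by
          rw [sq]; exact mul_le_mul_of_nonneg_right (hwle j) (hw0 j)
      have h2 : ∑ j ∈ Finset.range N, ∑ l ∈ Finset.range m, a (2 * m * j + (o + l)) ≤ A := by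
        refine le_trans ?_ hA
        rw [add_comm (2 * m * N) o, Finset.sum_range_add, sum_range_mul]
        refine le_add_of_nonneg_of_le (Finset.sum_nonneg fun s _ => ha0 s)
          (Finset.sum_le_sum fun j _ => ?_)
        have : Finset.range m ⊆ Finset.range (2 * m) := Finset.range_subset_range.2 (by omega)
        refine le_trans (le_of_eq ?_) (Finset.sum_le_sum_of_subset_of_nonneg this
          fun _ _ _ => ha0 _)
        exact Finset.sum_congr rfl fun l _ => by congr 1; ring
      have h3 : ∑ j ∈ Finset.range N, w j ≤ lam * A := by
        rw [hw, ← Finset.mul_sum]; exact mul_le_mul_of_nonneg_left h2 hlam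
      have h4 : lam * v * ∑ j ∈ Finset.range N, w j ≤ lam * v * (lam * A) :=
        mul_le_mul_of_nonneg_left h3 (mul_nonneg hlam hv0)
      nlinarith
  · intro n j hj
    refine hVmeas _ j fun l hl => rowField_mono T fun i h1 h2 h3 h4 => ⟨h1, ?_⟩
    have : 2 * m * j + 2 * m ≤ 2 * m * n := by nlinarith
    omega
  · exact fun n => hVmeas _ n fun l hl => rowField_mono T fun i h1 h2 h3 h4 => ⟨by omega, h2⟩
  · intro j ω
    simp only [hV, hw]
    rw [abs_mul, abs_of_nonneg hlam]
    exact mul_le_mul_of_nonneg_left ((Finset.abs_sum_le_sum_abs _ _).trans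
      (Finset.sum_le_sum fun l _ => hbd _ ω)) hlam
  · intro j
    simp only [hV]
    rw [integral_const_mul, integral_finsetSum _ fun l _ => hξi _]
    simp [hmean]

/-- The exponential inequality for the sum of a row. -/
lemma measure_le_sum_row (hX : ∀ T t, Measurable (X T t)) {T m : ℕ} (hT : 1 ≤ T) (hm : 1 ≤ m)
    {ξ : ℕ → Ω → ℝ} (hξ : ∀ s, Measurable[rowField X T (s + 1) (s + 1)] (ξ s)) {a : ℕ → ℝ}
    (hbd : ∀ s ω, |ξ s ω| ≤ a s) (haT : ∀ s, T ≤ s → a s = 0) (hmean : ∀ s, ∫ ω, ξ s ω ∂P = 0)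
    {v A lam : ℝ} (hv : ∀ i, ∑ l ∈ Finset.range m, a (i + l) ≤ v)
    (hA : ∑ s ∈ Finset.range T, a s ≤ A) (hlam : 0 ≤ lam) (hlv : lam * v ≤ 1) (x : ℝ) :
    P {ω | x ≤ ∑ s ∈ Finset.range T, ξ s ω} ≤ 2 * ENNReal.ofReal (Real.exp
      (lam ^ 2 * v * A + (T / m + 1) * (3 * phiCoef P X m) - lam * (x / 2))) := by
  -- More pairs of blocks than needed to cover the row; the summands beyond `T` vanish.
  set N : ℕ := T / m + 1 with hN
  have hTN : T ≤ 2 * m * N := by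
    have := Nat.lt_mul_div_succ T (show 0 < m by omega)
    rw [← hN] at this
    nlinarith
  have hext : ∀ {M : Type} [AddCommMonoid M] (f : ℕ → M) (L : ℕ), (∀ s, T ≤ s → f s = 0) → T ≤ L →
      ∑ s ∈ Finset.range L, f s = ∑ s ∈ Finset.range T, f s := fun f L hf hL =>
    (Finset.sum_subset (Finset.range_subset_range.2 hL) fun s _ hs => hf s (by simpa using hs)).symm
  have hξT : ∀ ω s, T ≤ s → ξ s ω = 0 := fun ω s hs => by
    have := hbd s ω
    rw [haT s hs] at this
    exact abs_nonpos_iff.1 this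
  have hNle : (N : ℝ) ≤ T / m + 1 := by
    rw [hN]; push_cast; gcongr; exact Nat.cast_div_le
  have hb : ∀ o ≤ m, P {ω | x / 2 ≤ ∑ j ∈ Finset.range N, ∑ l ∈ Finset.range m,
      ξ (2 * m * j + (o + l)) ω} ≤ ENNReal.ofReal (Real.exp
      (lam ^ 2 * v * A + (T / m + 1) * (3 * phiCoef P X m) - lam * (x / 2))) := by
    intro o ho
    refine (measure_le_sum_blocks hX hT ho hξ hbd hmean hv (A := A) ?_ hlam hlv (x / 2)).trans ?_
    · rwa [hext a _ haT (by omega)]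
    · refine ENNReal.ofReal_le_ofReal (Real.exp_le_exp.2 ?_)
      have := phiCoef_nonneg (P := P) (X := X) m
      gcongr
  rw [two_mul]
  refine le_trans (measure_mono fun ω hω => ?_) ((measure_union_le _ _).trans
    (add_le_add (hb 0 (by omega)) (hb m le_rfl)))
  simp only [mem_union, mem_ofPred_eq] at hω ⊢
  -- The offsets 0 and `m` select the alternate blocks and together exhaust the row, so one of the
  -- two partial sums must reach x/2.
  by_contra! hcon
  have hsum : ∑ s ∈ Finset.range T, ξ s ω =
      (∑ j ∈ Finset.range N, ∑ l ∈ Finset.range m, ξ (2 * m * j + (0 + l)) ω) +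
      ∑ j ∈ Finset.range N, ∑ l ∈ Finset.range m, ξ (2 * m * j + (m + l)) ω := by
    rw [← hext (fun s => ξ s ω) (2 * m * N) (hξT ω) hTN, sum_range_mul (fun s => ξ s ω),
      ← Finset.sum_add_distrib]
    refine Finset.sum_congr rfl fun j _ => ?_
    rw [two_mul, Finset.sum_range_add]
    simp
  linarith [hcon.1, hcon.2]

end Array

end Mixing

end LII

namespace LII

/-! ### Kernel weights -/

/-- The total weight of the local criterion. -/
noncomputable def kernelWeight (K : ℝ → ℝ) (h : ℝ) (T : ℕ) (u : ℝ) : ℝ :=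
  1 / (T * h) * ∑ t ∈ Finset.Icc 1 T, K ((u - (t : ℝ) / T) / h)

lemma integrable_of_rpow_tail {f : ℝ → ℝ} (hf : Continuous f) {C L v : ℝ} (hL : 0 < L) (hv : 1 < v)
    (hC : ∀ x, |f x| ≤ C) (ht : ∀ x, L < |x| → |f x| ≤ C * |x| ^ (-v)) : Integrable f := by
  have hC0 : 0 ≤ C := (abs_nonneg _).trans (hC 0)
  have hv0 : 0 ≤ v := by linarith
  have hint : Integrable fun x : ℝ => (1 + ‖x‖) ^ (-v) :=
    integrable_one_add_norm (by simpa using hv)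
  -- The first constant dominates on |x| ≤ L, the second on the tail, where |x| ≥ (L / (1 + L)) (1 +
  -- |x|).
  refine (hint.const_mul (C * (1 + L) ^ v + C * (L / (1 + L)) ^ (-v))).mono'
    hf.aestronglyMeasurable (Eventually.of_forall fun x => ?_)
  rw [Real.norm_eq_abs, Real.norm_eq_abs, add_mul]
  have hx : (0 : ℝ) < 1 + |x| := by positivity
  have hp1 : 0 ≤ C * (1 + L) ^ v * (1 + |x|) ^ (-v) := by positivity
  have hp2 : 0 ≤ C * (L / (1 + L)) ^ (-v) * (1 + |x|) ^ (-v) := by positivity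
  rcases le_or_gt |x| L with hxL | hxL
  · have h1 : (1 : ℝ) ≤ (1 + L) ^ v * (1 + |x|) ^ (-v) := by
      rw [Real.rpow_neg hx.le, ← div_eq_mul_inv, one_le_div (by positivity)]
      exact Real.rpow_le_rpow hx.le (by linarith) hv0
    have := mul_le_mul_of_nonneg_left h1 hC0
    linarith [hC x]
  · have h1 : |x| ^ (-v) ≤ (L / (1 + L)) ^ (-v) * (1 + |x|) ^ (-v) := by
      rw [← Real.mul_rpow (by positivity) hx.le]
      refine Real.rpow_le_rpow_of_nonpos (by positivity) ?_ (by linarith)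
      rw [div_mul_eq_mul_div, div_le_iff₀ (by positivity)]
      nlinarith
    have := mul_le_mul_of_nonneg_left h1 hC0
    linarith [ht x hxL]

/-- A Riemann sum of a nonnegative function of bounded variation. -/
lemma riemannSum_le {K : ℝ → ℝ} (hK0 : ∀ x, 0 ≤ K x) (hK : ContDiff ℝ 1 K) (hKi : Integrable K)
    (hK' : Integrable (deriv K)) {d : ℝ} (hd : 0 < d) (x : ℝ) (T : ℕ) :
    d * ∑ t ∈ Finset.Icc 1 T, K (x - t * d) ≤ (∫ y, K y) + d * ∫ y, |deriv K y| := by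
  have hc := hK.continuous
  have hc' : Continuous (deriv K) := hK.continuous_deriv le_rfl
  set F : ℝ → ℝ := fun y => K y + d * |deriv K y| with hF
  have hFc : Continuous F := hc.add (continuous_const.mul hc'.abs)
  have hF0 : ∀ y, 0 ≤ F y := fun y => add_nonneg (hK0 y) (by positivity)
  have hFi : Integrable F := hKi.add (hK'.abs.const_mul d)
  -- On one cell, `K a` exceeds `K y` by at most the variation of `K` on that cell; summing over
  -- adjacent cells gives the total variation.
  have hcell : ∀ a : ℝ, d * K a ≤ ∫ y in a..(a + d), F y := by
    intro a
    have had : a ≤ a + d := by linarith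
    set V := ∫ y in a..(a + d), |deriv K y| with hV
    have hpt : ∀ y ∈ Icc a (a + d), K a - V ≤ K y := by
      intro y hy
      have h1 : ∫ s in a..y, deriv K s = K y - K a :=
        intervalIntegral.integral_deriv_eq_sub (fun s _ => hK.differentiable one_ne_zero s)
          (hc'.intervalIntegrable _ _)
      have h2 : |∫ s in a..y, deriv K s| ≤ ∫ s in a..y, |deriv K s| :=
        intervalIntegral.abs_integral_le_integral_abs hy.1
      have h3 : ∫ s in a..y, |deriv K s| ≤ V :=
        intervalIntegral.integral_mono_interval le_rfl hy.1 hy.2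
          (Eventually.of_forall fun _ => abs_nonneg _) (hc'.abs.intervalIntegrable _ _)
      rw [h1] at h2
      linarith [(abs_le.1 h2).1]
    have h4 : ∫ y in a..(a + d), (K a - V) ≤ ∫ y in a..(a + d), K y :=
      intervalIntegral.integral_mono_on had (by simp) (hc.intervalIntegrable _ _) hpt
    rw [intervalIntegral.integral_const, smul_eq_mul] at h4
    have h5 : ∫ y in a..(a + d), F y = (∫ y in a..(a + d), K y) + d * V := by
      have hi : IntervalIntegrable (fun y => d * |deriv K y|) volume a (a + d) :=
        (continuous_const.mul hc'.abs).intervalIntegrable _ _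
      rw [hF, intervalIntegral.integral_add (hc.intervalIntegrable _ _) hi,
        intervalIntegral.integral_const_mul]
    rw [h5]
    linarith
  have hsum : ∀ N : ℕ, d * ∑ t ∈ Finset.Icc 1 N, K (x - t * d) ≤ ∫ y in (x - N * d)..x, F y := by
    intro N
    induction N with
    | zero => simp
    | succ N ih =>
      rw [Finset.sum_Icc_succ_top (by omega), mul_add]
      have h1 := hcell (x - (N + 1 : ℕ) * d)
      have h2 : x - ((N + 1 : ℕ) : ℝ) * d + d = x - N * d := by push_cast; ring
      rw [h2] at h1
      rw [← intervalIntegral.integral_add_adjacent_intervals (hFc.intervalIntegrable _ (x - N * d))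
        (hFc.intervalIntegrable _ _)]
      linarith
  refine (hsum T).trans ?_
  rw [intervalIntegral.integral_of_le (by nlinarith [Nat.cast_nonneg (α := ℝ) T])]
  refine (setIntegral_le_integral hFi (Eventually.of_forall hF0)).trans (le_of_eq ?_)
  rw [hF, integral_add hKi (hK'.abs.const_mul d), integral_const_mul]

/-- The ⌊l⌋ integers from ⌈a⌉ on lie in the window, and ⌊l⌋ ≥ l/2 for l ≥ 2. Positivity of `a`
excludes the index 0. -/
lemma sum_Icc_ge_of_window {f : ℕ → ℝ} (hf : ∀ t, 0 ≤ f t) {T : ℕ} {a l c : ℝ} (ha : 0 < a)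
    (hl : 2 ≤ l) (hT : a + l ≤ T) (hc : 0 ≤ c) (hwin : ∀ t : ℕ, a ≤ t → (t : ℝ) ≤ a + l → c ≤ f t) :
    c * (l / 2) ≤ ∑ t ∈ Finset.Icc 1 T, f t := by
  have hce := Nat.le_ceil a
  have hce' := Nat.ceil_lt_add_one ha.le
  have hfl := Nat.floor_le (show 0 ≤ l by linarith)
  have hfl' := Nat.lt_floor_add_one l
  have hpos : 0 < ⌈a⌉₊ := Nat.ceil_pos.2 ha
  have hmem : ∀ t ∈ Finset.Ico ⌈a⌉₊ (⌈a⌉₊ + ⌊l⌋₊), a ≤ (t : ℝ) ∧ (t : ℝ) ≤ a + l := by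
    intro t ht
    obtain ⟨h1, h2⟩ := Finset.mem_Ico.1 ht
    have h1' : (⌈a⌉₊ : ℝ) ≤ t := by exact_mod_cast h1
    have h2' : (t : ℝ) + 1 ≤ ⌈a⌉₊ + ⌊l⌋₊ := by exact_mod_cast h2
    constructor <;> linarith
  have hsub : Finset.Ico ⌈a⌉₊ (⌈a⌉₊ + ⌊l⌋₊) ⊆ Finset.Icc 1 T := by
    intro t ht
    obtain ⟨h1, h2⟩ := hmem t ht
    refine Finset.mem_Icc.2 ⟨by have := (Finset.mem_Ico.1 ht).1; omega, ?_⟩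
    exact_mod_cast h2.trans hT
  calc c * (l / 2) ≤ c * ⌊l⌋₊ := by gcongr; linarith
    _ = ∑ t ∈ Finset.Ico ⌈a⌉₊ (⌈a⌉₊ + ⌊l⌋₊), c := by simp [mul_comm]
    _ ≤ ∑ t ∈ Finset.Ico ⌈a⌉₊ (⌈a⌉₊ + ⌊l⌋₊), f t :=
        Finset.sum_le_sum fun t ht => hwin t (hmem t ht).1 (hmem t ht).2
    _ ≤ _ := Finset.sum_le_sum_of_subset_of_nonneg hsub fun t _ _ => hf t

section

variable {Ω S : Type*} [MeasurableSpace Ω] [MeasurableSpace S] {dθ dρ dz : ℕ}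
  {M : Setup Ω S dθ dρ dz} {m : ℕ → ℕ} {k : ℕ}

lemma Setup.KernelAssumption.integrable_deriv (hK : M.KernelAssumption m k) :
    Integrable (deriv M.K) := by
  have hc : Continuous (deriv M.K) := hK.smooth.continuous_deriv (by
    have := hK.two_le
    exact_mod_cast (by omega : 1 ≤ k))
  rcases hK.tail with ⟨L, hL⟩ | ⟨C, L, v, hL, hv, hC, ht⟩
  · refine hc.integrable_of_hasCompactSupport (HasCompactSupport.deriv ?_)
    refine HasCompactSupport.intro (isCompact_closedBall (0 : ℝ) L) fun x hx => hL x ?_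
    simpa using hx
  · exact integrable_of_rpow_tail hc hL hv hC ht

/-- The total weight is a Riemann sum of `K` with mesh 1/(Th), which is at most one for large `T`.
-/
lemma Setup.KernelAssumption.exists_weight_le (hK : M.KernelAssumption m k) :
    ∃ W > 0, ∀ᶠ T in atTop, ∀ u, kernelWeight M.K (M.h T) T u ≤ W := by
  refine ⟨1 + ∫ y, |deriv M.K y|, by
    have : 0 ≤ ∫ y, |deriv M.K y| := integral_nonneg fun _ => abs_nonneg _
    linarith, ?_⟩
  filter_upwards [hK.Th_top.eventually_ge_atTop 1, eventually_ge_atTop 1] with T hT hT1 u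
  have hh := hK.h_pos T hT1
  have hTpos : (0 : ℝ) < T := by exact_mod_cast hT1
  have hk1 : ContDiff ℝ 1 M.K := hK.smooth.of_le (by
    have := hK.two_le
    exact_mod_cast (by omega : 1 ≤ k))
  have h1 := riemannSum_le hK.nonneg hk1 hK.integrable hK.integrable_deriv
    (d := 1 / (T * M.h T)) (by positivity) (u / M.h T) T
  have h2 : 1 / (T * M.h T) * ∫ y, |deriv M.K y| ≤ ∫ y, |deriv M.K y| :=
    mul_le_of_le_one_left (integral_nonneg fun _ => abs_nonneg _)
      ((div_le_one (by positivity)).2 hT)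
  rw [hK.integral_one] at h1
  refine le_trans (le_of_eq ?_) (h1.trans (by linarith))
  unfold kernelWeight
  congr 1
  refine Finset.sum_congr rfl fun t _ => ?_
  congr 1
  field_simp

/-- By symmetry the kernel is bounded below on a window on each side of zero. Both sides are wanted,
because near an end of [0, 1] observations exist on one side only. -/
lemma Setup.KernelAssumption.exists_interval (hK : M.KernelAssumption m k) :
    ∃ p r c : ℝ, 0 < p ∧ 0 < r ∧ 0 < c ∧ ∀ x, p ≤ |x| → |x| ≤ p + r → c ≤ M.K x := by
  have hcont := hK.smooth.continuous
  have habs : ∀ x, M.K |x| = M.K x := fun x => by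
    rcases abs_choice x with h | h <;> rw [h]
    exact hK.symm x
  obtain ⟨p, hp, hKp⟩ : ∃ p > 0, 0 < M.K p := by
    by_contra! hcon
    have hz : M.K =ᵐ[volume] 0 := by
      have : ∀ᵐ x : ℝ, x ≠ 0 := by simp [ae_iff]
      filter_upwards [this] with x hx
      have := hcon |x| (abs_pos.2 hx)
      rw [habs] at this
      exact le_antisymm this (hK.nonneg x)
    have := hK.integral_one
    rw [integral_congr_ae hz] at this
    simp at this
  obtain ⟨δ, hδ, hb⟩ := Metric.continuous_iff.1 hcont p (M.K p / 2) (by positivity)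
  refine ⟨p, δ / 2, M.K p / 2, hp, by positivity, by positivity, fun x h1 h2 => ?_⟩
  have := hb |x| (by rw [Real.dist_eq, abs_lt]; constructor <;> linarith)
  rw [habs, Real.dist_eq, abs_lt] at this
  linarith [this.1]

/-- The window is taken to the left of `u` when u ≥ 1/2 and to the right otherwise; for small `h` it
stays inside the sample. It contains at least Thr/2 observations, each with kernel value at least
`c`. -/
lemma Setup.KernelAssumption.exists_le_weight (hK : M.KernelAssumption m k) :
    ∃ c > 0, ∀ᶠ T in atTop, ∀ u ∈ Icc (0 : ℝ) 1, c ≤ kernelWeight M.K (M.h T) T u := by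
  obtain ⟨p, r, c, hp, hr, hc, hwin⟩ := hK.exists_interval
  refine ⟨c * (r / 2), by positivity, ?_⟩
  have hsmall : ∀ᶠ T in atTop, M.h T < 1 / (4 * (p + r)) :=
    hK.h_zero.eventually_lt_const (by positivity)
  filter_upwards [hK.Th_top.eventually_ge_atTop (2 / r), eventually_ge_atTop 1, hsmall]
    with T hT hT1 hs u hu
  have hh := hK.h_pos T hT1
  have hTpos : (0 : ℝ) < T := by exact_mod_cast hT1
  rw [lt_div_iff₀ (by positivity)] at hs
  rw [div_le_iff₀ hr] at hT
  have hprod : (T : ℝ) * M.h T * (p + r) ≤ T / 4 := by nlinarith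
  have key : c * (T * M.h T * r / 2) ≤ ∑ t ∈ Finset.Icc 1 T, M.K ((u - (t : ℝ) / T) / M.h T) := by
    have hx : ∀ t : ℕ, (u - (t : ℝ) / T) / M.h T = (T * u - t) / (T * M.h T) := fun t => by
      field_simp
    have habsx : ∀ t : ℕ, |(u - (t : ℝ) / T) / M.h T| = |T * u - t| / (T * M.h T) := fun t => by
      rw [hx, abs_div, abs_of_pos (show (0 : ℝ) < T * M.h T by positivity)]
    rcases le_total (1 / 2) u with hu2 | hu2
    · refine sum_Icc_ge_of_window (a := T * u - T * M.h T * (p + r)) (fun t => hK.nonneg _)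
        (by nlinarith) hT ?_ hc.le fun t h1 h2 => hwin _ ?_ ?_
      · nlinarith [hu.2, mul_pos (mul_pos hTpos hh) hp]
      · rw [habsx, le_div_iff₀ (by positivity)]
        refine le_trans ?_ (le_abs_self _)
        linarith
      · rw [habsx, div_le_iff₀ (by positivity), abs_of_nonneg]
        · linarith
        · have : 0 < p * (T * M.h T) := by positivity
          linarith
    · refine sum_Icc_ge_of_window (a := T * u + T * M.h T * p) (fun t => hK.nonneg _)
        ?_ hT ?_ hc.le fun t h1 h2 => hwin _ ?_ ?_
      · have : 0 < T * M.h T * p := by positivity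
        nlinarith [hu.1]
      · nlinarith
      · rw [habsx, le_div_iff₀ (by positivity)]
        refine le_trans ?_ (neg_le_abs _)
        linarith
      · rw [habsx, div_le_iff₀ (by positivity), abs_of_nonpos]
        · linarith
        · have : 0 < T * M.h T * p := by positivity
          linarith
  unfold kernelWeight
  rw [one_div, inv_mul_eq_div, le_div_iff₀ (by positivity)]
  linarith

/-- Weighted sums of terms which are small near `u` are small. -/
lemma Setup.KernelAssumption.weighted_sum_le (hK : M.KernelAssumption m k) {a ε : ℝ} (ha : 0 < a)
    (hε : 0 < ε) : ∀ᶠ T in atTop, ∀ (u B ε' : ℝ) (b : ℕ → ℝ), 0 ≤ ε' →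
      (∀ t ∈ Finset.Icc 1 T, |b t| ≤ B) →
      (∀ t ∈ Finset.Icc 1 T, |u - (t : ℝ) / T| ≤ a → |b t| ≤ ε') →
      |1 / (T * M.h T) * ∑ t ∈ Finset.Icc 1 T, b t * M.K ((u - (t : ℝ) / T) / M.h T)| ≤
        ε' * kernelWeight M.K (M.h T) T u + B * ε := by
  have hdec := hK.decay
  rw [← Metric.cobounded_eq_cocompact] at hdec
  -- Since |x| K(x) < εa far out, and |x| > a/h for observations at distance more than `a`, their
  -- kernel values are at most εh. At most `T` such terms, divided by Th, cost ε in total.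
  obtain ⟨R, -, hR⟩ := (hasBasis_cobounded_norm (E := ℝ)).eventually_iff.1
    (hdec.eventually_lt_const (mul_pos hε ha))
  have hR' : ∀ᶠ T in atTop, M.h T < a / (|R| + 1) :=
    hK.h_zero.eventually_lt_const (by positivity)
  filter_upwards [eventually_ge_atTop 1, hR'] with T hT1 hTR u B ε' b hε' hB hb
  have hh := hK.h_pos T hT1
  have hTpos : (0 : ℝ) < T := by exact_mod_cast hT1
  have hB0 : 0 ≤ B := (abs_nonneg _).trans (hB 1 (Finset.mem_Icc.2 ⟨le_rfl, hT1⟩))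
  have hterm : ∀ t ∈ Finset.Icc 1 T, |b t * M.K ((u - (t : ℝ) / T) / M.h T)| ≤
      ε' * M.K ((u - (t : ℝ) / T) / M.h T) + B * (ε * M.h T) := by
    intro t ht
    have hK0 := hK.nonneg ((u - (t : ℝ) / T) / M.h T)
    rw [abs_mul, abs_of_nonneg hK0]
    rcases le_or_gt |u - (t : ℝ) / T| a with hle | hgt
    · have : 0 ≤ B * (ε * M.h T) := by positivity
      nlinarith [mul_le_mul_of_nonneg_right (hb t ht hle) hK0]
    · have hx : a / M.h T < |(u - (t : ℝ) / T) / M.h T| := by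
        rw [abs_div, abs_of_pos hh]
        exact div_lt_div_of_pos_right hgt hh
      have hRx : R ≤ ‖(u - (t : ℝ) / T) / M.h T‖ := by
        rw [Real.norm_eq_abs]
        have : |R| + 1 < a / M.h T := by
          rw [lt_div_iff₀ (by positivity)] at hTR ⊢
          linarith
        linarith [le_abs_self R]
      have h1 := hR hRx
      have h2 : a / M.h T * M.K ((u - (t : ℝ) / T) / M.h T) ≤ ε * a :=
        (mul_le_mul_of_nonneg_right hx.le hK0).trans h1.le
      have h3 : M.K ((u - (t : ℝ) / T) / M.h T) ≤ ε * M.h T := by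
        rw [div_mul_eq_mul_div, div_le_iff₀ hh] at h2
        nlinarith
      have h4 := mul_le_mul (hB t ht) h3 hK0 hB0
      have : 0 ≤ ε' * M.K ((u - (t : ℝ) / T) / M.h T) := by positivity
      linarith
  rw [abs_mul, abs_of_pos (show (0 : ℝ) < 1 / (T * M.h T) by positivity)]
  have hsum := (Finset.abs_sum_le_sum_abs _ _).trans (Finset.sum_le_sum hterm)
  refine (mul_le_mul_of_nonneg_left hsum (by positivity)).trans (le_of_eq ?_)
  rw [Finset.sum_add_distrib, ← Finset.mul_sum, Finset.sum_const, Nat.card_Icc, nsmul_eq_mul]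
  unfold kernelWeight
  simp only [Nat.add_sub_cancel]
  field_simp

end

end LII

namespace LII

/-! ### Increments of the criterion of one observation -/

section Increment

variable {Ω S : Type*} [MeasurableSpace Ω] [MeasurableSpace S] {dθ dρ dz : ℕ}
  {M : Setup Ω S dθ dρ dz} {M₀ : Euc dρ → ℝ → ℝ} {ρ₀ : ℝ → Euc dρ} {ρ₀s : ℝ → Euc dθ → Euc dρ}
  {ε₀ : ℝ}

/-- The increment of the criterion of one observation, from a reference parameter `b`. -/
def Setup.incr (M : Setup Ω S dθ dρ dz) (b : Euc dρ) (p : ℝ × Euc dz) (ρ : Euc dρ) : ℝ :=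
  M.G p.1 p.2 ρ - M.G p.1 p.2 b

lemma Setup.AuxiliaryAssumption.G_lipschitz (hM : M.Basic)
    (h3 : M.AuxiliaryAssumption M₀ ρ₀ ρ₀s ε₀) : ∃ C : ℝ, 0 ≤ C ∧
      ∀ (p p' : ℝ × Euc dz), ∀ ρ ∈ M.O, ∀ ρ' ∈ M.O,
        |M.G p.1 p.2 ρ - M.G p'.1 p'.2 ρ'| ≤ C * (‖p - p'‖ + ‖ρ - ρ'‖) := by
  obtain ⟨C, hC⟩ := h3.G_bdd
  have hopen : IsOpen (univ ×ˢ univ ×ˢ M.O : Set (ℝ × Euc dz × Euc dρ)) :=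
    isOpen_univ.prod (isOpen_univ.prod hM.open_O)
  have hconv : Convex ℝ (univ ×ˢ univ ×ˢ M.O : Set (ℝ × Euc dz × Euc dρ)) :=
    convex_univ.prod (convex_univ.prod hM.convex_O)
  refine ⟨|C|, abs_nonneg _, fun p p' ρ hρ ρ' hρ' => ?_⟩
  have h := hconv.norm_image_sub_le_of_norm_fderiv_le (𝕜 := ℝ)
    (f := fun p : ℝ × Euc dz × Euc dρ => M.G p.1 p.2.1 p.2.2) (C := |C|)
    (x := (p'.1, p'.2, ρ')) (y := (p.1, p.2, ρ))
    (fun x hx => (h3.G_smooth.differentiableOn two_ne_zero x hx).differentiableAt (hopen.mem_nhds hx))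
    (fun x hx => (hC x hx).1.trans (le_abs_self C)) ⟨trivial, trivial, hρ'⟩ ⟨trivial, trivial, hρ⟩
  rw [Real.norm_eq_abs] at h
  refine h.trans (mul_le_mul_of_nonneg_left ?_ (abs_nonneg _))
  simp only [Prod.mk_sub_mk, Prod.norm_def, Prod.fst_sub, Prod.snd_sub]
  refine max_le ?_ (max_le ?_ ?_)
  · exact le_add_of_le_of_nonneg (le_max_left _ _) (norm_nonneg _)
  · exact le_add_of_le_of_nonneg (le_max_right _ _) (norm_nonneg _)
  · exact le_add_of_nonneg_left (le_max_of_le_left (norm_nonneg _))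

lemma Setup.AuxiliaryAssumption.incr_lipschitz (hM : M.Basic)
    (h3 : M.AuxiliaryAssumption M₀ ρ₀ ρ₀s ε₀) {b : Euc dρ} (hb : b ∈ M.Γ) : ∃ C : ℝ, 0 ≤ C ∧
      ∀ (p p' : ℝ × Euc dz), ∀ ρ ∈ M.Γ, ∀ ρ' ∈ M.Γ,
        |M.incr b p ρ - M.incr b p' ρ'| ≤ C * (‖p - p'‖ + ‖ρ - ρ'‖) := by
  obtain ⟨C, hC0, hC⟩ := h3.G_lipschitz hM
  refine ⟨2 * C, by positivity, fun p p' ρ hρ ρ' hρ' => ?_⟩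
  have h1 := abs_le.1 (hC p p' ρ (hM.Γ_sub_O hρ) ρ' (hM.Γ_sub_O hρ'))
  have h2 := abs_le.1 (hC p p' b (hM.Γ_sub_O hb) b (hM.Γ_sub_O hb))
  rw [sub_self, norm_zero, add_zero] at h2
  have h3 : 0 ≤ C * ‖ρ - ρ'‖ := by positivity
  rw [Setup.incr, Setup.incr, abs_le]
  constructor <;> linarith [h1.1, h1.2, h2.1, h2.2]

/-- The Lipschitz bound against the diameter of `Γ`; the criterion itself may be unbounded in the
data. -/
lemma Setup.AuxiliaryAssumption.incr_bounded (hM : M.Basic)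
    (h3 : M.AuxiliaryAssumption M₀ ρ₀ ρ₀s ε₀) {b : Euc dρ} (hb : b ∈ M.Γ) : ∃ B : ℝ, 0 < B ∧
      ∀ (p : ℝ × Euc dz), ∀ ρ ∈ M.Γ, |M.incr b p ρ| ≤ B := by
  obtain ⟨C, hC0, hC⟩ := h3.incr_lipschitz hM hb
  obtain ⟨R, hR⟩ := h3.compact_Γ.isBounded.subset_closedBall b
  refine ⟨C * |R| + 1, by positivity, fun p ρ hρ => ?_⟩
  have h := hC p p ρ hρ b hb
  have h0 : M.incr b p b = 0 := sub_self _
  rw [h0, sub_zero, sub_self, norm_zero, zero_add] at h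
  have h1 : ‖ρ - b‖ ≤ |R| := by
    have := Metric.mem_closedBall.1 (hR hρ)
    rw [dist_eq_norm] at this
    exact this.trans (le_abs_self R)
  have := mul_le_mul_of_nonneg_left h1 hC0
  linarith

lemma Setup.AuxiliaryAssumption.continuous_incr (hM : M.Basic)
    (h3 : M.AuxiliaryAssumption M₀ ρ₀ ρ₀s ε₀) {b : Euc dρ} (hb : b ∈ M.Γ) :
    ContinuousOn (fun x : (ℝ × Euc dz) × Euc dρ => M.incr b x.1 x.2) (univ ×ˢ M.Γ) := by
  obtain ⟨C, hC0, hC⟩ := h3.incr_lipschitz hM hb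
  have hlip : LipschitzOnWith (2 * C).toNNReal
      (fun x : (ℝ × Euc dz) × Euc dρ => M.incr b x.1 x.2) (univ ×ˢ M.Γ) := by
    refine LipschitzOnWith.of_dist_le_mul fun x hx y hy => ?_
    rw [Real.dist_eq, Real.coe_toNNReal _ (by positivity), dist_eq_norm]
    refine (hC x.1 y.1 x.2 hx.2 y.2 hy.2).trans ?_
    have h1 : ‖x.1 - y.1‖ ≤ ‖x - y‖ := norm_fst_le (x - y)
    have h2 : ‖x.2 - y.2‖ ≤ ‖x - y‖ := norm_snd_le (x - y)
    nlinarith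
  exact hlip.continuousOn

lemma Setup.AuxiliaryAssumption.measurable_incr (hM : M.Basic)
    (h3 : M.AuxiliaryAssumption M₀ ρ₀ ρ₀s ε₀) {b : Euc dρ} (hb : b ∈ M.Γ) {ρ : Euc dρ}
    (hρ : ρ ∈ M.Γ) : Measurable fun p => M.incr b p ρ :=
  Continuous.measurable ((h3.continuous_incr hM hb).comp_continuous
    (f := fun p : ℝ × Euc dz => (p, ρ)) (by fun_prop) fun _ => ⟨trivial, hρ⟩)

/-! ### The limit of the simulated criterion -/

/-- The stationary pair as a function of the history of the errors. -/
def Setup.pair (M : Setup Ω S dθ dρ dz) (u : ℝ) (θ : Euc dθ) (x : ℕ → S) : ℝ × Euc dz :=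
  (M.r (M.φ x θ) θ, M.ζ u x θ)

/-- The expected increment of the criterion at the stationary pair. -/
noncomputable def Setup.meanIncr (M : Setup Ω S dθ dρ dz) (b : Euc dρ) (u : ℝ) (θ : Euc dθ)
    (ρ : Euc dρ) : ℝ :=
  ∫ x, M.incr b (M.pair u θ x) ρ ∂Measure.infinitePi fun _ : ℕ => M.Q

lemma Setup.IsNoise.isProbabilityMeasure (hM : M.Basic) {e : ℤ → Ω → S} (he : M.IsNoise e) :
    IsProbabilityMeasure M.Q := by
  have := hM.prob
  rw [← he.law 0]
  exact Measure.isProbabilityMeasure_map (he.meas 0).aemeasurable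

/-- The law depends on `Q` alone, so regularity for almost every history of the observed errors
carries over to the simulated ones. -/
lemma Setup.StructuralAssumption.histLaw_eq (h1 : M.StructuralAssumption) :
    M.histLaw = Measure.infinitePi fun _ : ℕ => M.Q :=
  map_hist h1.noise.meas h1.noise.indep h1.noise.law 0

lemma Setup.StructuralAssumption.measurable_pair (hM : M.Basic) (h1 : M.StructuralAssumption)
    {u : ℝ} (hu : u ∈ Icc (0 : ℝ) 1) {θ : Euc dθ} (hθ : θ ∈ M.Θ) : Measurable (M.pair u θ) := by
  obtain ⟨V, C, hV, hΘV, hr, -, -⟩ := h1.smooth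
  have hrθ : Continuous fun e => M.r e θ :=
    hr.comp_continuous (f := fun e : ℝ => (e, θ)) (by fun_prop) fun e => ⟨trivial, hΘV hθ⟩
  exact (hrθ.measurable.comp (hM.meas_φ θ hθ)).prodMk (hM.meas_ζ u hu θ hθ)

lemma Setup.StructuralAssumption.continuousOn_pair (h1 : M.StructuralAssumption) :
    ∀ᵐ x ∂Measure.infinitePi fun _ : ℕ => M.Q,
      ContinuousOn (fun p : ℝ × Euc dθ => M.pair p.1 p.2 x) (Icc 0 1 ×ˢ M.Θ) := by
  obtain ⟨V, C, hV, hΘV, hr, -, hφ⟩ := h1.smooth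
  have hζ := h1.ζ_cont
  rw [h1.histLaw_eq] at hφ hζ
  filter_upwards [hφ, hζ] with x hx hz
  refine ContinuousOn.prodMk ?_ hz
  have hφc : ContinuousOn (fun p : ℝ × Euc dθ => M.φ x p.2) (Icc 0 1 ×ˢ M.Θ) :=
    hx.1.continuousOn.comp continuousOn_snd fun p hp => hΘV hp.2
  exact hr.comp (hφc.prodMk continuousOn_snd) fun p hp => ⟨trivial, hΘV hp.2⟩

lemma Setup.continuousOn_incr_pair (hM : M.Basic) (h1 : M.StructuralAssumption)
    (h3 : M.AuxiliaryAssumption M₀ ρ₀ ρ₀s ε₀) {b : Euc dρ} (hb : b ∈ M.Γ) :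
    ∀ᵐ x ∂Measure.infinitePi fun _ : ℕ => M.Q,
      ContinuousOn (fun p : (ℝ × Euc dθ) × Euc dρ => M.incr b (M.pair p.1.1 p.1.2 x) p.2)
        ((Icc 0 1 ×ˢ M.Θ) ×ˢ M.Γ) := by
  filter_upwards [h1.continuousOn_pair] with x hx
  exact (h3.continuous_incr hM hb).comp
    ((hx.comp continuousOn_fst fun p hp => hp.1).prodMk continuousOn_snd)
    fun p hp => ⟨trivial, hp.2⟩

lemma Setup.continuousOn_meanIncr (hM : M.Basic) (h1 : M.StructuralAssumption)
    (h3 : M.AuxiliaryAssumption M₀ ρ₀ ρ₀s ε₀) {b : Euc dρ} (hb : b ∈ M.Γ) :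
    ContinuousOn (fun p : (ℝ × Euc dθ) × Euc dρ => M.meanIncr b p.1.1 p.1.2 p.2)
      ((Icc 0 1 ×ˢ M.Θ) ×ˢ M.Γ) := by
  have := h1.noise.isProbabilityMeasure hM
  obtain ⟨B, hB0, hB⟩ := h3.incr_bounded hM hb
  refine continuousOn_of_dominated (bound := fun _ => B) (fun p hp => ?_) (fun p hp => ?_)
    (integrable_const B) (Setup.continuousOn_incr_pair hM h1 h3 hb)
  · exact ((h3.measurable_incr hM hb hp.2).comp
      (h1.measurable_pair hM hp.1.1 hp.1.2)).aestronglyMeasurable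
  · exact Eventually.of_forall fun x => hB _ _ hp.2

/-- The expectation of an increment at a stationary pair, driven by any white noise. -/
lemma Setup.integral_incr_pair (hM : M.Basic) (h1 : M.StructuralAssumption)
    (h3 : M.AuxiliaryAssumption M₀ ρ₀ ρ₀s ε₀) {b : Euc dρ} (hb : b ∈ M.Γ) {e : ℤ → Ω → S}
    (he : M.IsNoise e) {u : ℝ} (hu : u ∈ Icc (0 : ℝ) 1) {θ : Euc dθ} (hθ : θ ∈ M.Θ) {ρ : Euc dρ}
    (hρ : ρ ∈ M.Γ) (t : ℤ) :
    ∫ ω, M.incr b (M.pair u θ (hist (fun s => e s ω) t)) ρ ∂M.P = M.meanIncr b u θ ρ := by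
  have hm := (h3.measurable_incr hM hb hρ).comp (h1.measurable_pair hM hu hθ)
  rw [Setup.meanIncr, ← map_hist he.meas he.indep he.law t]
  exact (integral_map (measurable_hist_comp he.meas t).aemeasurable hm.aestronglyMeasurable).symm

lemma Setup.U_subset (hM : M.Basic) : M.U ⊆ Icc 0 1 := fun u hu =>
  ⟨hM.δ_nonneg.trans hu.1, hu.2.trans (by linarith [hM.δ_nonneg])⟩

lemma Setup.nonempty_U (hM : M.Basic) : M.U.Nonempty :=
  ⟨M.δ, le_rfl, by linarith [hM.δ_lt]⟩

/-- The limit of the simulated criterion and the expected increment differ by a constant. -/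
lemma Setup.simLimit_sub (hM : M.Basic) (h1 : M.StructuralAssumption)
    (h3 : M.AuxiliaryAssumption M₀ ρ₀ ρ₀s ε₀) {M₀s : Euc dρ → ℝ → Euc dθ → ℝ}
    (hM₀s : M.IsSimLimitCrit M₀s) {b : Euc dρ} (hb : b ∈ M.Γ) {u : ℝ} (hu : u ∈ M.U) {θ : Euc dθ}
    (hθ : θ ∈ M.Θ) {ρ : Euc dρ} (hρ : ρ ∈ M.Γ) :
    M₀s ρ u θ - M₀s b u θ = M.meanIncr b u θ ρ := by
  obtain ⟨hi, hl⟩ := hM₀s u hu θ hθ ρ hρ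
  obtain ⟨hi', hl'⟩ := hM₀s u hu θ hθ b hb
  refine tendsto_nhds_unique (hl.sub hl') (tendsto_const_nhds.congr' ?_)
  filter_upwards [eventually_ge_atTop 1] with T hT
  have hT' : (T : ℝ) ≠ 0 := by positivity
  rw [← mul_sub, ← Finset.sum_sub_distrib, Finset.sum_congr rfl (g := fun _ => M.meanIncr b u θ ρ)]
  · rw [Finset.sum_const, Nat.card_Icc, nsmul_eq_mul, Nat.add_sub_cancel]
    field_simp
  · intro t _
    rw [← integral_sub (hi t) (hi' t),
      ← Setup.integral_incr_pair hM h1 h3 hb h1.noise_sim (Setup.U_subset hM hu) hθ hρ (t : ℤ)]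
    rfl

lemma Setup.simCrit_sub (M : Setup Ω S dθ dρ dz) (T : ℕ) (ω : Ω) (u : ℝ) (θ : Euc dθ)
    (b ρ : Euc dρ) : M.simCrit T ω u θ ρ - M.simCrit T ω u θ b =
      1 / (T : ℝ) * ∑ t ∈ Finset.Icc 1 T,
        M.incr b (M.pair u θ (hist (fun s => M.νsim s ω) t)) ρ := by
  rw [Setup.simCrit, Setup.simCrit, ← mul_sub, ← Finset.sum_sub_distrib]
  rfl

/-- The simulated criterion orders the parameters as its limit does, up to small errors. -/
lemma Setup.simCrit_order (hM : M.Basic) (h1 : M.StructuralAssumption)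
    (h3 : M.AuxiliaryAssumption M₀ ρ₀ ρ₀s ε₀) {b : Euc dρ} (hb : b ∈ M.Γ) {η : ℝ} (hη : 0 < η) :
    AsympSure M.P fun T ω => ∀ x ∈ M.U ×ˢ M.Θ, ∀ ρ ∈ M.Γ, ∀ ρ' ∈ M.Γ,
      M.simCrit T ω x.1 x.2 ρ ≤ M.simCrit T ω x.1 x.2 ρ' →
        M.meanIncr b x.1 x.2 ρ ≤ M.meanIncr b x.1 x.2 ρ' + η := by
  have := h1.noise.isProbabilityMeasure hM
  obtain ⟨B, hB0, hB⟩ := h3.incr_bounded hM hb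
  have hcpt : IsCompact ((Icc (0 : ℝ) 1 ×ˢ M.Θ) ×ˢ M.Γ) :=
    (isCompact_Icc.prod h3.compact_Θ).prod h3.compact_Γ
  have : CompactSpace ↥((Icc (0 : ℝ) 1 ×ˢ M.Θ) ×ˢ M.Γ) := isCompact_iff_compactSpace.1 hcpt
  have : Nonempty ↥((Icc (0 : ℝ) 1 ×ˢ M.Θ) ×ˢ M.Γ) :=
    ⟨((0, M.θ₀ 0), b), ⟨by simp, hM.θ₀_mem 0 (by simp)⟩, hb⟩
  -- The parameter `ρ` belongs to the index, so one event serves all pairs `ρ`, `ρ'`; each of them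
  -- costs η/2.
  have key := asympSure_uniform_average (X := ↥((Icc (0 : ℝ) 1 ×ˢ M.Θ) ×ˢ M.Γ))
    h1.noise_sim.meas h1.noise_sim.indep h1.noise_sim.law
    (W := fun p x => M.incr b (M.pair p.1.1.1 p.1.1.2 x) p.1.2) (B := B)
    (fun p => (h3.measurable_incr hM hb p.2.2).comp (h1.measurable_pair hM p.2.1.1 p.2.1.2))
    (fun p x => hB _ _ p.2.2)
    (by
      filter_upwards [Setup.continuousOn_incr_pair hM h1 h3 hb] with x hx
      exact continuousOn_iff_continuous_domRestrict.1 hx) (half_pos hη)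
  refine key.mono (Eventually.of_forall fun T ω h => ?_)
  rintro ⟨u, θ⟩ ⟨hu, hθ⟩ ρ hρ ρ' hρ' hle
  have hu' := Setup.U_subset hM hu
  have e1 := (abs_lt.1 (h ⟨((u, θ), ρ), ⟨hu', hθ⟩, hρ⟩)).1
  have e2 := (abs_lt.1 (h ⟨((u, θ), ρ'), ⟨hu', hθ⟩, hρ'⟩)).2
  simp only at e1 e2 hle ⊢
  rw [← Setup.simCrit_sub] at e1 e2
  simp only [Setup.meanIncr] at e1 e2 ⊢
  linarith

end Increment

end LII

namespace LII

/-! ### Uniform convergence of centred kernel averages of the observed data -/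

section Centered

variable {Ω S : Type*} [MeasurableSpace Ω] [MeasurableSpace S] {dθ dρ dz : ℕ}
  {M : Setup Ω S dθ dρ dz} {m : ℕ → ℕ} {k : ℕ}

/-- The centred kernel average of `ψ (Y, Z)`. -/
noncomputable def Setup.centered (M : Setup Ω S dθ dρ dz) (ψ : ℝ × Euc dz → ℝ) (T : ℕ) (u : ℝ)
    (ω : Ω) : ℝ :=
  1 / (T * M.h T) * ∑ t ∈ Finset.Icc 1 T,
    (ψ (M.YZ T t ω) - ∫ ω', ψ (M.YZ T t ω') ∂M.P) * M.K ((u - (t : ℝ) / T) / M.h T)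

lemma Setup.Basic.measurable_YZ (hM : M.Basic) (T t : ℕ) : Measurable (M.YZ T t) :=
  (hM.meas_Y T t).prodMk (hM.meas_Z T t)

lemma Setup.abs_sub_integral_le (hM : M.Basic) {ψ : ℝ × Euc dz → ℝ} {B : ℝ}
    (hB : ∀ p, |ψ p| ≤ B) (T t : ℕ) (ω : Ω) :
    |ψ (M.YZ T t ω) - ∫ ω', ψ (M.YZ T t ω') ∂M.P| ≤ 2 * B := by
  have := hM.prob
  have h1 := hB (M.YZ T t ω)
  have h2 : |∫ ω', ψ (M.YZ T t ω') ∂M.P| ≤ B := by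
    have := norm_integral_le_of_norm_le_const (μ := M.P) (f := fun ω' => ψ (M.YZ T t ω'))
      (Eventually.of_forall fun ω => hB (M.YZ T t ω))
    simpa using this
  linarith [abs_sub (ψ (M.YZ T t ω)) (∫ ω', ψ (M.YZ T t ω') ∂M.P)]

lemma Setup.measurable_centered (hM : M.Basic) {ψ : ℝ × Euc dz → ℝ} (hψ : Measurable ψ) (T : ℕ)
    (u : ℝ) : Measurable (M.centered ψ T u) :=
  measurable_const.mul (Finset.measurable_sum _ fun t _ =>
    ((hψ.comp (hM.measurable_YZ T t)).sub_const _).mul_const _)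

lemma Setup.centered_neg (M : Setup Ω S dθ dρ dz) (ψ : ℝ × Euc dz → ℝ) (T : ℕ) (u : ℝ) (ω : Ω) :
    M.centered (fun p => -ψ p) T u ω = -M.centered ψ T u ω := by
  simp only [Setup.centered, integral_neg]
  rw [← mul_neg, ← Finset.sum_neg_distrib]
  congr 1
  exact Finset.sum_congr rfl fun t _ => by ring

/-- The row inequality with two scales: a block of length `n` carries at most 2Bκ n/(Th), while the
whole row carries at most 2BW. -/
lemma Setup.measure_le_centered (hM : M.Basic) (h4 : M.KernelAssumption m k)
    {ψ : ℝ × Euc dz → ℝ} (hψ : Measurable ψ) {B : ℝ} (hB0 : 0 ≤ B) (hB : ∀ p, |ψ p| ≤ B) {T n : ℕ}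
    (hT : 1 ≤ T) (hn : 1 ≤ n) {u W κ lam : ℝ} (hW : kernelWeight M.K (M.h T) T u ≤ W)
    (hκ : ∀ x, M.K x ≤ κ) (hlam : 0 ≤ lam) (hlv : lam * (2 * B * κ * (n / (T * M.h T))) ≤ 1) (x : ℝ) :
    M.P {ω | x ≤ M.centered ψ T u ω} ≤ 2 * ENNReal.ofReal (Real.exp
      (lam ^ 2 * (2 * B * κ * (n / (T * M.h T))) * (2 * B * W) +
        (T / n + 1) * (3 * phiCoef M.P M.YZ n) - lam * (x / 2))) := by
  have := hM.prob
  have hTpos : (0 : ℝ) < T := by exact_mod_cast hT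
  have hh := h4.h_pos T hT
  have hd : 0 < (T : ℝ) * M.h T := by positivity
  set w : ℕ → ℝ := fun s =>
    1 / (T * M.h T) * M.K ((u - ((s + 1 : ℕ) : ℝ) / T) / M.h T) with hw
  have hw0 : ∀ s, 0 ≤ w s := fun s => mul_nonneg (by positivity) (h4.nonneg _)
  set χ : ℕ → Ω → ℝ := fun s ω =>
    ψ (M.YZ T (s + 1) ω) - ∫ ω', ψ (M.YZ T (s + 1) ω') ∂M.P with hχ
  -- Extended by zero so that blocks may overrun the end of the row.
  set ξ : ℕ → Ω → ℝ := fun s ω => if s < T then χ s ω * w s else 0 with hξ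
  have hshift : ∀ f : ℕ → ℝ, ∑ t ∈ Finset.Icc 1 T, f t = ∑ s ∈ Finset.range T, f (s + 1) := by
    intro f
    rw [Finset.range_eq_Ico, Finset.sum_Ico_add' f 0 T 1, ← Finset.Ico_add_one_right_eq_Icc]
  have hψi : ∀ s, Integrable (fun ω => ψ (M.YZ T s ω)) M.P := fun s =>
    Integrable.of_bound (hψ.comp (hM.measurable_YZ T s)).aestronglyMeasurable B
      (Eventually.of_forall fun ω => hB _)
  have hsum : ∀ ω, M.centered ψ T u ω = ∑ s ∈ Finset.range T, ξ s ω := by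
    intro ω
    rw [Setup.centered, hshift, Finset.mul_sum]
    refine Finset.sum_congr rfl fun s hs => ?_
    simp only [hξ, if_pos (Finset.mem_range.1 hs), hχ, hw]
    ring
  simp only [hsum]
  refine measure_le_sum_row (X := M.YZ) hM.measurable_YZ hT hn (ξ := ξ)
    (a := fun s => if s < T then 2 * B * w s else 0) (fun s => ?_) (fun s ω => ?_) (fun s hs => ?_)
    (fun s => ?_) (fun i => ?_) ?_ hlam hlv x
  · by_cases hs : s < T
    · simp only [hξ, if_pos hs]
      have h1 : Measurable[rowField M.YZ T (s + 1) (s + 1)] (M.YZ T (s + 1)) :=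
        measurable_iff_comap_le.2 (le_iSup₂_of_le (f := fun i (_ : i ∈ _) =>
          MeasurableSpace.comap (M.YZ T i) _) (s + 1) ⟨by omega, by omega, le_rfl, le_rfl⟩ le_rfl)
      exact ((hψ.comp h1).sub_const _).mul_const _
    · simp only [hξ, if_neg hs]
      exact measurable_const
  · by_cases hs : s < T
    · simp only [hξ, if_pos hs]
      rw [abs_mul, abs_of_nonneg (hw0 s)]
      exact mul_le_mul_of_nonneg_right (Setup.abs_sub_integral_le hM hB _ _ _) (hw0 s)
    · simp only [hξ, if_neg hs, abs_zero, le_refl]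
  · simp only [if_neg (not_lt.2 hs)]
  · by_cases hs : s < T
    · simp only [hξ, if_pos hs, hχ]
      rw [integral_mul_const, integral_sub (hψi _) (integrable_const _)]
      simp
    · simp only [hξ, if_neg hs, integral_zero]
  · refine (Finset.sum_le_card_nsmul _ _ (2 * B * (1 / (T * M.h T) * κ)) fun l _ => ?_).trans
      (le_of_eq ?_)
    · have h1 : w (i + l) ≤ 1 / (T * M.h T) * κ := mul_le_mul_of_nonneg_left (hκ _) (by positivity)
      have h2 : 0 ≤ 2 * B * (1 / (T * M.h T) * κ) :=
        mul_nonneg (by positivity) ((hw0 _).trans h1)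
      split_ifs
      · exact mul_le_mul_of_nonneg_left h1 (by positivity)
      · exact h2
    · rw [Finset.card_range, nsmul_eq_mul]
      field_simp
  · have : ∑ s ∈ Finset.range T, (if s < T then 2 * B * w s else 0) =
        2 * B * kernelWeight M.K (M.h T) T u := by
      rw [kernelWeight, hshift, Finset.mul_sum, Finset.mul_sum]
      exact Finset.sum_congr rfl fun s hs => by rw [if_pos (Finset.mem_range.1 hs)]
    rw [this]
    exact mul_le_mul_of_nonneg_left hW (by positivity)

/-- The accumulated mixing error in the exponent stays bounded: since m ≤ T, T/m + 1 is at most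
2T/m, whence the factor 6. -/
lemma Setup.DependenceAssumption.eventually_mixing_le (h2 : M.DependenceAssumption m) :
    ∃ C : ℝ, ∀ T : ℕ, 1 ≤ T → ((T : ℝ) / m T + 1) * (3 * phiCoef M.P M.YZ (m T)) ≤ C := by
  obtain ⟨C, hC⟩ := h2.mixing_rate
  refine ⟨6 * C, fun T hT => ?_⟩
  obtain ⟨h1, h3⟩ := h2.m_range T hT
  have hm : (0 : ℝ) < m T := by exact_mod_cast h1
  have hmT : (1 : ℝ) ≤ T / m T := by
    rw [one_le_div hm]; exact_mod_cast h3
  have hφ := phiCoef_nonneg (P := M.P) (X := M.YZ) (m T)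
  have h4 : (T : ℝ) / m T * phiCoef M.P M.YZ (m T) ≤ C := by
    have := hC T hT
    rwa [mul_div_right_comm] at this
  nlinarith

/-- The deviation probability at one point is of smaller order than `T⁻⁵`. -/
lemma Setup.measure_abs_centered_le (hM : M.Basic) (h2 : M.DependenceAssumption m)
    (h4 : M.KernelAssumption m k) {ψ : ℝ × Euc dz → ℝ} (hψ : Measurable ψ) {B : ℝ} (hB0 : 0 < B)
    (hB : ∀ p, |ψ p| ≤ B) {x : ℝ} (hx : 0 < x) :
    ∃ C : ℝ, 0 ≤ C ∧ ∀ᶠ T : ℕ in atTop, ∀ u : ℝ,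
      M.P {ω | x ≤ |M.centered ψ T u ω|} ≤ ENNReal.ofReal (C / (T : ℝ) ^ 5) := by
  obtain ⟨W, hW0, hW⟩ := h4.exists_weight_le
  obtain ⟨κ', hκ'⟩ := h4.bounded
  obtain ⟨C, hC⟩ := h2.eventually_mixing_le
  set κ := max κ' 1 with hκdef
  have hκ0 : 0 < κ := lt_max_of_lt_right one_pos
  have hκ : ∀ y, M.K y ≤ κ := fun y => (hκ' y).trans (le_max_left _ _)
  set A := 2 * B * W with hA
  have hA0 : 0 < A := by positivity
  -- With λ = q/v, q ≤ 1 gives λv ≤ 1, and q ≤ x/(4A) makes the quadratic term at most half of the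
  -- linear term λx/2. What remains is λx/4 = c Th/m, which eventually exceeds 5 log T.
  set q := min 1 (x / (4 * A)) with hq
  have hq0 : 0 < q := lt_min one_pos (by positivity)
  have hqA : q * A ≤ x / 4 := by
    have := min_le_right 1 (x / (4 * A))
    rw [← hq, le_div_iff₀ (by positivity)] at this
    linarith
  set c := q * x / (8 * B * κ) with hc
  have hc0 : 0 < c := by positivity
  refine ⟨4 * Real.exp C, by positivity, ?_⟩
  filter_upwards [hW, h4.Th_rate.eventually_ge_atTop (5 / c), eventually_ge_atTop 2]
    with T hWT hrate hT2 u
  have hT1 : 1 ≤ T := by omega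
  have hTpos : (0 : ℝ) < T := by exact_mod_cast hT1
  have hh := h4.h_pos T hT1
  have hlog : 0 < Real.log T := Real.log_pos (by exact_mod_cast hT2)
  obtain ⟨hm1, -⟩ := h2.m_range T hT1
  have hmpos : (0 : ℝ) < m T := by exact_mod_cast hm1
  set v := 2 * B * κ * (m T / (T * M.h T)) with hv
  have hv0 : 0 < v := by positivity
  have hexp : c * (T * M.h T / m T) ≥ 5 * Real.log T := by
    rw [← div_div, le_div_iff₀ hlog] at hrate
    have := mul_le_mul_of_nonneg_left hrate hc0.le
    refine le_trans (le_of_eq ?_) this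
    field_simp
  have hone : ∀ ψ' : ℝ × Euc dz → ℝ, Measurable ψ' → (∀ p, |ψ' p| ≤ B) →
      M.P {ω | x ≤ M.centered ψ' T u ω} ≤ ENNReal.ofReal (2 * Real.exp C / (T : ℝ) ^ 5) := by
    intro ψ' hψ' hB'
    refine (Setup.measure_le_centered hM h4 hψ' hB0.le hB' hT1 hm1 (hWT u) hκ (lam := q / v)
      (by positivity) ?_ x).trans ?_
    · rw [← hv, div_mul_cancel₀ _ hv0.ne']
      exact min_le_left _ _
    · have htwo : ∀ y : ℝ, (2 : ℝ≥0∞) * ENNReal.ofReal y = ENNReal.ofReal (2 * y) := fun y => by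
        rw [ENNReal.ofReal_mul (by norm_num)]; simp
      rw [htwo]
      refine ENNReal.ofReal_le_ofReal ?_
      rw [mul_div_assoc]
      refine mul_le_mul_of_nonneg_left ?_ (by norm_num)
      have h5 : Real.exp C / (T : ℝ) ^ 5 = Real.exp (C - 5 * Real.log T) := by
        rw [Real.exp_sub]
        congr 1
        rw [mul_comm, Real.exp_mul, Real.exp_log hTpos]
        norm_cast
      rw [h5]
      refine Real.exp_le_exp.2 ?_
      rw [← hv, ← hA]
      have h6 := hC T hT1
      have h7 : (q / v) ^ 2 * v * A = q / v * (q * A) := by field_simp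
      have h8 : q / v * (q * A) ≤ q / v * (x / 4) :=
        mul_le_mul_of_nonneg_left hqA (by positivity)
      have h9 : q / v * (x / 4) = c * (T * M.h T / m T) := by
        rw [hc, hv]; field_simp; ring
      have h10 : q / v * (x / 2) = 2 * (q / v * (x / 4)) := by ring
      rw [h7, h10]
      linarith
  have hsub : {ω | x ≤ |M.centered ψ T u ω|} ⊆
      {ω | x ≤ M.centered ψ T u ω} ∪ {ω | x ≤ M.centered (fun p => -ψ p) T u ω} := by
    intro ω hω
    rcases le_abs.1 (show x ≤ |M.centered ψ T u ω| from hω) with h | h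
    · exact Or.inl h
    · right
      change x ≤ _
      rwa [Setup.centered_neg]
  refine (measure_mono hsub).trans ((measure_union_le _ _).trans ((add_le_add (hone ψ hψ hB)
    (hone _ hψ.neg fun p => by rw [Pi.neg_apply, abs_neg]; exact hB p)).trans (le_of_eq ?_)))
  rw [← ENNReal.ofReal_add (by positivity) (by positivity)]
  congr 1
  ring

/-- One factor 1/h comes from the normalization and one from the argument of the kernel; each is at
most `T` once Th ≥ 1. -/
lemma Setup.exists_centered_lipschitz (hM : M.Basic) (h4 : M.KernelAssumption m k)
    {ψ : ℝ × Euc dz → ℝ} {B : ℝ} (hB : ∀ p, |ψ p| ≤ B) :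
    ∃ C : ℝ, 0 ≤ C ∧ ∀ᶠ T : ℕ in atTop, ∀ (u u' : ℝ) (ω : Ω),
      |M.centered ψ T u ω - M.centered ψ T u' ω| ≤ C * (T : ℝ) ^ 2 * |u - u'| := by
  obtain ⟨L, hL⟩ := h4.lipschitz
  have hL0 : 0 ≤ L := by
    have := hL 0 1
    norm_num at this
    exact (abs_nonneg _).trans this
  have hB0 : 0 ≤ B := (abs_nonneg _).trans (hB 0)
  refine ⟨2 * B * L, by positivity, ?_⟩
  filter_upwards [h4.Th_top.eventually_ge_atTop 1, eventually_ge_atTop 1] with T hTh hT1 u u' ω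
  have hTpos : (0 : ℝ) < T := by exact_mod_cast hT1
  have hh := h4.h_pos T hT1
  rw [Setup.centered, Setup.centered, ← mul_sub, ← Finset.sum_sub_distrib, abs_mul,
    abs_of_pos (show (0 : ℝ) < 1 / (T * M.h T) by positivity)]
  have hterm : ∀ t ∈ Finset.Icc 1 T,
      |(ψ (M.YZ T t ω) - ∫ ω', ψ (M.YZ T t ω') ∂M.P) * M.K ((u - (t : ℝ) / T) / M.h T) -
        (ψ (M.YZ T t ω) - ∫ ω', ψ (M.YZ T t ω') ∂M.P) * M.K ((u' - (t : ℝ) / T) / M.h T)| ≤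
      2 * B * (L * (|u - u'| / M.h T)) := by
    intro t _
    rw [← mul_sub, abs_mul]
    refine mul_le_mul (Setup.abs_sub_integral_le hM hB _ _ _) ((hL _ _).trans (le_of_eq ?_))
      (abs_nonneg _) (by positivity)
    rw [← sub_div, abs_div, abs_of_pos hh]
    congr 3
    ring
  have hsum := (Finset.abs_sum_le_sum_abs _ _).trans (Finset.sum_le_card_nsmul _ _ _ hterm)
  refine (mul_le_mul_of_nonneg_left hsum (by positivity)).trans ?_
  rw [Nat.card_Icc, nsmul_eq_mul, Nat.add_sub_cancel]
  have h1 : 1 / M.h T ≤ T := by rw [div_le_iff₀ hh]; exact hTh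
  have h2 : (1 / M.h T) ^ 2 ≤ (T : ℝ) ^ 2 := pow_le_pow_left₀ (by positivity) h1 2
  calc 1 / (T * M.h T) * (T * (2 * B * (L * (|u - u'| / M.h T))))
      = 2 * B * L * (1 / M.h T) ^ 2 * |u - u'| := by field_simp
    _ ≤ _ := by gcongr

/-- Centred kernel averages of a bounded function of the data converge to zero uniformly. -/
lemma Setup.asympSure_centered (hM : M.Basic) (h2 : M.DependenceAssumption m)
    (h4 : M.KernelAssumption m k) {ψ : ℝ × Euc dz → ℝ} (hψ : Measurable ψ) {B : ℝ} (hB0 : 0 < B)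
    (hB : ∀ p, |ψ p| ≤ B) {η : ℝ} (hη : 0 < η) :
    AsympSure M.P fun T ω => ∀ u ∈ Icc (0 : ℝ) 1, |M.centered ψ T u ω| ≤ η := by
  obtain ⟨C, hC0, hC⟩ := Setup.measure_abs_centered_le hM h2 h4 hψ hB0 hB (half_pos hη)
  obtain ⟨L, hL0, hL⟩ := Setup.exists_centered_lipschitz hM h4 hB
  have hLT : Tendsto (fun T : ℕ => L / (T : ℝ)) atTop (𝓝 0) := tendsto_const_div_atTop_nhds_zero_nat L
  -- On a grid of mesh T⁻³ the Lipschitz constant of order T² leaves an error of order 1/T, and the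
  -- union bound over T³ + 1 points leaves a summable T⁻².
  refine AsympSure.of_summable (A := fun T => ⋃ i ∈ Finset.range (T ^ 3 + 1),
    {ω | η / 2 ≤ |M.centered ψ T ((i : ℝ) / (T : ℝ) ^ 3) ω|}) (b := fun T => 2 * C * (1 / (T : ℝ) ^ 2))
    (fun T => Finset.measurableSet_biUnion _ fun i _ => measurableSet_le measurable_const
      (Setup.measurable_centered hM hψ T _).abs)
    ((Real.summable_one_div_nat_pow.2 (by norm_num)).mul_left _) ?_ ?_
  · filter_upwards [hC, eventually_ge_atTop 1] with T hT hT1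
    have hTpos : (1 : ℝ) ≤ T := by exact_mod_cast hT1
    refine (measure_biUnion_finset_le _ _).trans ((Finset.sum_le_card_nsmul _ _ _
      fun i _ => hT _).trans ?_)
    rw [Finset.card_range, nsmul_eq_mul, ← ENNReal.ofReal_natCast,
      ← ENNReal.ofReal_mul (by positivity)]
    refine ENNReal.ofReal_le_ofReal ?_
    have h1 : ((T ^ 3 + 1 : ℕ) : ℝ) ≤ 2 * (T : ℝ) ^ 3 := by
      push_cast
      have : (1 : ℝ) ≤ (T : ℝ) ^ 3 := one_le_pow₀ hTpos
      linarith
    calc ((T ^ 3 + 1 : ℕ) : ℝ) * (C / (T : ℝ) ^ 5) ≤ 2 * (T : ℝ) ^ 3 * (C / (T : ℝ) ^ 5) := by gcongr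
      _ = 2 * C * (1 / (T : ℝ) ^ 2) := by
        have : (T : ℝ) ≠ 0 := by positivity
        field_simp
  · filter_upwards [hL, hLT.eventually_lt_const (half_pos hη), eventually_ge_atTop 1]
      with T hLip hsmall hT1 ω hω u hu
    have hTpos : (0 : ℝ) < T := by exact_mod_cast hT1
    have hT3 : (0 : ℝ) < (T : ℝ) ^ 3 := by positivity
    set i := ⌊u * (T : ℝ) ^ 3⌋₊ with hi
    have hi1 : (i : ℝ) ≤ u * (T : ℝ) ^ 3 := Nat.floor_le (mul_nonneg hu.1 hT3.le)
    have hi2 : u * (T : ℝ) ^ 3 < i + 1 := Nat.lt_floor_add_one _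
    have himem : i ∈ Finset.range (T ^ 3 + 1) := by
      rw [Finset.mem_range, Nat.lt_succ_iff]
      have : (i : ℝ) ≤ (T : ℝ) ^ 3 := hi1.trans (mul_le_of_le_one_left hT3.le hu.2)
      exact_mod_cast this
    have h1 : |M.centered ψ T ((i : ℝ) / (T : ℝ) ^ 3) ω| < η / 2 := by
      by_contra! hcon
      exact hω (mem_iUnion₂.2 ⟨i, himem, hcon⟩)
    have hdist : |u - (i : ℝ) / (T : ℝ) ^ 3| ≤ 1 / (T : ℝ) ^ 3 := by
      rw [abs_le]
      have e1 : (i : ℝ) / (T : ℝ) ^ 3 ≤ u := by rwa [div_le_iff₀ hT3]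
      have e2 : u ≤ (i : ℝ) / (T : ℝ) ^ 3 + 1 / (T : ℝ) ^ 3 := by
        rw [← add_div, le_div_iff₀ hT3]; exact hi2.le
      have e3 : 0 < 1 / (T : ℝ) ^ 3 := by positivity
      constructor <;> linarith
    have h2 := hLip u ((i : ℝ) / (T : ℝ) ^ 3) ω
    have h3 : L * (T : ℝ) ^ 2 * |u - (i : ℝ) / (T : ℝ) ^ 3| ≤ L / T := by
      calc _ ≤ L * (T : ℝ) ^ 2 * (1 / (T : ℝ) ^ 3) := by gcongr
        _ = L / T := by field_simp
    have h4 := abs_sub_abs_le_abs_sub (M.centered ψ T u ω) (M.centered ψ T ((i : ℝ) / (T : ℝ) ^ 3) ω)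
    linarith

end Centered

end LII

namespace LII

/-! ### The observed criterion -/

section Observed

variable {Ω S : Type*} [MeasurableSpace Ω] [MeasurableSpace S] {dθ dρ dz : ℕ}
  {M : Setup Ω S dθ dρ dz} {m : ℕ → ℕ} {k : ℕ} {M₀ : Euc dρ → ℝ → ℝ} {ρ₀ : ℝ → Euc dρ}
  {ρ₀s : ℝ → Euc dθ → Euc dρ} {ε₀ : ℝ}

/-- Markov's inequality for the scale of the error of a locally stationary approximation. -/
lemma tendsto_measure_abs_gt {P : Measure Ω} {C : ℕ → Ω → ℝ} {η B : ℝ} (hη : 0 < η)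
    (hC : ∀ T, Measurable (C T))
    (hB : ∀ T, 1 ≤ T → ∫⁻ ω, ENNReal.ofReal (|C T ω| ^ η) ∂P ≤ ENNReal.ofReal B) {a : ℝ}
    (ha : 0 < a) : Tendsto (fun T : ℕ => P {ω | a * T < |C T ω|}) atTop (𝓝 0) := by
  have hlim : Tendsto (fun T : ℕ => ENNReal.ofReal (B / (a * T) ^ η)) atTop (𝓝 0) := by
    have h1 : Tendsto (fun T : ℕ => (a * (T : ℝ)) ^ η) atTop atTop :=
      (tendsto_rpow_atTop hη).comp (tendsto_natCast_atTop_atTop.const_mul_atTop ha)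
    simpa using ENNReal.tendsto_ofReal (h1.const_div_atTop B)
  refine tendsto_of_tendsto_of_tendsto_of_le_of_le' tendsto_const_nhds hlim
    (Eventually.of_forall fun _ => zero_le) ?_
  filter_upwards [eventually_ge_atTop 1] with T hT
  have hTpos : (0 : ℝ) < T := by exact_mod_cast hT
  have haT : 0 < (a * (T : ℝ)) ^ η := by positivity
  have hm : AEMeasurable (fun ω => ENNReal.ofReal (|C T ω| ^ η)) P :=
    ((hC T).abs.pow_const η).ennreal_ofReal.aemeasurable
  refine (measure_mono fun ω hω => ?_).trans ((meas_ge_le_lintegral_div hm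
    (ENNReal.ofReal_pos.2 haT).ne' ENNReal.ofReal_ne_top).trans
    ((ENNReal.div_le_div_right (hB T hT) _).trans (le_of_eq
      (ENNReal.ofReal_div_of_pos haT).symm)))
  exact ENNReal.ofReal_le_ofReal (Real.rpow_le_rpow (by positivity) (le_of_lt hω) hη.le)

lemma Setup.integrable_incr_YZ (hM : M.Basic) (h3 : M.AuxiliaryAssumption M₀ ρ₀ ρ₀s ε₀)
    {b : Euc dρ} (hb : b ∈ M.Γ) {ρ : Euc dρ} (hρ : ρ ∈ M.Γ) (T t : ℕ) :
    Integrable (fun ω => M.incr b (M.YZ T t ω) ρ) M.P := by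
  have := hM.prob
  obtain ⟨B, -, hB⟩ := h3.incr_bounded hM hb
  exact Integrable.of_bound ((h3.measurable_incr hM hb hρ).comp
    (hM.measurable_YZ T t)).aestronglyMeasurable B (Eventually.of_forall fun ω => hB _ ρ hρ)

/-- The expected increments at the data are close to those at the stationary approximation. -/
lemma Setup.integral_incr_YZ_sub_le (hM : M.Basic) (h1 : M.StructuralAssumption)
    (h2 : M.DependenceAssumption m) (h3 : M.AuxiliaryAssumption M₀ ρ₀ ρ₀s ε₀) {b : Euc dρ}
    (hb : b ∈ M.Γ) {κ : ℝ} (hκ : 0 < κ) :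
    ∀ᶠ T : ℕ in atTop, ∀ t ∈ Finset.Icc 1 T, ∀ ρ ∈ M.Γ,
      |(∫ ω, M.incr b (M.YZ T t ω) ρ ∂M.P) -
        M.meanIncr b ((t : ℝ) / T) (M.θ₀ ((t : ℝ) / T)) ρ| ≤ κ := by
  have := hM.prob
  obtain ⟨B, hB0, hB⟩ := h3.incr_bounded hM hb
  obtain ⟨L, hL0, hL⟩ := h3.incr_lipschitz hM hb
  obtain ⟨-, C, η, D, hη, hC, hD, happ⟩ := h2.locStat
  -- If |C_T| ≤ aT, the approximation error is at most `a` and the increments differ by at most La ≤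
  -- κ/2. On the remaining event the increments are merely bounded, so its vanishing probability
  -- suffices.
  set a := κ / (2 * (L + 1)) with ha
  have ha0 : 0 < a := by positivity
  have hLa : L * a ≤ κ / 2 := by
    rw [ha, mul_div_assoc', div_le_div_iff₀ (by positivity) (by norm_num)]
    nlinarith
  have hlim := tendsto_measure_abs_gt hη hC hD ha0
  have hlim' : Tendsto (fun T : ℕ => 2 * B * M.P.real {ω | a * T < |C T ω|}) atTop (𝓝 0) := by
    have := ((ENNReal.tendsto_toReal ENNReal.zero_ne_top).comp hlim).const_mul (2 * B)
    simpa [measureReal_def] using this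
  filter_upwards [hlim'.eventually_lt_const (half_pos hκ), eventually_ge_atTop 1]
    with T hsmall hT1 t ht ρ hρ
  have hTpos : (0 : ℝ) < T := by exact_mod_cast hT1
  obtain ⟨ht1, htT⟩ := Finset.mem_Icc.1 ht
  have hu : (t : ℝ) / T ∈ Icc (0 : ℝ) 1 :=
    ⟨by positivity, (div_le_one hTpos).2 (by exact_mod_cast htT)⟩
  have hyzm : Measurable (M.yz ((t : ℝ) / T) t) :=
    (h1.measurable_pair hM hu (hM.θ₀_mem _ hu)).comp (measurable_hist_comp h1.noise.meas t)
  have hi := Setup.integrable_incr_YZ hM h3 hb hρ T t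
  have hi' : Integrable (fun ω => M.incr b (M.yz ((t : ℝ) / T) t ω) ρ) M.P :=
    Integrable.of_bound ((h3.measurable_incr hM hb hρ).comp hyzm).aestronglyMeasurable B
      (Eventually.of_forall fun ω => hB _ ρ hρ)
  have hE : MeasurableSet {ω | a * T < |C T ω|} := measurableSet_lt measurable_const (hC T).abs
  rw [← Setup.integral_incr_pair hM h1 h3 hb h1.noise hu (hM.θ₀_mem _ hu) hρ (t : ℤ)]
  change |(∫ ω, M.incr b (M.YZ T t ω) ρ ∂M.P) - ∫ ω, M.incr b (M.yz ((t : ℝ) / T) t ω) ρ ∂M.P| ≤ κ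
  rw [← integral_sub hi hi']
  have hbound : ∫ ω, |M.incr b (M.YZ T t ω) ρ - M.incr b (M.yz ((t : ℝ) / T) t ω) ρ| ∂M.P ≤
      ∫ ω, (κ / 2 + {ω | a * T < |C T ω|}.indicator (fun _ => 2 * B) ω) ∂M.P := by
    refine integral_mono_ae (hi.sub hi').abs
      ((integrable_const _).add ((integrable_const _).indicator hE)) ?_
    filter_upwards [happ T hT1] with ω hω
    by_cases hmem : a * T < |C T ω|
    · rw [indicator_of_mem (by exact hmem)]
      have h5 := hB (M.YZ T t ω) ρ hρ
      have h6 := hB (M.yz ((t : ℝ) / T) t ω) ρ hρ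
      linarith [abs_sub (M.incr b (M.YZ T t ω) ρ) (M.incr b (M.yz ((t : ℝ) / T) t ω) ρ)]
    · rw [indicator_of_notMem (by exact hmem), add_zero]
      have h5 := hL (M.YZ T t ω) (M.yz ((t : ℝ) / T) t ω) ρ hρ ρ hρ
      rw [sub_self, norm_zero, add_zero] at h5
      have h6 : ‖M.YZ T t ω - M.yz ((t : ℝ) / T) t ω‖ ≤ a := by
        refine (hω t ht).trans ?_
        rw [div_le_iff₀ hTpos]
        exact (le_abs_self _).trans (not_lt.1 hmem)
      exact h5.trans ((mul_le_mul_of_nonneg_left h6 hL0).trans hLa)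
  refine abs_integral_le_integral_abs.trans (hbound.trans ?_)
  rw [integral_add (integrable_const _) ((integrable_const _).indicator hE),
    integral_indicator_const _ hE]
  simp only [integral_const, probReal_univ, smul_eq_mul, one_mul]
  linarith

lemma Setup.abs_meanIncr_le (hM : M.Basic) (h1 : M.StructuralAssumption) {b : Euc dρ} {B : ℝ}
    (hB : ∀ (p : ℝ × Euc dz), ∀ ρ ∈ M.Γ, |M.incr b p ρ| ≤ B) (u : ℝ) (θ : Euc dθ) {ρ : Euc dρ}
    (hρ : ρ ∈ M.Γ) : |M.meanIncr b u θ ρ| ≤ B := by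
  have := h1.noise.isProbabilityMeasure hM
  have := norm_integral_le_of_norm_le_const (μ := Measure.infinitePi fun _ : ℕ => M.Q)
    (f := fun x => M.incr b (M.pair u θ x) ρ) (Eventually.of_forall fun x => hB _ ρ hρ)
  simpa [Setup.meanIncr] using this

lemma Setup.continuousOn_meanIncr_θ₀ (hM : M.Basic) (h1 : M.StructuralAssumption)
    (h3 : M.AuxiliaryAssumption M₀ ρ₀ ρ₀s ε₀) {b : Euc dρ} (hb : b ∈ M.Γ) :
    ContinuousOn (fun p : ℝ × Euc dρ => M.meanIncr b p.1 (M.θ₀ p.1) p.2) (Icc 0 1 ×ˢ M.Γ) :=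
  (Setup.continuousOn_meanIncr hM h1 h3 hb).comp (f := fun p : ℝ × Euc dρ => ((p.1, M.θ₀ p.1), p.2))
    ((continuousOn_fst.prodMk (h1.θ₀_cont.comp continuousOn_fst fun _ hp => hp.1)).prodMk
      continuousOn_snd)
    fun _ hp => ⟨⟨hp.1, hM.θ₀_mem _ hp.1⟩, hp.2⟩

/-- The kernel average of the expected increments, up to the total weight. -/
lemma Setup.kernel_average_meanIncr (hM : M.Basic) (h1 : M.StructuralAssumption)
    (h2 : M.DependenceAssumption m) (h3 : M.AuxiliaryAssumption M₀ ρ₀ ρ₀s ε₀)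
    (h4 : M.KernelAssumption m k) {b : Euc dρ} (hb : b ∈ M.Γ) {κ : ℝ} (hκ : 0 < κ) :
    ∀ᶠ T : ℕ in atTop, ∀ u ∈ Icc (0 : ℝ) 1, ∀ ρ ∈ M.Γ,
      |1 / (T * M.h T) * ∑ t ∈ Finset.Icc 1 T, (∫ ω, M.incr b (M.YZ T t ω) ρ ∂M.P) *
          M.K ((u - (t : ℝ) / T) / M.h T) -
        M.meanIncr b u (M.θ₀ u) ρ * kernelWeight M.K (M.h T) T u| ≤ κ := by
  have := hM.prob
  obtain ⟨B, hB0, hB⟩ := h3.incr_bounded hM hb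
  obtain ⟨W, hW0, hW⟩ := h4.exists_weight_le
  -- Near `u` the stationary approximation and continuity in time cost κ' each, hence 2κ'W = κ/2
  -- after weighting; the distant observations cost 2B · κ/(4B) = κ/2.
  set κ' := κ / (4 * W) with hκ'
  have hκ'0 : 0 < κ' := by positivity
  obtain ⟨a, ha, hcont⟩ := Metric.uniformContinuousOn_iff.1
    ((isCompact_Icc.prod h3.compact_Γ).uniformContinuousOn_of_continuous
      (Setup.continuousOn_meanIncr_θ₀ hM h1 h3 hb)) κ' hκ'0
  filter_upwards [Setup.integral_incr_YZ_sub_le hM h1 h2 h3 hb hκ'0, hW, eventually_ge_atTop 1,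
    h4.weighted_sum_le (half_pos ha) (show 0 < κ / (4 * B) by positivity)]
    with T hbias hWT hT1 hweight u hu ρ hρ
  have hTpos : (0 : ℝ) < T := by exact_mod_cast hT1
  have key := hweight u (2 * B) (κ' + κ')
    (fun t => (∫ ω, M.incr b (M.YZ T t ω) ρ ∂M.P) - M.meanIncr b u (M.θ₀ u) ρ)
    (by positivity) (fun t _ => ?_) (fun t ht htu => ?_)
  · have heq : 1 / (T * M.h T) * ∑ t ∈ Finset.Icc 1 T, (∫ ω, M.incr b (M.YZ T t ω) ρ ∂M.P) *
          M.K ((u - (t : ℝ) / T) / M.h T) -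
        M.meanIncr b u (M.θ₀ u) ρ * kernelWeight M.K (M.h T) T u =
        1 / (T * M.h T) * ∑ t ∈ Finset.Icc 1 T, ((∫ ω, M.incr b (M.YZ T t ω) ρ ∂M.P) -
          M.meanIncr b u (M.θ₀ u) ρ) * M.K ((u - (t : ℝ) / T) / M.h T) := by
      simp only [sub_mul, Finset.sum_sub_distrib, ← Finset.mul_sum, kernelWeight]
      ring
    rw [heq]
    refine key.trans ?_
    have e1 : (κ' + κ') * kernelWeight M.K (M.h T) T u ≤ (κ' + κ') * W :=
      mul_le_mul_of_nonneg_left (hWT u) (by positivity)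
    have e2 : (κ' + κ') * W = κ / 2 := by rw [hκ']; field_simp; ring
    have e3 : 2 * B * (κ / (4 * B)) = κ / 2 := by field_simp; ring
    linarith
  · have e1 : |∫ ω, M.incr b (M.YZ T t ω) ρ ∂M.P| ≤ B := by
      have := norm_integral_le_of_norm_le_const (μ := M.P)
        (f := fun ω => M.incr b (M.YZ T t ω) ρ) (Eventually.of_forall fun ω => hB _ ρ hρ)
      simpa using this
    have e2 := Setup.abs_meanIncr_le hM h1 hB u (M.θ₀ u) hρ
    linarith [abs_sub (∫ ω, M.incr b (M.YZ T t ω) ρ ∂M.P) (M.meanIncr b u (M.θ₀ u) ρ)]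
  · obtain ⟨ht1, htT⟩ := Finset.mem_Icc.1 ht
    have hs : (t : ℝ) / T ∈ Icc (0 : ℝ) 1 :=
      ⟨by positivity, (div_le_one hTpos).2 (by exact_mod_cast htT)⟩
    have e1 := hbias t ht ρ hρ
    have e2 := hcont ((t : ℝ) / T, ρ) ⟨hs, hρ⟩ (u, ρ) ⟨hu, hρ⟩ (by
      rw [Prod.dist_eq, dist_self, Real.dist_eq, abs_sub_comm, max_eq_left (abs_nonneg _)]
      linarith)
    rw [Real.dist_eq] at e2
    exact (abs_sub_le _ _ _).trans (add_le_add e1 e2.le)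

lemma Setup.abs_centered_sub_le (hM : M.Basic) (h4 : M.KernelAssumption m k)
    {ψ ψ' : ℝ × Euc dz → ℝ} {T : ℕ} (hi : ∀ t, Integrable (fun ω => ψ (M.YZ T t ω)) M.P)
    (hi' : ∀ t, Integrable (fun ω => ψ' (M.YZ T t ω)) M.P) {ε : ℝ} (hε : ∀ p, |ψ p - ψ' p| ≤ ε)
    (hT : 1 ≤ T) (u : ℝ) (ω : Ω) :
    |M.centered ψ T u ω - M.centered ψ' T u ω| ≤ 2 * ε * kernelWeight M.K (M.h T) T u := by
  have hTpos : (0 : ℝ) < T := by exact_mod_cast hT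
  have hh := h4.h_pos T hT
  have heq : M.centered ψ T u ω - M.centered ψ' T u ω = M.centered (fun p => ψ p - ψ' p) T u ω := by
    simp only [Setup.centered]
    rw [← mul_sub, ← Finset.sum_sub_distrib]
    congr 1
    refine Finset.sum_congr rfl fun t _ => ?_
    rw [integral_sub (hi t) (hi' t)]
    ring
  rw [heq, Setup.centered, kernelWeight, abs_mul,
    abs_of_pos (show (0 : ℝ) < 1 / (T * M.h T) by positivity), mul_left_comm]
  refine mul_le_mul_of_nonneg_left ?_ (by positivity)
  rw [Finset.mul_sum]
  refine (Finset.abs_sum_le_sum_abs _ _).trans (Finset.sum_le_sum fun t _ => ?_)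
  rw [abs_mul, abs_of_nonneg (h4.nonneg _)]
  exact mul_le_mul_of_nonneg_right
    (Setup.abs_sub_integral_le hM (ψ := fun p => ψ p - ψ' p) hε T t ω) (h4.nonneg _)

/-- Uniformity in `ρ` costs only a finite net of `Γ`, because increments are Lipschitz in `ρ`
uniformly in the data and the total weight is bounded. -/
lemma Setup.asympSure_centered_incr (hM : M.Basic) (h2 : M.DependenceAssumption m)
    (h3 : M.AuxiliaryAssumption M₀ ρ₀ ρ₀s ε₀) (h4 : M.KernelAssumption m k) {b : Euc dρ}
    (hb : b ∈ M.Γ) {η : ℝ} (hη : 0 < η) :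
    AsympSure M.P fun T ω => ∀ u ∈ Icc (0 : ℝ) 1, ∀ ρ ∈ M.Γ,
      |M.centered (fun p => M.incr b p ρ) T u ω| ≤ η := by
  obtain ⟨B, hB0, hB⟩ := h3.incr_bounded hM hb
  obtain ⟨L, hL0, hL⟩ := h3.incr_lipschitz hM hb
  obtain ⟨W, hW0, hW⟩ := h4.exists_weight_le
  set r := η / (4 * (L + 1) * W) with hr
  have hr0 : 0 < r := by positivity
  have hLr : 2 * (L * r) * W ≤ η / 2 := by
    rw [hr]
    have : L * (η / (4 * (L + 1) * W)) = L / (L + 1) * (η / (4 * W)) := by field_simp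
    rw [this]
    have h5 : L / (L + 1) ≤ 1 := (div_le_one (by positivity)).2 (by linarith)
    have h6 : 2 * (η / (4 * W)) * W = η / 2 := by field_simp; ring
    calc 2 * (L / (L + 1) * (η / (4 * W))) * W = L / (L + 1) * (2 * (η / (4 * W)) * W) := by ring
      _ ≤ 1 * (2 * (η / (4 * W)) * W) := by gcongr
      _ = η / 2 := by rw [one_mul, h6]
  obtain ⟨s, hsΓ, hsf, hcov⟩ := h3.compact_Γ.finite_cover_balls hr0
  refine (AsympSure.forall_finset hsf.toFinset fun ρ hρ => Setup.asympSure_centered hM h2 h4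
    (h3.measurable_incr hM hb (hsΓ (hsf.mem_toFinset.1 hρ))) hB0
    (fun p => hB p ρ (hsΓ (hsf.mem_toFinset.1 hρ))) (half_pos hη)).mono ?_
  filter_upwards [hW, eventually_ge_atTop 1] with T hWT hT1 ω hω u hu ρ hρ
  obtain ⟨ρ', hρ', hd⟩ := mem_iUnion₂.1 (hcov hρ)
  have hρ'Γ := hsΓ hρ'
  have h5 := hω ρ' (hsf.mem_toFinset.2 hρ') u hu
  have h6 := Setup.abs_centered_sub_le hM h4 (T := T) (ψ := fun p => M.incr b p ρ)
    (ψ' := fun p => M.incr b p ρ')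
    (Setup.integrable_incr_YZ hM h3 hb hρ T) (Setup.integrable_incr_YZ hM h3 hb hρ'Γ T)
    (ε := L * r) (fun p => ?_) hT1 u ω
  · have h7 : 2 * (L * r) * kernelWeight M.K (M.h T) T u ≤ 2 * (L * r) * W :=
      mul_le_mul_of_nonneg_left (hWT u) (by positivity)
    have h8 := abs_sub_abs_le_abs_sub (M.centered (fun p => M.incr b p ρ) T u ω)
      (M.centered (fun p => M.incr b p ρ') T u ω)
    linarith
  · have h7 := hL p p ρ hρ ρ' hρ'Γ
    rw [sub_self, norm_zero, zero_add] at h7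
    refine h7.trans (mul_le_mul_of_nonneg_left ?_ hL0)
    rw [← dist_eq_norm]
    exact (Metric.mem_ball.1 hd).le

lemma Setup.crit_sub (M : Setup Ω S dθ dρ dz) (T : ℕ) (ω : Ω) (u : ℝ) (b ρ : Euc dρ) :
    M.crit T ω u ρ - M.crit T ω u b = 1 / (T * M.h T) * ∑ t ∈ Finset.Icc 1 T,
      M.incr b (M.YZ T t ω) ρ * M.K ((u - (t : ℝ) / T) / M.h T) := by
  rw [Setup.crit, Setup.crit, ← mul_sub, ← Finset.sum_sub_distrib]
  congr 1
  exact Finset.sum_congr rfl fun t _ => (sub_mul _ _ _).symm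

/-- Uniform convergence of the increments of the observed criterion. -/
lemma Setup.asympSure_crit_sub (hM : M.Basic) (h1 : M.StructuralAssumption)
    (h2 : M.DependenceAssumption m) (h3 : M.AuxiliaryAssumption M₀ ρ₀ ρ₀s ε₀)
    (h4 : M.KernelAssumption m k) {b : Euc dρ} (hb : b ∈ M.Γ) {η : ℝ} (hη : 0 < η) :
    AsympSure M.P fun T ω => ∀ u ∈ Icc (0 : ℝ) 1, ∀ ρ ∈ M.Γ,
      |M.crit T ω u ρ - M.crit T ω u b -
        M.meanIncr b u (M.θ₀ u) ρ * kernelWeight M.K (M.h T) T u| ≤ η := by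
  refine (Setup.asympSure_centered_incr hM h2 h3 h4 hb (half_pos hη)).mono ?_
  filter_upwards [Setup.kernel_average_meanIncr hM h1 h2 h3 h4 hb (half_pos hη)]
    with T hT ω hω u hu ρ hρ
  have h5 := hω u hu ρ hρ
  have h6 := hT u hu ρ hρ
  have heq : M.crit T ω u ρ - M.crit T ω u b = M.centered (fun p => M.incr b p ρ) T u ω +
      1 / (T * M.h T) * ∑ t ∈ Finset.Icc 1 T, (∫ ω, M.incr b (M.YZ T t ω) ρ ∂M.P) *
          M.K ((u - (t : ℝ) / T) / M.h T) := by
    rw [Setup.crit_sub, Setup.centered, ← mul_add, ← Finset.sum_add_distrib]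
    congr 1
    exact Finset.sum_congr rfl fun t _ => by ring
  rw [heq, add_sub_assoc]
  exact (abs_add_le _ _).trans (by linarith)

/-- The observed criterion orders the parameters as the mean increment does, up to small errors. -/
lemma Setup.crit_order (hM : M.Basic) (h1 : M.StructuralAssumption)
    (h2 : M.DependenceAssumption m) (h3 : M.AuxiliaryAssumption M₀ ρ₀ ρ₀s ε₀)
    (h4 : M.KernelAssumption m k) {b : Euc dρ} (hb : b ∈ M.Γ) {η : ℝ} (hη : 0 < η) :
    AsympSure M.P fun T ω => ∀ u ∈ M.U, ∀ ρ ∈ M.Γ, ∀ ρ' ∈ M.Γ,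
      M.crit T ω u ρ ≤ M.crit T ω u ρ' →
        M.meanIncr b u (M.θ₀ u) ρ ≤ M.meanIncr b u (M.θ₀ u) ρ' + η := by
  obtain ⟨c, hc0, hc⟩ := h4.exists_le_weight
  refine (Setup.asympSure_crit_sub hM h1 h2 h3 h4 hb (η := c * η / 2) (by positivity)).mono ?_
  filter_upwards [hc] with T hcT ω hω u hu ρ hρ ρ' hρ' hle
  have hu' := Setup.U_subset hM hu
  have h5 := (abs_le.1 (hω u hu' ρ hρ)).1
  have h6 := (abs_le.1 (hω u hu' ρ' hρ')).2
  have hw := hcT u hu'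
  have hw0 : 0 < kernelWeight M.K (M.h T) T u := hc0.trans_le hw
  -- The weight has no known limit but is at least `c`, so two errors of cη/2 become at most η after
  -- division by it.
  refine le_of_mul_le_mul_right (a := kernelWeight M.K (M.h T) T u) ?_ hw0
  have h7 : c * η ≤ kernelWeight M.K (M.h T) T u * η := mul_le_mul_of_nonneg_right hw hη.le
  nlinarith

/-- Integrability is assumed only near pseudo-true values; a bounded increment carries it to all of
`Γ`. -/
lemma Setup.integrable_G_YZ (hM : M.Basic) (h3 : M.AuxiliaryAssumption M₀ ρ₀ ρ₀s ε₀)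
    (hρ₀ : ∀ u ∈ M.U, ρ₀ u ∈ M.Γ) {ρ : Euc dρ} (hρ : ρ ∈ M.Γ) {T t : ℕ}
    (ht : t ∈ Finset.Icc 1 T) : Integrable (fun ω => M.G (M.Y T t ω) (M.Z T t ω) ρ) M.P := by
  obtain ⟨u, hu⟩ := Setup.nonempty_U hM
  obtain ⟨C, hC⟩ := h3.G_int u hu T t ht
  have h5 := (hC (ρ₀ u) ⟨hρ₀ u hu, by simp [h3.ε₀_pos.le]⟩).1
  refine (h5.add (Setup.integrable_incr_YZ hM h3 (hρ₀ u hu) hρ T t)).congr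
    (Eventually.of_forall fun ω => ?_)
  simp only [Pi.add_apply, Setup.incr, Setup.YZ]
  ring

lemma Setup.integral_crit_sub (hM : M.Basic) (h3 : M.AuxiliaryAssumption M₀ ρ₀ ρ₀s ε₀)
    (hρ₀ : ∀ u ∈ M.U, ρ₀ u ∈ M.Γ) {b : Euc dρ} (hb : b ∈ M.Γ) {ρ : Euc dρ} (hρ : ρ ∈ M.Γ) (T : ℕ)
    (u : ℝ) : (∫ ω, M.crit T ω u ρ ∂M.P) - ∫ ω, M.crit T ω u b ∂M.P =
      1 / (T * M.h T) * ∑ t ∈ Finset.Icc 1 T, (∫ ω, M.incr b (M.YZ T t ω) ρ ∂M.P) *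
          M.K ((u - (t : ℝ) / T) / M.h T) := by
  have hi : ∀ ρ ∈ M.Γ, Integrable (fun ω => M.crit T ω u ρ) M.P := fun ρ hρ =>
    (integrable_finsetSum _ fun t ht =>
      (Setup.integrable_G_YZ hM h3 hρ₀ hρ ht).mul_const _).const_mul _
  rw [← integral_sub (hi ρ hρ) (hi b hb)]
  simp only [Setup.crit_sub]
  rw [integral_const_mul, integral_finsetSum _ fun t _ =>
    (Setup.integrable_incr_YZ hM h3 hb hρ T t).mul_const _]
  simp only [integral_mul_const]

/-- The pseudo-true value is the unique minimizer of the mean increment. -/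
lemma Setup.eq_of_meanIncr_le (hM : M.Basic) (h1 : M.StructuralAssumption)
    (h2 : M.DependenceAssumption m) (h3 : M.AuxiliaryAssumption M₀ ρ₀ ρ₀s ε₀)
    (h4 : M.KernelAssumption m k) (hM₀ : M.IsLimitCrit M₀) (hρ₀ : ∀ u ∈ M.U, ρ₀ u ∈ M.Γ)
    {b : Euc dρ} (hb : b ∈ M.Γ) {u : ℝ} (hu : u ∈ M.U) {ρ : Euc dρ} (hρ : ρ ∈ M.Γ)
    (hle : M.meanIncr b u (M.θ₀ u) ρ ≤ M.meanIncr b u (M.θ₀ u) (ρ₀ u)) : ρ = ρ₀ u := by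
  by_contra hne
  have hpos : 0 < ‖ρ - ρ₀ u‖ := norm_pos_iff.2 (sub_ne_zero.2 hne)
  obtain ⟨η, hη, hsep⟩ := h3.separated u hu _ (half_pos hpos)
  have hgap := hsep ρ hρ (half_lt_self hpos)
  obtain ⟨c, hc0, hc⟩ := h4.exists_le_weight
  have hu' := Setup.U_subset hM hu
  have hlim := (hM₀ u hu ρ (hM.Γ_sub_O hρ)).sub (hM₀ u hu (ρ₀ u) (hM.Γ_sub_O (hρ₀ u hu)))
  -- The difference of expected criteria is the nonpositive difference of mean increments times a
  -- positive weight, up to 2 · η/4. Its limit would therefore be at most η/2, against the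
  -- separation gap η.
  have hev : ∀ᶠ T : ℕ in atTop,
      (∫ ω, M.crit T ω u ρ ∂M.P) - ∫ ω, M.crit T ω u (ρ₀ u) ∂M.P ≤ η / 2 := by
    filter_upwards [Setup.kernel_average_meanIncr hM h1 h2 h3 h4 hb
      (show 0 < η / 4 by positivity), hc] with T hT hcT
    have h5 := (abs_le.1 (hT u hu' ρ hρ)).2
    have h6 := (abs_le.1 (hT u hu' _ (hρ₀ u hu))).1
    rw [← Setup.integral_crit_sub hM h3 hρ₀ hb hρ] at h5
    rw [← Setup.integral_crit_sub hM h3 hρ₀ hb (hρ₀ u hu)] at h6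
    have h7 := mul_le_mul_of_nonneg_right hle (hc0.le.trans (hcT u hu'))
    linarith
  have := le_of_tendsto hlim hev
  linarith

end Observed

end LII

namespace LII

/-! ### Existence and local uniqueness of minimizers -/

section Minimizers

variable {Ω S : Type*} [MeasurableSpace Ω] [MeasurableSpace S] {dθ dρ dz : ℕ}
  {M : Setup Ω S dθ dρ dz} {M₀ : Euc dρ → ℝ → ℝ} {ρ₀ : ℝ → Euc dρ}
  {ρ₀s : ℝ → Euc dθ → Euc dρ} {ε₀ : ℝ}

lemma Setup.AuxiliaryAssumption.differentiableAt_G (hM : M.Basic)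
    (h3 : M.AuxiliaryAssumption M₀ ρ₀ ρ₀s ε₀) (y : ℝ) (z : Euc dz) {ρ : Euc dρ} (hρ : ρ ∈ M.Γ) :
    DifferentiableAt ℝ (fun ρ' => M.G y z ρ') ρ := by
  have hopen : IsOpen (univ ×ˢ univ ×ˢ M.O : Set (ℝ × Euc dz × Euc dρ)) :=
    isOpen_univ.prod (isOpen_univ.prod hM.open_O)
  have hmem : (y, z, ρ) ∈ (univ ×ˢ univ ×ˢ M.O : Set (ℝ × Euc dz × Euc dρ)) :=
    ⟨trivial, trivial, hM.Γ_sub_O hρ⟩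
  have h : DifferentiableAt ℝ (fun p : ℝ × Euc dz × Euc dρ => M.G p.1 p.2.1 p.2.2) (y, z, ρ) :=
    (h3.G_smooth.differentiableOn two_ne_zero _ hmem).differentiableAt (hopen.mem_nhds hmem)
  exact h.comp ρ (f := fun ρ' : Euc dρ => (y, z, ρ')) (by fun_prop)

/-- General weights cover both criteria: kernel weights for the data, unit weights for the
simulation. -/
lemma Setup.AuxiliaryAssumption.hasGradientAt_sum (hM : M.Basic)
    (h3 : M.AuxiliaryAssumption M₀ ρ₀ ρ₀s ε₀) {ι : Type*} (s : Finset ι) (y : ι → ℝ)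
    (z : ι → Euc dz) (w : ι → ℝ) (c : ℝ) {ρ : Euc dρ} (hρ : ρ ∈ M.Γ) :
    HasGradientAt (fun ρ' => c * ∑ i ∈ s, M.G (y i) (z i) ρ' * w i)
      (c • ∑ i ∈ s, w i • M.q (y i) (z i) ρ) ρ := by
  have hterm : ∀ i ∈ s, HasFDerivAt (fun ρ' => M.G (y i) (z i) ρ' * w i)
      (w i • (InnerProductSpace.toDual ℝ (Euc dρ)) (M.q (y i) (z i) ρ)) ρ := fun i _ =>
    (h3.differentiableAt_G hM (y i) (z i) hρ).hasGradientAt.hasFDerivAt.mul_const (w i)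
  rw [hasGradientAt_iff_hasFDerivAt]
  have heq : (InnerProductSpace.toDual ℝ (Euc dρ)) (c • ∑ i ∈ s, w i • M.q (y i) (z i) ρ) =
      c • ∑ i ∈ s, w i • (InnerProductSpace.toDual ℝ (Euc dρ)) (M.q (y i) (z i) ρ) := by
    rw [map_smulₛₗ, map_sum]
    simp only [map_smulₛₗ, RCLike.conj_to_real]
  rw [heq]
  exact (HasFDerivAt.fun_sum hterm).const_mul c

lemma Setup.AuxiliaryAssumption.exists_minimizer (hM : M.Basic)
    (h3 : M.AuxiliaryAssumption M₀ ρ₀ ρ₀s ε₀) (hΓ : M.Γ.Nonempty) {ι : Type*} (s : Finset ι)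
    (y : ι → ℝ) (z : ι → Euc dz) (w : ι → ℝ) (c : ℝ) :
    ∃ ρ, M.IsArgmin (fun ρ' => c * ∑ i ∈ s, M.G (y i) (z i) ρ' * w i) ρ := by
  obtain ⟨ρ, hρ, hmin⟩ := h3.compact_Γ.exists_isMinOn hΓ (fun ρ hρ =>
    (h3.hasGradientAt_sum hM s y z w c hρ).continuousAt.continuousWithinAt)
  exact ⟨ρ, hρ, fun ρ' hρ' => hmin hρ'⟩

/-- Positively weighted sums of the criteria have at most one minimizer on a convex set on which the
score is strictly monotone. -/
lemma Setup.AuxiliaryAssumption.minimizer_unique (hM : M.Basic)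
    (h3 : M.AuxiliaryAssumption M₀ ρ₀ ρ₀s ε₀) {ι : Type*} {s : Finset ι} {y : ι → ℝ}
    {z : ι → Euc dz} {w : ι → ℝ} {c : ℝ} (hc : 0 < c) (hw : ∀ i ∈ s, 0 ≤ w i)
    (hw' : ∃ i ∈ s, 0 < w i) {N : Set (Euc dρ)} (hN : N ⊆ M.Γ) (hconv : Convex ℝ N)
    (hmono : ∀ (y : ℝ) (z : Euc dz), ∀ ρ₁ ∈ N, ∀ ρ₂ ∈ N, ρ₁ ≠ ρ₂ →
      0 < inner ℝ (M.q y z ρ₁ - M.q y z ρ₂) (ρ₁ - ρ₂)) {ρ₁ ρ₂ : Euc dρ} (h₁ : ρ₁ ∈ N) (h₂ : ρ₂ ∈ N)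
    (hm₁ : ∀ ρ ∈ N, c * ∑ i ∈ s, M.G (y i) (z i) ρ₁ * w i ≤ c * ∑ i ∈ s, M.G (y i) (z i) ρ * w i)
    (hm₂ : ∀ ρ ∈ N, c * ∑ i ∈ s, M.G (y i) (z i) ρ₂ * w i ≤ c * ∑ i ∈ s, M.G (y i) (z i) ρ * w i) :
    ρ₁ = ρ₂ := by
  refine minimizer_unique_of_gradient_strictMono hconv
    (fun ρ hρ => h3.hasGradientAt_sum hM s y z w c (hN hρ)) (fun a ha b hb hab => ?_) h₁ h₂ hm₁ hm₂
  obtain ⟨j, hj, hwj⟩ := hw'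
  rw [← smul_sub, ← Finset.sum_sub_distrib, real_inner_smul_left, sum_inner]
  refine mul_pos hc (Finset.sum_pos' (fun i hi => ?_) ⟨j, hj, ?_⟩)
  · rw [← smul_sub, real_inner_smul_left]
    exact mul_nonneg (hw i hi) (hmono _ _ a ha b hb hab).le
  · rw [← smul_sub, real_inner_smul_left]
    exact mul_pos hwj (hmono _ _ a ha b hb hab)

lemma Setup.simCrit_eq (M : Setup Ω S dθ dρ dz) (T : ℕ) (ω : Ω) (u : ℝ) (θ : Euc dθ) :
    M.simCrit T ω u θ = fun ρ => 1 / (T : ℝ) * ∑ t ∈ Finset.Icc 1 T,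
      M.G (M.y M.νsim θ t ω) (M.z M.νsim u θ t ω) ρ * 1 := by
  funext ρ
  simp [Setup.simCrit]

end Minimizers

lemma isLittleOp_of_asympSure {Ω E : Type*} [MeasurableSpace Ω] {P : Measure Ω}
    [IsFiniteMeasure P] {X : Set E} {D : ℕ → Ω → E → ℝ}
    (h : ∀ ε > 0, AsympSure P fun T ω => ∀ x ∈ X, D T ω x < ε) :
    IsLittleOp P fun T ω => ⨆ x ∈ X, ENNReal.ofReal (D T ω x) := by
  intro ε hε
  -- A finite level strictly below ε handles ε = ∞ and absorbs the loss of strictness in the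
  -- supremum.
  obtain ⟨r, hr0, hr⟩ := ENNReal.lt_iff_exists_nnreal_btwn.1 hε
  have hr0' : (0 : ℝ) < r := by exact_mod_cast hr0
  refine tendsto_of_tendsto_of_tendsto_of_le_of_le tendsto_const_nhds
    (h r hr0').tendsto_measure_not (fun _ => zero_le) fun T => measure_mono fun ω hω hcon => ?_
  have hle : (⨆ x ∈ X, ENNReal.ofReal (D T ω x)) ≤ r := iSup₂_le fun x hx => by
    rw [← ENNReal.ofReal_coe_nnreal]
    exact ENNReal.ofReal_le_ofReal (hcon x hx).le
  exact absurd (lt_of_le_of_lt hle hr) (not_lt.2 hω)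

end LII

/-! ### Existence, uniqueness and uniform consistency of the minimizers. -/

theorem theorem1 {Ω S : Type*} [MeasurableSpace Ω] [MeasurableSpace S] {dθ dρ dz : ℕ}
    (M : LII.Setup Ω S dθ dρ dz) (m : ℕ → ℕ) (k : ℕ) (ε₀ : ℝ)
    (M₀ : LII.Euc dρ → ℝ → ℝ) (M₀s : LII.Euc dρ → ℝ → LII.Euc dθ → ℝ)
    (ρ₀ : ℝ → LII.Euc dρ) (ρ₀s : ℝ → LII.Euc dθ → LII.Euc dρ)
    (hM : M.Basic)
    -- the limit criteria and the pseudo-true values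
    (hM₀ : M.IsLimitCrit M₀) (hM₀s : M.IsSimLimitCrit M₀s)
    (hρ₀ : ∀ u ∈ M.U, M.IsArgmin (fun ρ => M₀ ρ u) (ρ₀ u))
    (hρ₀s : ∀ u ∈ M.U, ∀ θ ∈ M.Θ, ∀ ρ, M.IsArgmin (fun ρ' => M₀s ρ' u θ) ρ ↔ ρ = ρ₀s u θ)
    (h1 : M.StructuralAssumption) (h2 : M.DependenceAssumption m) (h3 : M.AuxiliaryAssumption M₀ ρ₀ ρ₀s ε₀)
    (h4 : M.KernelAssumption m k) :
    -- existence, always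
    (∀ T ω, ∀ u ∈ M.U, ∃ ρ, M.IsArgmin (M.crit T ω u) ρ) ∧
    (∀ T ω, ∀ u ∈ M.U, ∀ θ ∈ M.Θ, ∃ ρ, M.IsArgmin (M.simCrit T ω u θ) ρ) ∧
    -- uniqueness: almost surely, for all large `T`, at all points simultaneously
    (∀ᵐ ω ∂M.P, ∀ᶠ T in atTop, ∀ u ∈ M.U, ∃! ρ, M.IsArgmin (M.crit T ω u) ρ) ∧
    (∀ᵐ ω ∂M.P, ∀ᶠ T in atTop, ∀ u ∈ M.U, ∀ θ ∈ M.Θ,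
      ∃! ρ, M.IsArgmin (M.simCrit T ω u θ) ρ) ∧
    -- uniform consistency of the estimator from the observed data
    (∀ ρhat : ℕ → Ω → ℝ → LII.Euc dρ,
      (∀ T ω, ∀ u ∈ M.U, M.IsArgmin (M.crit T ω u) (ρhat T ω u)) →
      LII.IsLittleOp M.P (fun T ω => ⨆ u ∈ M.U, ENNReal.ofReal ‖ρhat T ω u - ρ₀ u‖)) ∧
    -- uniform consistency of the estimator from the simulated data
    (∀ ρhat : ℕ → Ω → ℝ → LII.Euc dθ → LII.Euc dρ,
      (∀ T ω, ∀ u ∈ M.U, ∀ θ ∈ M.Θ, M.IsArgmin (M.simCrit T ω u θ) (ρhat T ω u θ)) →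
      LII.IsLittleOp M.P (fun T ω => ⨆ u ∈ M.U, ⨆ θ ∈ M.Θ,
        ENNReal.ofReal ‖ρhat T ω u θ - ρ₀s u θ‖)) := by
  have hprob := hM.prob
  obtain ⟨u₀, hu₀⟩ := LII.Setup.nonempty_U hM
  have hρ₀Γ : ∀ u ∈ M.U, ρ₀ u ∈ M.Γ := fun u hu => (hρ₀ u hu).1
  set b := ρ₀ u₀ with hb_def
  have hb : b ∈ M.Γ := hρ₀Γ u₀ hu₀
  have hU : IsCompact M.U := isCompact_Icc
  have hUs := LII.Setup.U_subset hM
  -- existence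
  have hex : ∀ T ω, ∀ u ∈ M.U, ∃ ρ, M.IsArgmin (M.crit T ω u) ρ := fun T ω u _ =>
    h3.exists_minimizer hM ⟨b, hb⟩ (Finset.Icc 1 T) (fun t => M.Y T t ω) (fun t => M.Z T t ω) _ _
  have hexs : ∀ T ω, ∀ u ∈ M.U, ∀ θ ∈ M.Θ, ∃ ρ, M.IsArgmin (M.simCrit T ω u θ) ρ := by
    intro T ω u _ θ _
    rw [LII.Setup.simCrit_eq]
    exact h3.exists_minimizer hM ⟨b, hb⟩ (Finset.Icc 1 T) (fun t => M.y M.νsim θ t ω)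
      (fun t => M.z M.νsim u θ t ω) _ _
  -- the limit criterion of the observed data
  have hcont : ContinuousOn (fun p : ℝ × LII.Euc dρ => M.meanIncr b p.1 (M.θ₀ p.1) p.2)
      (M.U ×ˢ M.Γ) :=
    (LII.Setup.continuousOn_meanIncr_θ₀ hM h1 h3 hb).mono (prod_mono hUs Subset.rfl)
  have hmin : ∀ u ∈ M.U, ∀ ρ ∈ M.Γ,
      M.meanIncr b u (M.θ₀ u) ρ ≤ M.meanIncr b u (M.θ₀ u) (ρ₀ u) → ρ = ρ₀ u :=
    fun u hu ρ hρ => LII.Setup.eq_of_meanIncr_le hM h1 h2 h3 h4 hM₀ hρ₀Γ hb hu hρ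
  have horder := fun η (hη : 0 < η) => LII.Setup.crit_order hM h1 h2 h3 h4 hb hη
  -- the limit criterion of the simulated data
  have hUΘ : IsCompact (M.U ×ˢ M.Θ) := hU.prod h3.compact_Θ
  have hρ₀sm : ∀ x ∈ M.U ×ˢ M.Θ, M.IsArgmin (fun ρ' => M₀s ρ' x.1 x.2) (ρ₀s x.1 x.2) :=
    fun x hx => (hρ₀s x.1 hx.1 x.2 hx.2 _).2 rfl
  have hconts : ContinuousOn (fun p : (ℝ × LII.Euc dθ) × LII.Euc dρ =>
      M.meanIncr b p.1.1 p.1.2 p.2) ((M.U ×ˢ M.Θ) ×ˢ M.Γ) :=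
    (LII.Setup.continuousOn_meanIncr hM h1 h3 hb).mono
      (prod_mono (prod_mono hUs Subset.rfl) Subset.rfl)
  have hmins : ∀ x ∈ M.U ×ˢ M.Θ, ∀ ρ ∈ M.Γ,
      M.meanIncr b x.1 x.2 ρ ≤ M.meanIncr b x.1 x.2 (ρ₀s x.1 x.2) → ρ = ρ₀s x.1 x.2 := by
    intro x hx ρ hρ hle
    -- The limit criterion and `meanIncr` differ by a constant in ρ, so a point doing as well as the
    -- pseudo-true value is itself a minimizer.
    refine (hρ₀s x.1 hx.1 x.2 hx.2 ρ).1 ⟨hρ, fun ρ' hρ' => ?_⟩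
    have e1 := (hρ₀sm x hx).2 ρ' hρ'
    rw [← LII.Setup.simLimit_sub hM h1 h3 hM₀s hb hx.1 hx.2 hρ,
      ← LII.Setup.simLimit_sub hM h1 h3 hM₀s hb hx.1 hx.2 (hρ₀sm x hx).1] at hle
    simp only at e1 ⊢
    linarith
  have horders := fun η (hη : 0 < η) => LII.Setup.simCrit_order hM h1 h3 hb hη
  -- local uniqueness
  let good : Set (LII.Euc dρ) → Prop := fun N => Convex ℝ N ∧ ∀ (y : ℝ) (z : LII.Euc dz),
    ∀ ρ₁ ∈ N, ∀ ρ₂ ∈ N, ρ₁ ≠ ρ₂ → 0 < inner ℝ (M.q y z ρ₁ - M.q y z ρ₂) (ρ₁ - ρ₂)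
  have hgood : ∀ c, M.ScoreStrictMonoNear c → ∃ ε > 0, good {ρ ∈ M.Γ | dist ρ c ≤ ε} := by
    rintro c ⟨ε, hε, h5, h6⟩
    simp only [dist_eq_norm]
    exact ⟨ε, hε, h5, h6⟩
  obtain ⟨c, hc0, hc⟩ := h4.exists_le_weight
  have hloc : ∀ᶠ T in atTop, ∀ ω, ∀ u ∈ M.U, ∀ N ⊆ M.Γ, good N → ∀ ρ₁ ∈ N, ∀ ρ₂ ∈ N,
      (∀ ρ ∈ N, M.crit T ω u ρ₁ ≤ M.crit T ω u ρ) →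
      (∀ ρ ∈ N, M.crit T ω u ρ₂ ≤ M.crit T ω u ρ) → ρ₁ = ρ₂ := by
    filter_upwards [hc, eventually_ge_atTop 1] with T hcT hT1 ω u hu N hN hg ρ₁ h₁ ρ₂ h₂ hm₁ hm₂
    have hTpos : (0 : ℝ) < T := by exact_mod_cast hT1
    have hh := h4.h_pos T hT1
    refine h3.minimizer_unique hM (s := Finset.Icc 1 T) (y := fun t => M.Y T t ω)
      (z := fun t => M.Z T t ω) (w := fun t => M.K ((u - (t : ℝ) / T) / M.h T))
      (c := 1 / (T * M.h T)) (by positivity) (fun t _ => h4.nonneg _) ?_ hN hg.1 hg.2 h₁ h₂ hm₁ hm₂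
    -- If no observation had positive kernel weight, the total weight would contradict its lower
    -- bound.
    by_contra! hcon
    have h5 := hcT u (hUs hu)
    have h6 : LII.kernelWeight M.K (M.h T) T u ≤ 0 :=
      mul_nonpos_of_nonneg_of_nonpos (by positivity) (Finset.sum_nonpos hcon)
    linarith
  have hlocs : ∀ᶠ T in atTop, ∀ ω, ∀ x ∈ M.U ×ˢ M.Θ, ∀ N ⊆ M.Γ, good N → ∀ ρ₁ ∈ N, ∀ ρ₂ ∈ N,
      (∀ ρ ∈ N, M.simCrit T ω x.1 x.2 ρ₁ ≤ M.simCrit T ω x.1 x.2 ρ) →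
      (∀ ρ ∈ N, M.simCrit T ω x.1 x.2 ρ₂ ≤ M.simCrit T ω x.1 x.2 ρ) → ρ₁ = ρ₂ := by
    filter_upwards [eventually_ge_atTop 1] with T hT1 ω x hx N hN hg ρ₁ h₁ ρ₂ h₂ hm₁ hm₂
    have hTpos : (0 : ℝ) < T := by exact_mod_cast hT1
    rw [LII.Setup.simCrit_eq] at hm₁ hm₂
    exact h3.minimizer_unique hM (s := Finset.Icc 1 T) (y := fun t => M.y M.νsim x.2 t ω)
      (z := fun t => M.z M.νsim x.1 x.2 t ω) (w := fun _ => 1) (c := 1 / (T : ℝ)) (by positivity)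
      (fun _ _ => zero_le_one) ⟨1, Finset.mem_Icc.2 ⟨le_rfl, hT1⟩, one_pos⟩ hN hg.1 hg.2 h₁ h₂ hm₁ hm₂
  refine ⟨hex, hexs, ?_, ?_, fun ρhat hρhat => ?_, fun ρhat hρhat => ?_⟩
  · filter_upwards [(LII.AsympSure.argmin_unique hU h3.compact_Γ hcont hρ₀Γ hmin horder
      (fun u hu => hgood _ (h3.score_mono u hu)) hloc).ae_eventually] with ω hω
    filter_upwards [hω] with T hT u hu
    obtain ⟨ρ, hρ⟩ := hex T ω u hu
    exact ⟨ρ, hρ, fun ρ' hρ' => hT u hu ρ' hρ'.1 ρ hρ.1 hρ'.2 hρ.2⟩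
  · filter_upwards [(LII.AsympSure.argmin_unique hUΘ h3.compact_Γ hconts
      (fun x hx => (hρ₀sm x hx).1) hmins horders
      (fun x hx => hgood _ (h3.score_mono_sim x.1 hx.1 x.2 hx.2)) hlocs).ae_eventually] with ω hω
    filter_upwards [hω] with T hT u hu θ hθ
    obtain ⟨ρ, hρ⟩ := hexs T ω u hu θ hθ
    exact ⟨ρ, hρ, fun ρ' hρ' => hT (u, θ) ⟨hu, hθ⟩ ρ' hρ'.1 ρ hρ.1 hρ'.2 hρ.2⟩
  · refine LII.isLittleOp_of_asympSure fun ε hε => ?_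
    refine (LII.AsympSure.argmin_dist_lt hU h3.compact_Γ hcont hρ₀Γ hmin horder hε).mono
      (Eventually.of_forall fun T ω h u hu => ?_)
    rw [← dist_eq_norm]
    exact h u hu _ (hρhat T ω u hu).1 (hρhat T ω u hu).2
  · have hsup : ∀ T ω, (⨆ u ∈ M.U, ⨆ θ ∈ M.Θ, ENNReal.ofReal ‖ρhat T ω u θ - ρ₀s u θ‖) =
        ⨆ x ∈ M.U ×ˢ M.Θ, ENNReal.ofReal ‖ρhat T ω x.1 x.2 - ρ₀s x.1 x.2‖ := fun T ω =>
      (biSup_prod (f := fun x : ℝ × LII.Euc dθ =>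
        ENNReal.ofReal ‖ρhat T ω x.1 x.2 - ρ₀s x.1 x.2‖)).symm
    simp only [hsup]
    refine LII.isLittleOp_of_asympSure fun ε hε => ?_
    refine (LII.AsympSure.argmin_dist_lt hUΘ h3.compact_Γ hconts (fun x hx => (hρ₀sm x hx).1) hmins
      horders hε).mono (Eventually.of_forall fun T ω h x hx => ?_)
    rw [← dist_eq_norm]
    exact h x hx _ (hρhat T ω x.1 hx.1 x.2 hx.2).1 (hρhat T ω x.1 hx.1 x.2 hx.2).2
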